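/- **Representation formula for the biharmonic Schrödinger equation on the half space.** *Notation.* For $\kappa\in\mathbb R$, $\lambda\in\mathbb C$ put $$\widehat{v}(\kappa,\lambda)=\int_{\mathbb R}\int_0^\infty e^{-i\kappa x-i\lambda y}v(x,y)\,dy\,dx\ (\Im\lambda\le 0),\qquad \tilde g(\kappa,\eta,t)=\int_0^t e^{\eta\tau}\int_{\mathbb R}e^{-i\kappa x}g(x,\tau)\,dx\,d\tau,$$ $$E(\kappa,\lambda;x,y,t)=\exp\big(i(\kappa^2+\lambda^2)^2t+i\kappa x+i\lambda y\big).$$ For $0<\varepsilon<\pi/4$ let $\sqrt{z}^{*}=|z|^{1/2}e^{i\arg z/2}$ with $\arg z\in[\varepsilon,2\pi+\varepsilon)$, and $\nu_\kappa(\lambda)=\sqrt{-\lambda^2-2\kappa^2}^{*}$. With $\nu=\nu_\kappa(\lambda)$ and $\tilde g_j=\tilde g_j(\kappa,-i(\kappa^2+\lambda^2)^2,t)$ let $$G(\kappa,\lambda,t)=\frac{2\lambda}{\nu-\lambda}\widehat{u_0}(\kappa,-\nu)-\frac{\lambda+\nu}{\nu-\lambda}\widehat{u_0}(\kappa,-\lambda)+2(\lambda^2\nu+\lambda\nu^2)\tilde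 g_0+2i(\lambda^2+\lambda\nu)\tilde g_1 .$$ Let $D_\kappa^+=\{\lambda:\Im\lambda>0,\ \Re[i(\kappa^2+\lambda^2)^2]>0\}$, with $\partial D_\kappa^+$ oriented so that $D_\kappa^+$ lies on its left. Thus $\partial D_\kappa^+$ consists of the path $-\infty\to0\to i|\kappa|$ followed by the left half of the hyperbola branch $\Im\lambda=\sqrt{\kappa^2+(\Re\lambda)^2}$ traversed outwards, and of the path $i\infty\to i|\kappa|$ followed by the right half of that branch traversed outwards. Let $\Gamma_\kappa$ be the contour obtained from $\partial D_\kappa^+$ by replacing both half hyperbolas by rays in their asymptotic directions: $-\infty\to0\to i|\kappa|\to i|\kappa|+e^{3\pi i/4}\infty$ together with $i\infty\to0\to e^{i\pi/4}\infty$. Integrals over unbounded $\lambda$-contours are improper integrals, convergent at each end separately. *Statement.* There is an absolute integer $N$ such that the following holds. Let $T>0$, $0<\varepsilon<\pi/4$, and let $u$ be of class $C^N$ on $\mathbb R\times[0,\infty)\times[0,T]$ with $(1+|x|+|y|)^{N}|D^n u|$ bounded there for all $n\le N$. Suppose that $$iu_t+\Delta^2u=0\ \text{ in }\mathbb R\times(0,\infty)\times(0,T),\qquad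 u(x,0,t)=g_0(x,t),\quad u_y(x,0,t)=g_1(x,t)\quad(0<t<T),\qquad u(x,y,0)=u_0(x,y)\quad(y>0).$$ Then for all $x\in\mathbb R$, $y>0$, $0<t<T$: for every $\kappa\in\mathbb R$ the inner ($\lambda$-) integrals below converge, they are integrable functions of $\kappa$, and $$u(x,y,t)=\frac1{(2\pi)^2}\int_{-\infty}^\infty\int_{-\infty}^\infty E(\kappa,\lambda;x,y,t)\,\widehat{u_0}(\kappa,\lambda)\,d\lambda\,d\kappa+\frac1{(2\pi)^2}\int_{-\infty}^\infty\int_{\partial D_\kappa^+}E(\kappa,\lambda;x,y,t)\,G(\kappa,\lambda,t)\,d\lambda\,d\kappa .$$ Moreover, for every $\kappa$ the integral over $\Gamma_\kappa$ converges and $\int_{\partial D_\kappa^+}EG\,d\lambda=\int_{\Gamma_\kappa}EG\,d\lambda$, so that the formula also holds with $\partial D_\kappa^+$ replaced by $\Gamma_\kappa$. -/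

import Mathlib

open Set Filter Topology MeasureTheory

noncomputable section

namespace BiharmonicSchrodinger

/-! ### Domain, smoothness and decay, the initial-boundary value problem -/

/-- The closed space-time domain `ℝ × [0,∞) × [0,T]`; points are `(x, y, t)`. -/
def closedDomain (T : ℝ) : Set (ℝ × ℝ × ℝ) :=
  univ ×ˢ (Ici 0 ×ˢ Icc 0 T)

/-- `u` is `C^N` up to the boundary of the half space-time domain, and all its derivatives of
order at most `N` decay like `(1 + |x| + |y|)^{-N}`, uniformly in `t ∈ [0,T]`. -/
def SmoothDecaying (N : ℕ) (T : ℝ) (u : ℝ × ℝ × ℝ → ℂ) : Prop :=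
  ContDiffOn ℝ N u (closedDomain T) ∧
    ∀ n ≤ N, ∃ C : ℝ, ∀ x y t : ℝ, 0 ≤ y → 0 ≤ t → t ≤ T →
      (1 + |x| + |y|) ^ N *
        ‖iteratedFDerivWithin ℝ n u (closedDomain T) (x, y, t)‖ ≤ C

/-- `Δ²u = ∂ₓ⁴u + 2∂ₓ²∂ᵧ²u + ∂ᵧ⁴u` at `(x, y, t)`. -/
def biLaplacian (u : ℝ × ℝ × ℝ → ℂ) (x y t : ℝ) : ℂ :=
  iteratedDeriv 4 (fun ξ => u (ξ, y, t)) x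
    + 2 * iteratedDeriv 2 (fun ξ => iteratedDeriv 2 (fun η => u (ξ, η, t)) y) x
    + iteratedDeriv 4 (fun η => u (x, η, t)) y

/-- `i u_t + Δ²u = 0` in `ℝ × (0,∞) × (0,T)` with Dirichlet data `g₀`, Neumann data `g₁` and
initial datum `u₀`. -/
structure IsSolution (T : ℝ) (u₀ g₀ g₁ : ℝ → ℝ → ℂ) (u : ℝ × ℝ × ℝ → ℂ) : Prop where
  pde : ∀ x y t : ℝ, 0 < y → 0 < t → t < T →
    Complex.I * deriv (fun τ => u (x, y, τ)) t + biLaplacian u x y t = 0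
  dirichlet : ∀ x t : ℝ, 0 < t → t < T → u (x, 0, t) = g₀ x t
  neumann : ∀ x t : ℝ, 0 < t → t < T →
    derivWithin (fun η => u (x, η, t)) (Ici 0) 0 = g₁ x t
  initial : ∀ x y : ℝ, 0 < y → u (x, y, 0) = u₀ x y

/-! ### Transforms -/

/-- Half space Fourier transform (used for `κ` real and `Im l ≤ 0`). -/
def halfSpaceFT (v : ℝ → ℝ → ℂ) (κ : ℝ) (l : ℂ) : ℂ :=
  ∫ x : ℝ, ∫ y in Ioi (0 : ℝ), Complex.exp (-Complex.I * x * κ - Complex.I * y * l) * v x y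

/-- Fourier transform in `x` of a function of `(x, t)`. -/
def xFT (g : ℝ → ℝ → ℂ) (κ t : ℝ) : ℂ :=
  ∫ x : ℝ, Complex.exp (-Complex.I * x * κ) * g x t

/-- The `t`-transform `g̃(κ, η, t) = ∫₀ᵗ exp(η τ) ĝ(κ, τ) dτ`. -/
def tTransform (g : ℝ → ℝ → ℂ) (κ : ℝ) (η : ℂ) (t : ℝ) : ℂ :=
  ∫ τ in (0 : ℝ)..t, Complex.exp (η * τ) * xFT g κ τ

/-! ### The rotated square root, the map `ν_κ`, and the integrands -/

/-- The argument of `z` chosen in `[ε, 2π + ε)`. -/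
def argStar (ε : ℝ) (z : ℂ) : ℝ :=
  toIcoMod Real.two_pi_pos ε (Complex.arg z)

/-- The square root with branch cut rotated by `ε`: `|z|^{1/2} exp(i arg z / 2)`,
`arg z ∈ [ε, 2π + ε)`. -/
def sqrtStar (ε : ℝ) (z : ℂ) : ℂ :=
  (Real.sqrt ‖z‖ : ℂ) * Complex.exp (Complex.I * (argStar ε z / 2 : ℝ))

/-- `ν_κ(l) = √(-l² - 2κ²)` with the rotated branch. -/
def nu (ε κ : ℝ) (l : ℂ) : ℂ :=
  sqrtStar ε (-l ^ 2 - 2 * (κ : ℂ) ^ 2)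

/-- `E(κ, l; x, y, t) = exp(i(κ² + l²)² t + iκx + ily)`. -/
def E (κ : ℝ) (l : ℂ) (x y t : ℝ) : ℂ :=
  Complex.exp (Complex.I * ((κ : ℂ) ^ 2 + l ^ 2) ^ 2 * t + Complex.I * κ * x + Complex.I * l * y)

/-- The integrand `G(κ, l, t)`, built from `u₀`, `g₀`, `g₁` only. -/
def G (ε : ℝ) (u₀ g₀ g₁ : ℝ → ℝ → ℂ) (κ : ℝ) (l : ℂ) (t : ℝ) : ℂ :=
  (2 * l / (nu ε κ l - l) * halfSpaceFT u₀ κ (-nu ε κ l)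
      - (l + nu ε κ l) / (nu ε κ l - l) * halfSpaceFT u₀ κ (-l))
    + (2 * (l ^ 2 * nu ε κ l + l * nu ε κ l ^ 2)
          * tTransform g₀ κ (-Complex.I * ((κ : ℂ) ^ 2 + l ^ 2) ^ 2) t
      + 2 * Complex.I * (l ^ 2 + l * nu ε κ l)
          * tTransform g₁ κ (-Complex.I * ((κ : ℂ) ^ 2 + l ^ 2) ^ 2) t)

/-! ### Contours -/

/-- `I = ∫_γ f(l) dl` along the unbounded curve `γ : [0,∞) → ℂ`, as an improper integral:
integrable on each bounded piece `[0, R]`, and the integrals over `[0, R]` converge to `I`. -/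
def HasCurveIntegral (γ : ℝ → ℂ) (f : ℂ → ℂ) (I : ℂ) : Prop :=
  (∀ R : ℝ, 0 ≤ R → IntervalIntegrable (fun s => f (γ s) * deriv γ s) volume 0 R) ∧
    Tendsto (fun R : ℝ => ∫ s in (0 : ℝ)..R, f (γ s) * deriv γ s) atTop (𝓝 I)

/-- The half line from `0` to `-∞`. -/
def negAxis (s : ℝ) : ℂ := -s

/-- `I = ∫_{-∞}^{∞} f(l) dl` as an improper integral, convergent at both ends separately. -/
def HasRealLineIntegral (f : ℂ → ℂ) (I : ℂ) : Prop :=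
  ∃ I₁ I₂ : ℂ, HasCurveIntegral negAxis f I₁ ∧
    HasCurveIntegral (fun s => (s : ℂ)) f I₂ ∧ I = -I₁ + I₂

/-- `I = ∫ f(l) dl` along the segment from `0` to `i|κ|`. -/
def HasSegmentIntegral (κ : ℝ) (f : ℂ → ℂ) (I : ℂ) : Prop :=
  IntervalIntegrable (fun s : ℝ => f (s * Complex.I) * Complex.I) volume 0 |κ| ∧
    I = ∫ s in (0 : ℝ)..|κ|, f (s * Complex.I) * Complex.I

/-- `D_κ = {l : Re[i(κ² + l²)²] > 0}`. -/
def D (κ : ℝ) : Set ℂ :=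
  {l | 0 < (Complex.I * ((κ : ℂ) ^ 2 + l ^ 2) ^ 2).re}

/-- `D_κ⁺ = D_κ ∩ ℂ₊`. -/
def DPlus (κ : ℝ) : Set ℂ :=
  D κ ∩ {l | 0 < l.im}

theorem mem_DPlus (κ : ℝ) (l : ℂ) :
    l ∈ DPlus κ ↔ l.re * (κ ^ 2 + l.re ^ 2 - l.im ^ 2) < 0 ∧ 0 < l.im := by
  have h : (Complex.I * ((κ : ℂ) ^ 2 + l ^ 2) ^ 2).re
      = -(4 * l.im * (l.re * (κ ^ 2 + l.re ^ 2 - l.im ^ 2))) := by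
    simp [pow_two]
    ring
  simp only [DPlus, D, mem_inter_iff, mem_ofPred_eq, h]
  constructor
  · rintro ⟨h1, h2⟩
    exact ⟨by by_contra h3; push Not at h3; nlinarith [mul_nonneg h2.le h3], h2⟩
  · rintro ⟨h1, h2⟩
    exact ⟨by nlinarith [mul_pos h2 (neg_pos.2 h1)], h2⟩

theorem closure_DPlus (κ : ℝ) : closure (DPlus κ) =
    {l | 0 ≤ l.im ∧ ((0 ≤ l.re ∧ κ ^ 2 + l.re ^ 2 ≤ l.im ^ 2) ∨
      (l.re ≤ 0 ∧ l.im ^ 2 ≤ κ ^ 2 + l.re ^ 2))} := by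
  apply Subset.antisymm
  · apply closure_minimal
    · intro l hl
      rw [mem_DPlus] at hl
      refine ⟨hl.2.le, ?_⟩
      rcases le_total 0 l.re with h | h
      · left
        refine ⟨h, ?_⟩
        by_contra h3
        push Not at h3
        nlinarith [mul_nonneg h (sub_nonneg.2 h3.le)]
      · right
        refine ⟨h, ?_⟩
        by_contra h3
        push Not at h3
        nlinarith [mul_nonneg (neg_nonneg.2 h) (sub_nonneg.2 h3.le)]
    · have c1 : Continuous (fun l : ℂ => κ ^ 2 + l.re ^ 2) := by fun_prop
      have c2 : Continuous (fun l : ℂ => l.im ^ 2) := by fun_prop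
      exact (isClosed_le continuous_const Complex.continuous_im).inter
        (((isClosed_le continuous_const Complex.continuous_re).inter (isClosed_le c1 c2)).union
          ((isClosed_le Complex.continuous_re continuous_const).inter (isClosed_le c2 c1)))
  · rintro l ⟨h0, h⟩
    have key : ∀ p q : ℝ, (∀ δ : ℝ, 0 < δ → l + δ * (p + q * Complex.I) ∈ DPlus κ) →
        l ∈ closure (DPlus κ) := by
      intro p q hpq
      have hc : Continuous (fun δ : ℝ => l + δ * (p + q * Complex.I)) := by fun_prop
      have ht : Tendsto (fun δ : ℝ => l + δ * (p + q * Complex.I)) (𝓝[>] 0) (𝓝 l) := by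
        have := hc.tendsto 0
        simp only [Complex.ofReal_zero, zero_mul, add_zero] at this
        exact this.mono_left nhdsWithin_le_nhds
      exact mem_closure_of_tendsto ht (by filter_upwards [self_mem_nhdsWithin] with δ hδ using hpq δ hδ)
    rcases h with ⟨h1, h2⟩ | ⟨h1, h2⟩
    · have h3 : l.re ≤ l.im := by nlinarith [sq_nonneg κ]
      apply key 1 2
      intro δ hδ
      rw [mem_DPlus]
      simp
      constructor
      · apply mul_neg_of_pos_of_neg <;> nlinarith [mul_nonneg hδ.le h1, mul_nonneg hδ.le h0, mul_pos hδ hδ, mul_nonneg hδ.le (sub_nonneg.2 h3)]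
      · nlinarith
    · rcases h0.lt_or_eq with h3 | h3
      · apply key (-1) 0
        intro δ hδ
        rw [mem_DPlus]
        simp
        exact ⟨mul_neg_of_neg_of_pos (by linarith)
          (by nlinarith [mul_nonneg hδ.le (neg_nonneg.2 h1)]), h3⟩
      · apply key (-2) 1
        intro δ hδ
        rw [mem_DPlus]
        simp [← h3]
        exact ⟨mul_neg_of_neg_of_pos (by linarith)
          (by nlinarith [mul_nonneg hδ.le (neg_nonneg.2 h1), sq_nonneg κ, sq_nonneg l.re,
            mul_pos hδ hδ]), hδ⟩

/-- The half line from `i|κ|` to `i∞`. -/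
def imAxis (κ s : ℝ) : ℂ := ((|κ| + s : ℝ) : ℂ) * Complex.I

/-- The right half, starting at `i|κ|`, of the upper branch of `(Im l)² = κ² + (Re l)²`. -/
def rightHyperbola (κ s : ℝ) : ℂ := s + (Real.sqrt (κ ^ 2 + s ^ 2) : ℂ) * Complex.I

/-- The left half, starting at `i|κ|`, of the upper branch of `(Im l)² = κ² + (Re l)²`. -/
def leftHyperbola (κ s : ℝ) : ℂ := -s + (Real.sqrt (κ ^ 2 + s ^ 2) : ℂ) * Complex.I

/-- The topological boundary of `D_κ⁺` is the union of the five pieces of the contour. -/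
theorem frontier_DPlus (κ : ℝ) : frontier (DPlus κ) =
    negAxis '' Ici 0 ∪ (fun s : ℝ => (s : ℂ) * Complex.I) '' Icc 0 |κ| ∪
      leftHyperbola κ '' Ici 0 ∪ imAxis κ '' Ici 0 ∪ rightHyperbola κ '' Ici 0 := by
  have ho : IsOpen (DPlus κ) := by
    have c1 : Continuous (fun l : ℂ => (Complex.I * ((κ : ℂ) ^ 2 + l ^ 2) ^ 2).re) := by fun_prop
    exact (isOpen_lt continuous_const c1).inter (isOpen_lt continuous_const Complex.continuous_im)
  rw [ho.frontier_eq, closure_DPlus]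
  ext l
  simp only [Set.mem_sdiff, mem_DPlus, mem_ofPred_eq, mem_union, mem_image, mem_Ici, mem_Icc]
  constructor
  · rintro ⟨⟨h0, h⟩, hn⟩
    rcases h0.lt_or_eq with h3 | h3
    · have hz : l.re * (κ ^ 2 + l.re ^ 2 - l.im ^ 2) = 0 := by
        have h4 : 0 ≤ l.re * (κ ^ 2 + l.re ^ 2 - l.im ^ 2) := by
          by_contra h5
          exact hn ⟨not_le.1 h5, h3⟩
        rcases h with ⟨h1, h2⟩ | ⟨h1, h2⟩
        · nlinarith [mul_nonneg h1 (sub_nonneg.2 h2)]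
        · nlinarith [mul_nonneg (neg_nonneg.2 h1) (sub_nonneg.2 h2)]
      rcases mul_eq_zero.1 hz with h4 | h4
      · rcases le_total l.im |κ| with h5 | h5
        · left; left; left; right
          exact ⟨l.im, ⟨h0, h5⟩, by apply Complex.ext <;> simp [h4]⟩
        · left; right
          exact ⟨l.im - |κ|, by linarith, by apply Complex.ext <;> simp [imAxis, h4]⟩
      · have h6 : Real.sqrt (κ ^ 2 + l.re ^ 2) = l.im := by
          rw [show κ ^ 2 + l.re ^ 2 = l.im ^ 2 by linarith, Real.sqrt_sq h0]
        rcases le_total 0 l.re with h5 | h5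
        · right
          exact ⟨l.re, h5, by apply Complex.ext <;> simp [rightHyperbola, h6]⟩
        · left; left; right
          exact ⟨-l.re, by linarith, by apply Complex.ext <;> simp [leftHyperbola, h6]⟩
    · rcases h with ⟨h1, h2⟩ | ⟨h1, h2⟩
      · have h4 : l.re = 0 := by
          rw [← h3] at h2
          nlinarith [sq_nonneg κ, sq_nonneg l.re]
        left; left; left; left
        exact ⟨0, le_rfl, by apply Complex.ext <;> simp [negAxis, h4, ← h3]⟩
      · left; left; left; left
        exact ⟨-l.re, by linarith, by apply Complex.ext <;> simp [negAxis, ← h3]⟩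
  · rintro ((((⟨s, hs, rfl⟩ | ⟨s, hs, rfl⟩) | ⟨s, hs, rfl⟩) | ⟨s, hs, rfl⟩) | ⟨s, hs, rfl⟩)
    · simp [negAxis, hs]
      right
      positivity
    · simp [hs.1]
      right
      nlinarith [sq_abs κ, hs.1, hs.2, abs_nonneg κ]
    · have := Real.sq_sqrt (show 0 ≤ κ ^ 2 + s ^ 2 by positivity)
      simp [leftHyperbola, hs, this, Real.sqrt_nonneg]
    · have h1 : κ ^ 2 ≤ (|κ| + s) ^ 2 := by nlinarith [sq_abs κ, abs_nonneg κ]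
      have h2 : 0 ≤ |κ| + s := by positivity
      simp [imAxis, h1, h2]
    · have := Real.sq_sqrt (show 0 ≤ κ ^ 2 + s ^ 2 by positivity)
      simp [rightHyperbola, hs, this, Real.sqrt_nonneg]

/-- `I = ∫_{∂D_κ⁺} f(l) dl`, with `D_κ⁺` to the left of its boundary (see `frontier_DPlus`).
The component in `Re l < 0` is bounded by `-∞ → 0 → i|κ|` followed by the left half hyperbola
traversed outwards; the component in `Re l > 0` by `i∞ → i|κ|` followed by the right half
hyperbola traversed outwards. -/
def HasBoundaryIntegral (κ : ℝ) (f : ℂ → ℂ) (I : ℂ) : Prop :=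
  ∃ I₁ I₂ I₃ I₄ I₅ : ℂ, HasCurveIntegral negAxis f I₁ ∧ HasSegmentIntegral κ f I₂ ∧
    HasCurveIntegral (leftHyperbola κ) f I₃ ∧ HasCurveIntegral (imAxis κ) f I₄ ∧
    HasCurveIntegral (rightHyperbola κ) f I₅ ∧
    I = (-I₁ + I₂ + I₃) + (-I₄ + I₅)

/-- The ray from `i|κ|` to infinity in the direction `e^{3πi/4}`. -/
def leftRay (κ s : ℝ) : ℂ := -s + ((|κ| + s : ℝ) : ℂ) * Complex.I

/-- The ray from `0` to infinity in the direction `e^{πi/4}`. -/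
def rightRay (s : ℝ) : ℂ := s + (s : ℂ) * Complex.I

/-- `I = ∫ f(l) dl` over the asymptotic form of the contour, in which both half hyperbolas are
replaced by rays in their asymptotic directions: `-∞ → 0 → i|κ| → i|κ| + e^{3πi/4}∞` on the
left, `i∞ → 0 → e^{πi/4}∞` on the right. -/
def HasAsymptoticBoundaryIntegral (κ : ℝ) (f : ℂ → ℂ) (I : ℂ) : Prop :=
  ∃ I₁ I₂ I₃ I₄ I₅ : ℂ, HasCurveIntegral negAxis f I₁ ∧ HasSegmentIntegral κ f I₂ ∧
    HasCurveIntegral (leftRay κ) f I₃ ∧ HasCurveIntegral (imAxis 0) f I₄ ∧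
    HasCurveIntegral rightRay f I₅ ∧
    I = (-I₁ + I₂ + I₃) + (-I₄ + I₅)

end BiharmonicSchrodinger

end

/-!
This is the unified transform (Fokas) method. Writing `û` for the Fourier transform of `u` in `x`,
integration of the equation against `exp (-i l y)` and in time gives, for `Im l ≤ 0`, a global
relation between the half line transforms of `û` at the times `0` and `t` and the four boundary
values of `û` at `y = 0`. The time exponent depends on `l ^ 2` only and takes the same value at
`±ν_κ(l)`, so the relations at `-l` and `-ν_κ(l)` eliminate the two unknown boundary values, and on
the contour `E G` becomes the boundary term of the relation at `l` minus a remainder built from the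
transform of `û` at time `t`. The division by `ν - l` only produces a divided difference of that
transform, so the remainder is analytic and decays on each closed quadrant, and by Jordan's lemma
its contour integral vanishes. The boundary term grows nowhere between the contour and the real
line, so its integral may be moved to the real line, where the global relation turns it into the
inversion integral of `û` minus the integral of the initial datum. Fourier inversion in `y` and then
in `x` yields `u`.
-/

noncomputable section

namespace BiharmonicSchrodinger

/-! ### Tame curves and their deformations -/

/-- The curves along which contours are deformed: twice continuously differentiable up to the
starting point, and Lipschitz, so that the speed is bounded and the growth at most linear. -/
structure IsTameCurve (γ : ℝ → ℂ) : Prop where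
  contDiffOn : ContDiffOn ℝ 2 γ (Ici 0)
  lipschitzOnWith : ∃ C, LipschitzOnWith C γ (Ici 0)

namespace IsTameCurve

variable {γ δ : ℝ → ℂ}

theorem continuousOn (h : IsTameCurve γ) : ContinuousOn γ (Ici 0) :=
  h.contDiffOn.continuousOn

theorem continuousOn_derivWithin (h : IsTameCurve γ) :
    ContinuousOn (derivWithin γ (Ici 0)) (Ici 0) :=
  h.contDiffOn.continuousOn_derivWithin (uniqueDiffOn_Ici 0) one_le_two

theorem hasDerivAt (h : IsTameCurve γ) {s : ℝ} (hs : 0 < s) :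
    HasDerivAt γ (derivWithin γ (Ici 0) s) s :=
  ((h.contDiffOn.differentiableOn two_ne_zero s hs.le).hasDerivWithinAt).hasDerivAt
    (Ici_mem_nhds hs)

theorem differentiableAt_derivWithin (h : IsTameCurve γ) {s : ℝ} (hs : 0 < s) :
    DifferentiableAt ℝ (derivWithin γ (Ici 0)) s :=
  ((h.contDiffOn.derivWithin (uniqueDiffOn_Ici 0) one_add_one_eq_two.le).differentiableOn
    one_ne_zero s hs.le).differentiableAt (Ici_mem_nhds hs)

theorem exists_norm_deriv_le (h : IsTameCurve γ) : ∃ C : ℝ, ∀ s, 0 < s → ‖deriv γ s‖ ≤ C := by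
  obtain ⟨C, hC⟩ := h.lipschitzOnWith
  exact ⟨C, fun s hs => norm_deriv_le_of_lipschitzOn (Ici_mem_nhds hs) hC⟩

theorem exists_norm_le (h : IsTameCurve γ) : ∃ C : ℝ, ∀ s, 0 ≤ s → ‖γ s‖ ≤ C * (1 + s) := by
  obtain ⟨C, hC⟩ := h.lipschitzOnWith
  refine ⟨‖γ 0‖ + C, fun s hs => ?_⟩
  have hlip : ‖γ s - γ 0‖ ≤ C * s := by
    simpa [dist_eq_norm, abs_of_nonneg hs] using hC.dist_le_mul s hs 0 self_mem_Ici
  have hs0 : 0 ≤ ‖γ 0‖ * s := by positivity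
  linarith [norm_le_norm_add_norm_sub' (γ s) (γ 0), C.coe_nonneg]

theorem add (hγ : IsTameCurve γ) (hδ : IsTameCurve δ) : IsTameCurve (γ + δ) where
  contDiffOn := hγ.contDiffOn.add hδ.contDiffOn
  lipschitzOnWith := by
    obtain ⟨C, hC⟩ := hγ.lipschitzOnWith
    obtain ⟨C', hC'⟩ := hδ.lipschitzOnWith
    exact ⟨C + C', hC.add hC'⟩

theorem affine (c d : ℂ) : IsTameCurve fun s => c + s * d where
  contDiffOn :=
    (contDiff_const.add (Complex.ofRealCLM.contDiff.mul contDiff_const)).contDiffOn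
  lipschitzOnWith := ⟨‖d‖₊, (LipschitzWith.of_dist_le_mul fun s r => by
    rw [dist_add_left, dist_eq_norm, ← sub_mul, ← Complex.ofReal_sub, norm_mul, Complex.norm_real,
      coe_nnnorm, dist_eq_norm, mul_comm]).lipschitzOnWith⟩

theorem sqrt_sq_add_sq_mul_I (κ : ℝ) :
    IsTameCurve fun s => (Real.sqrt (κ ^ 2 + s ^ 2) : ℂ) * Complex.I where
  contDiffOn := by
    rcases eq_or_ne κ 0 with rfl | hκ
    · refine (affine 0 Complex.I).contDiffOn.congr fun s hs => ?_
      simp [Real.sqrt_sq hs]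
    · have hsqrt : ContDiff ℝ 2 fun s => Real.sqrt (κ ^ 2 + s ^ 2) :=
        ContDiff.sqrt (by fun_prop) fun s => by positivity
      exact ((Complex.ofRealCLM.contDiff.comp hsqrt).mul contDiff_const).contDiffOn
  lipschitzOnWith := ⟨1, (LipschitzWith.of_dist_le_mul fun s r => by
    have hnorm : ∀ s : ℝ, Real.sqrt (κ ^ 2 + s ^ 2) = ‖(κ + s * Complex.I : ℂ)‖ := fun s =>
      (Complex.norm_add_mul_I κ s).symm
    calc dist ((Real.sqrt (κ ^ 2 + s ^ 2) : ℂ) * Complex.I)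
          ((Real.sqrt (κ ^ 2 + r ^ 2) : ℂ) * Complex.I)
        = |‖(κ + s * Complex.I : ℂ)‖ - ‖(κ + r * Complex.I : ℂ)‖| := by
          rw [dist_eq_norm, ← sub_mul, ← Complex.ofReal_sub, norm_mul, Complex.norm_I, mul_one,
            Complex.norm_real, Real.norm_eq_abs, hnorm, hnorm]
      _ ≤ ‖(κ + s * Complex.I : ℂ) - (κ + r * Complex.I)‖ := abs_norm_sub_norm_le _ _
      _ = (1 : NNReal) * dist s r := by
          rw [add_sub_add_left_eq_sub, ← sub_mul, ← Complex.ofReal_sub, norm_mul, Complex.norm_I,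
            mul_one, Complex.norm_real, NNReal.coe_one, one_mul, dist_eq_norm]).lipschitzOnWith⟩

theorem intervalIntegrable (h : IsTameCurve γ) {F : ℂ → ℂ}
    (hF : ContinuousOn F (γ '' Ici 0)) {R : ℝ} (hR : 0 ≤ R) :
    IntervalIntegrable (fun s => F (γ s) * deriv γ s) volume 0 R := by
  have hcont : ContinuousOn (fun s => F (γ s) * derivWithin γ (Ici 0) s) (uIcc 0 R) := by
    rw [uIcc_of_le hR]
    exact ((hF.comp h.continuousOn (mapsTo_image _ _)).mul h.continuousOn_derivWithin).mono
      Icc_subset_Ici_self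
  refine hcont.intervalIntegrable.congr fun s hs => ?_
  rw [uIoc_of_le hR] at hs
  simp only [(h.hasDerivAt hs.1).deriv]

end IsTameCurve

theorem isTameCurve_negAxis : IsTameCurve negAxis := by
  convert IsTameCurve.affine 0 (-1) using 2
  simp [negAxis]

theorem isTameCurve_ofReal : IsTameCurve fun s => (s : ℂ) := by
  convert IsTameCurve.affine 0 1 using 2
  simp

theorem isTameCurve_imAxis (κ : ℝ) : IsTameCurve (imAxis κ) := by
  convert IsTameCurve.affine (|κ| * Complex.I) Complex.I using 2
  simp [imAxis, add_mul]

theorem isTameCurve_leftRay (κ : ℝ) : IsTameCurve (leftRay κ) := by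
  convert IsTameCurve.affine (|κ| * Complex.I) (-1 + Complex.I) using 2
  simp only [leftRay, Complex.ofReal_add]
  ring

theorem isTameCurve_rightRay : IsTameCurve rightRay := by
  convert IsTameCurve.affine 0 (1 + Complex.I) using 2
  simp only [rightRay]
  ring

theorem isTameCurve_leftHyperbola (κ : ℝ) : IsTameCurve (leftHyperbola κ) :=
  isTameCurve_negAxis.add (IsTameCurve.sqrt_sq_add_sq_mul_I κ)

theorem isTameCurve_rightHyperbola (κ : ℝ) : IsTameCurve (rightHyperbola κ) :=
  isTameCurve_ofReal.add (IsTameCurve.sqrt_sq_add_sq_mul_I κ)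

/-- The point that divides the segment from `a s` to `b s` in the ratio `θ : 1 - θ`. -/
def slide (a b : ℝ → ℂ) (s θ : ℝ) : ℂ := a s + θ * (b s - a s)

@[simp] theorem slide_zero (a b : ℝ → ℂ) (s : ℝ) : slide a b s 0 = a s := by simp [slide]

@[simp] theorem slide_one (a b : ℝ → ℂ) (s : ℝ) : slide a b s 1 = b s := by simp [slide]

theorem integral_rectangle_boundary_eq_zero {E : Type*} [NormedAddCommGroup E] [NormedSpace ℝ E]
    {f g : ℝ × ℝ → E} {a b : ℝ × ℝ} (hab : a ≤ b) (hf : ContinuousOn f (Icc a b))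
    (hg : ContinuousOn g (Icc a b))
    (hdiv : ∀ p ∈ Ioo a.1 b.1 ×ˢ Ioo a.2 b.2, ∃ f' g' : ℝ × ℝ →L[ℝ] E,
      HasFDerivAt f f' p ∧ HasFDerivAt g g' p ∧ f' (1, 0) + g' (0, 1) = 0) :
    (∫ x in a.1..b.1, g (x, b.2)) - (∫ x in a.1..b.1, g (x, a.2)) +
      (∫ y in a.2..b.2, f (b.1, y)) - ∫ y in a.2..b.2, f (a.1, y) = 0 := by
  classical
  set U := Ioo a.1 b.1 ×ˢ Ioo a.2 b.2
  set f' : ℝ × ℝ → ℝ × ℝ →L[ℝ] E := fun p => if p ∈ U then fderiv ℝ f p else 0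
  set g' : ℝ × ℝ → ℝ × ℝ →L[ℝ] E := fun p => if p ∈ U then fderiv ℝ g p else 0
  have hzero : ∀ p, f' p (1, 0) + g' p (0, 1) = 0 := by
    intro p
    by_cases hp : p ∈ U
    · obtain ⟨φ, ψ, hφ, hψ, h⟩ := hdiv p hp
      simpa only [f', g', if_pos hp, hφ.fderiv, hψ.fderiv] using h
    · simp [f', g', hp]
  have hf' : ∀ p ∈ U \ ∅, HasFDerivAt f (f' p) p := fun p hp => by
    obtain ⟨φ, -, hφ, -⟩ := hdiv p hp.1
    simpa only [f', if_pos hp.1] using hφ.differentiableAt.hasFDerivAt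
  have hg' : ∀ p ∈ U \ ∅, HasFDerivAt g (g' p) p := fun p hp => by
    obtain ⟨-, ψ, -, hψ, -⟩ := hdiv p hp.1
    simpa only [g', if_pos hp.1] using hψ.differentiableAt.hasFDerivAt
  have hdivergence := integral_divergence_prod_Icc_of_hasFDerivAt_off_countable_of_le f g f' g' a b
    hab ∅ countable_empty hf hg hf' hg' (by simp only [hzero]; exact integrableOn_zero)
  simpa only [hzero, integral_zero, eq_comm] using hdivergence

/-- The integrand decays like `exp (-y Im l) / (1 + |l|)` on `S`, and is holomorphic at the points
of `S` off both coordinate axes: this is what the deformations of the contours use. -/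
structure IsDecaying (y : ℝ) (S : Set ℂ) (F : ℂ → ℂ) : Prop where
  continuousOn : ContinuousOn F S
  exists_norm_le : ∃ C, 0 ≤ C ∧ ∀ l ∈ S, ‖F l‖ ≤ C * Real.exp (-y * l.im) / (1 + ‖l‖)
  differentiableAt : ∀ l ∈ S, l.re ≠ 0 → 0 < l.im → DifferentiableAt ℂ F l

/-- The segments from `a s` to `b s` move to infinity as `s → ∞` and rise at least at the rate
`θ s`, so that a decaying function has a negligible integral over them; they avoid the coordinate
axes, except at the end points and for `s = 0`. -/
structure IsDeformation (a b : ℝ → ℂ) : Prop where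
  left : IsTameCurve a
  right : IsTameCurve b
  re_ne_zero : ∀ s, 0 < s → ∀ θ ∈ Ioo (0 : ℝ) 1, (slide a b s θ).re ≠ 0
  mul_le_im : ∀ s, 0 ≤ s → ∀ θ ∈ Icc (0 : ℝ) 1, θ * s ≤ (slide a b s θ).im
  le_norm : ∀ s, 0 ≤ s → ∀ θ ∈ Icc (0 : ℝ) 1, s ≤ ‖slide a b s θ‖

theorem exists_hasFDerivAt_slide {a b : ℝ → ℂ} (ha : IsTameCurve a) (hb : IsTameCurve b)
    {F : ℂ → ℂ} {s θ : ℝ} (hs : 0 < s) (hF : DifferentiableAt ℂ F (slide a b s θ)) :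
    ∃ f' g' : ℝ × ℝ →L[ℝ] ℂ,
      HasFDerivAt (fun p : ℝ × ℝ => F (slide a b p.1 p.2) * (b p.1 - a p.1)) f' (s, θ) ∧
      HasFDerivAt (fun p : ℝ × ℝ => -(F (slide a b p.1 p.2) *
        slide (derivWithin a (Ici 0)) (derivWithin b (Ici 0)) p.1 p.2)) g' (s, θ) ∧
      f' (1, 0) + g' (0, 1) = 0 := by
  have hfst : HasFDerivAt (fun p : ℝ × ℝ => p.1) (ContinuousLinearMap.fst ℝ ℝ ℝ) (s, θ) :=
    hasFDerivAt_fst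
  have hsnd : HasFDerivAt (fun p : ℝ × ℝ => (p.2 : ℂ))
      (Complex.ofRealCLM.comp (ContinuousLinearMap.snd ℝ ℝ ℝ)) (s, θ) :=
    Complex.ofRealCLM.hasFDerivAt.comp (s, θ) hasFDerivAt_snd
  have hda := (ha.hasDerivAt hs).hasFDerivAt.comp (s, θ) hfst
  have hdb := (hb.hasDerivAt hs).hasFDerivAt.comp (s, θ) hfst
  have hda' := (ha.differentiableAt_derivWithin hs).hasDerivAt.hasFDerivAt.comp (s, θ) hfst
  have hdb' := (hb.differentiableAt_derivWithin hs).hasDerivAt.hasFDerivAt.comp (s, θ) hfst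
  have hslide := hda.add (hsnd.mul (hdb.sub hda))
  have hslide' := hda'.add (hsnd.mul (hdb'.sub hda'))
  have hdF := (hF.hasDerivAt.hasFDerivAt.restrictScalars ℝ).comp (x := ((s, θ) : ℝ × ℝ))
    (f := fun p : ℝ × ℝ => slide a b p.1 p.2) hslide
  refine ⟨_, _, hdF.mul (hdb.sub hda), (hdF.mul hslide').neg, ?_⟩
  simp [slide]
  ring

namespace IsDecaying

variable {y : ℝ} {S : Set ℂ} {F : ℂ → ℂ} {a b γ : ℝ → ℂ}

theorem intervalIntegrable (h : IsDecaying y S F) (hγ : IsTameCurve γ)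
    (hmem : ∀ s, 0 ≤ s → γ s ∈ S) {R : ℝ} (hR : 0 ≤ R) :
    IntervalIntegrable (fun s => F (γ s) * deriv γ s) volume 0 R :=
  hγ.intervalIntegrable (h.continuousOn.mono (image_subset_iff.2 hmem)) hR

theorem integral_sub_integral (h : IsDecaying y S F) (hab : IsDeformation a b)
    (hmem : ∀ s, 0 ≤ s → ∀ θ ∈ Icc (0 : ℝ) 1, slide a b s θ ∈ S) {R : ℝ} (hR : 0 ≤ R) :
    (∫ s in (0 : ℝ)..R, F (a s) * deriv a s) - (∫ s in (0 : ℝ)..R, F (b s) * deriv b s) =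
      (∫ θ in (0 : ℝ)..1, F (slide a b 0 θ) * (b 0 - a 0)) -
        ∫ θ in (0 : ℝ)..1, F (slide a b R θ) * (b R - a R) := by
  set a' := derivWithin a (Ici 0)
  set b' := derivWithin b (Ici 0)
  set K : Set (ℝ × ℝ) := Icc (0, 0) (R, 1)
  have hfst {c : ℝ → ℂ} (hc : ContinuousOn c (Ici 0)) : ContinuousOn (fun p => c p.1) K :=
    hc.comp continuousOn_fst fun p hp => hp.1.1
  have hslide {c d : ℝ → ℂ} (hc : ContinuousOn c (Ici 0)) (hd : ContinuousOn d (Ici 0)) :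
      ContinuousOn (fun p : ℝ × ℝ => slide c d p.1 p.2) K :=
    (hfst hc).add ((by fun_prop : ContinuousOn (fun p : ℝ × ℝ => (p.2 : ℂ)) K).mul
      ((hfst hd).sub (hfst hc)))
  have hF : ContinuousOn (fun p : ℝ × ℝ => F (slide a b p.1 p.2)) K :=
    h.continuousOn.comp (hslide hab.left.continuousOn hab.right.continuousOn)
      fun p hp => hmem p.1 hp.1.1 p.2 ⟨hp.1.2, hp.2.2⟩
  have hboundary := integral_rectangle_boundary_eq_zero (a := (0, 0)) (b := (R, 1))
    ⟨hR, zero_le_one⟩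
    (hF.mul ((hfst hab.right.continuousOn).sub (hfst hab.left.continuousOn)))
    (hF.mul (hslide hab.left.continuousOn_derivWithin hab.right.continuousOn_derivWithin)).neg
    (by
      rintro ⟨s, θ⟩ ⟨hs, hθ⟩
      have hθs : 0 < θ * s := mul_pos hθ.1 hs.1
      exact exists_hasFDerivAt_slide hab.left hab.right hs.1 <|
        h.differentiableAt _ (hmem s hs.1.le θ (Ioo_subset_Icc_self hθ))
          (hab.re_ne_zero s hs.1 θ hθ)
          (hθs.trans_le (hab.mul_le_im s hs.1.le θ (Ioo_subset_Icc_self hθ))))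
  have hderiv {c : ℝ → ℂ} (hc : IsTameCurve c) : (∫ s in (0 : ℝ)..R, F (c s) * deriv c s) =
      ∫ s in (0 : ℝ)..R, F (c s) * derivWithin c (Ici 0) s :=
    intervalIntegral.integral_congr_Ioo_of_le hR fun s hs => by
      simp only [(hc.hasDerivAt hs.1).deriv]
  simp only [Pi.neg_apply, Pi.mul_apply, Pi.sub_apply, slide_zero, slide_one,
    intervalIntegral.integral_neg] at hboundary
  rw [hderiv hab.left, hderiv hab.right]
  linear_combination hboundary

end IsDecaying

theorem integral_exp_neg_mul_le {c : ℝ} (hc : 0 < c) :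
    ∫ θ in (0 : ℝ)..1, Real.exp (-c * θ) ≤ c⁻¹ := by
  rw [intervalIntegral.integral_comp_mul_left Real.exp (neg_ne_zero.2 hc.ne'), integral_exp,
    smul_eq_mul, inv_neg, neg_mul, ← mul_neg, neg_sub, mul_zero, Real.exp_zero]
  exact mul_le_of_le_one_right (inv_nonneg.2 hc.le) (sub_le_self _ (Real.exp_pos _).le)

namespace HasCurveIntegral

variable {γ : ℝ → ℂ} {F F₁ F₂ : ℂ → ℂ} {I J : ℂ}

theorem unique (hI : HasCurveIntegral γ F I) (hJ : HasCurveIntegral γ F J) : I = J :=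
  tendsto_nhds_unique hI.2 hJ.2

theorem sub (hI : HasCurveIntegral γ F₁ I) (hJ : HasCurveIntegral γ F₂ J) :
    HasCurveIntegral γ (fun l => F₁ l - F₂ l) (I - J) := by
  refine ⟨fun R hR => ?_, (hI.2.sub hJ.2).congr' ?_⟩
  · simpa only [sub_mul] using (hI.1 R hR).sub (hJ.1 R hR)
  · filter_upwards [eventually_ge_atTop 0] with R hR
    simp only [sub_mul, intervalIntegral.integral_sub (hI.1 R hR) (hJ.1 R hR)]

theorem congr_off (hI : HasCurveIntegral γ F₁ I) (s₀ : ℝ)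
    (h : ∀ s, 0 < s → s ≠ s₀ → F₁ (γ s) = F₂ (γ s)) : HasCurveIntegral γ F₂ I := by
  have hae : ∀ R, 0 ≤ R → (fun s => F₁ (γ s) * deriv γ s) =ᵐ[volume.restrict (uIoc 0 R)]
      fun s => F₂ (γ s) * deriv γ s := by
    intro R hR
    rw [uIoc_of_le hR]
    filter_upwards [ae_restrict_of_ae (Measure.ae_ne volume s₀),
      ae_restrict_mem measurableSet_Ioc] with s hs hs'
    rw [h s hs'.1 hs]
  refine ⟨fun R hR => (hI.1 R hR).congr_ae (hae R hR), hI.2.congr' ?_⟩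
  filter_upwards [eventually_ge_atTop 0] with R hR
  exact intervalIntegral.integral_congr_ae_restrict (hae R hR)

end HasCurveIntegral

namespace IsDecaying

variable {y : ℝ} {S : Set ℂ} {F : ℂ → ℂ} {a b γ : ℝ → ℂ}

theorem exists_hasCurveIntegral (h : IsDecaying y S F) (hy : 0 < y) (hγ : IsTameCurve γ)
    (hmem : ∀ s, 0 ≤ s → γ s ∈ S) (him : ∀ s, 0 ≤ s → s ≤ (γ s).im) :
    ∃ I, HasCurveIntegral γ F I := by
  obtain ⟨c, hc⟩ := hγ.exists_norm_deriv_le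
  obtain ⟨C, hC, hbound⟩ := h.exists_norm_le
  have hspeed : ∀ s, 0 < s → ‖F (γ s) * deriv γ s‖ ≤ C * c * Real.exp (-y * s) := fun s hs => by
    have hexp : Real.exp (-y * (γ s).im) ≤ Real.exp (-y * s) :=
      Real.exp_le_exp.2 (by nlinarith [him s hs.le])
    calc ‖F (γ s) * deriv γ s‖
        ≤ C * Real.exp (-y * (γ s).im) / (1 + ‖γ s‖) * c := by
          rw [norm_mul]
          gcongr
          exacts [hbound _ (hmem s hs.le), hc s hs]
      _ ≤ C * Real.exp (-y * s) * c := by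
          have hc0 : 0 ≤ c := (norm_nonneg _).trans (hc s hs)
          gcongr
          exact (div_le_self (by positivity) (by simp)).trans (by gcongr)
      _ = C * c * Real.exp (-y * s) := by ring
  have hmeas : AEStronglyMeasurable (fun s => F (γ s) * deriv γ s) (volume.restrict (Ioi 0)) := by
    refine ((h.continuousOn.comp hγ.continuousOn hmem).mono
      Ioi_subset_Ici_self).aestronglyMeasurable measurableSet_Ioi |>.mul ?_
    exact (stronglyMeasurable_deriv γ).aestronglyMeasurable
  have hint : IntegrableOn (fun s => F (γ s) * deriv γ s) (Ioi 0) :=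
    ((exp_neg_integrableOn_Ioi 0 hy).const_mul (C * c)).mono' hmeas <|
      (ae_restrict_iff' measurableSet_Ioi).2 (Eventually.of_forall hspeed)
  exact ⟨_, fun R hR => h.intervalIntegrable hγ hmem hR,
    intervalIntegral_tendsto_integral_Ioi 0 hint tendsto_id⟩

theorem norm_integral_slide_le {C : ℝ} (hC : 0 ≤ C) (hy : 0 < y)
    (hbound : ∀ l ∈ S, ‖F l‖ ≤ C * Real.exp (-y * l.im) / (1 + ‖l‖)) (hab : IsDeformation a b)
    (hmem : ∀ s, 0 ≤ s → ∀ θ ∈ Icc (0 : ℝ) 1, slide a b s θ ∈ S) {R : ℝ} (hR : 0 < R) :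
    ‖∫ θ in (0 : ℝ)..1, F (slide a b R θ) * (b R - a R)‖ ≤
      C / (1 + R) * ‖b R - a R‖ * (y * R)⁻¹ := by
  have hpoint : ∀ θ ∈ Icc (0 : ℝ) 1, ‖F (slide a b R θ) * (b R - a R)‖ ≤
      C / (1 + R) * ‖b R - a R‖ * Real.exp (-(y * R) * θ) := fun θ hθ => by
    have hexp : -y * (slide a b R θ).im ≤ -(y * R) * θ := by
      nlinarith [hab.mul_le_im R hR.le θ hθ]
    calc ‖F (slide a b R θ) * (b R - a R)‖
        ≤ C * Real.exp (-y * (slide a b R θ).im) / (1 + ‖slide a b R θ‖) * ‖b R - a R‖ := by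
          rw [norm_mul]
          gcongr
          exact hbound _ (hmem R hR.le θ hθ)
      _ ≤ C * Real.exp (-(y * R) * θ) / (1 + R) * ‖b R - a R‖ := by
          gcongr
          exact hab.le_norm R hR.le θ hθ
      _ = _ := by ring
  calc ‖∫ θ in (0 : ℝ)..1, F (slide a b R θ) * (b R - a R)‖
      ≤ ∫ θ in (0 : ℝ)..1, C / (1 + R) * ‖b R - a R‖ * Real.exp (-(y * R) * θ) :=
        intervalIntegral.norm_integral_le_of_norm_le zero_le_one
          (Eventually.of_forall fun θ hθ => hpoint θ (Ioc_subset_Icc_self hθ))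
          (Continuous.intervalIntegrable (by fun_prop) _ _)
    _ ≤ C / (1 + R) * ‖b R - a R‖ * (y * R)⁻¹ := by
        rw [intervalIntegral.integral_const_mul]
        gcongr
        exact integral_exp_neg_mul_le (mul_pos hy hR)

theorem tendsto_integral_slide_atTop (h : IsDecaying y S F) (hy : 0 < y) (hab : IsDeformation a b)
    (hmem : ∀ s, 0 ≤ s → ∀ θ ∈ Icc (0 : ℝ) 1, slide a b s θ ∈ S) :
    Tendsto (fun R => ∫ θ in (0 : ℝ)..1, F (slide a b R θ) * (b R - a R)) atTop (𝓝 0) := by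
  obtain ⟨C, hC, hbound⟩ := h.exists_norm_le
  obtain ⟨Ca, hCa⟩ := hab.left.exists_norm_le
  obtain ⟨Cb, hCb⟩ := hab.right.exists_norm_le
  have hlim : Tendsto (fun R : ℝ => C * (Cb + Ca) * (y * R)⁻¹) atTop (𝓝 0) := by
    simpa using (tendsto_inv_atTop_zero.comp (tendsto_id.const_mul_atTop hy)).const_mul
      (C * (Cb + Ca))
  refine squeeze_zero_norm' ?_ hlim
  filter_upwards [eventually_gt_atTop 0] with R hR
  have hgrowth : ‖b R - a R‖ ≤ (Cb + Ca) * (1 + R) :=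
    (norm_sub_le _ _).trans (by linarith [hCa R hR.le, hCb R hR.le])
  calc _ ≤ C / (1 + R) * ‖b R - a R‖ * (y * R)⁻¹ :=
        norm_integral_slide_le hC hy hbound hab hmem hR
    _ ≤ C / (1 + R) * ((Cb + Ca) * (1 + R)) * (y * R)⁻¹ := by gcongr
    _ = C * (Cb + Ca) * (y * R)⁻¹ := by field_simp

theorem hasCurveIntegral_of_isDeformation (h : IsDecaying y S F) (hy : 0 < y)
    (hab : IsDeformation a b)
    (hmem : ∀ s, 0 ≤ s → ∀ θ ∈ Icc (0 : ℝ) 1, slide a b s θ ∈ S)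
    {I : ℂ} (hI : HasCurveIntegral b F I) :
    HasCurveIntegral a F ((∫ θ in (0 : ℝ)..1, F (slide a b 0 θ) * (b 0 - a 0)) + I) := by
  have ha : ∀ s, 0 ≤ s → a s ∈ S := fun s hs => by
    simpa using hmem s hs 0 (left_mem_Icc.2 zero_le_one)
  refine ⟨fun R hR => h.intervalIntegrable hab.left ha hR, ?_⟩
  have hlim := ((h.tendsto_integral_slide_atTop hy hab hmem).const_sub
    (∫ θ in (0 : ℝ)..1, F (slide a b 0 θ) * (b 0 - a 0))).add hI.2
  rw [sub_zero] at hlim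
  refine hlim.congr' ?_
  filter_upwards [eventually_ge_atTop 0] with R hR
  rw [← h.integral_sub_integral hab hmem hR, sub_add_cancel]

theorem hasCurveIntegral_of_isDeformation_of_eq (h : IsDecaying y S F) (hy : 0 < y)
    (hab : IsDeformation a b) (h0 : a 0 = b 0)
    (hmem : ∀ s, 0 ≤ s → ∀ θ ∈ Icc (0 : ℝ) 1, slide a b s θ ∈ S)
    {I : ℂ} (hI : HasCurveIntegral b F I) : HasCurveIntegral a F I := by
  simpa [h0] using h.hasCurveIntegral_of_isDeformation hy hab hmem hI

theorem hasCurveIntegral_of_isDeformation_of_segment (h : IsDecaying y S F) (hy : 0 < y)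
    (hab : IsDeformation a b) {κ : ℝ} (ha : a 0 = 0) (hb : b 0 = |κ| * Complex.I)
    (hmem : ∀ s, 0 ≤ s → ∀ θ ∈ Icc (0 : ℝ) 1, slide a b s θ ∈ S)
    {I : ℂ} (hI : HasCurveIntegral b F I) :
    HasCurveIntegral a F ((∫ s in (0 : ℝ)..|κ|, F (s * Complex.I) * Complex.I) + I) := by
  convert h.hasCurveIntegral_of_isDeformation hy hab hmem hI using 2
  have hscale := intervalIntegral.smul_integral_comp_mul_right (a := 0) (b := 1)
    (fun s : ℝ => F (s * Complex.I) * Complex.I) |κ|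
  rw [zero_mul, one_mul, ← intervalIntegral.integral_smul] at hscale
  rw [← hscale]
  refine intervalIntegral.integral_congr fun θ _ => ?_
  simp only [slide, ha, hb, Complex.ofReal_mul, Complex.real_smul, zero_add, sub_zero, mul_assoc]
  ring

end IsDecaying

/-! ### Deformation of the boundary contour -/

/-- The part of the closed upper half plane where `exp (i (κ² + l²)² t)` is bounded for `t ≥ 0`,
that is, the complement of `D κ` there. -/
def boundedRegion (κ : ℝ) : Set ℂ :=
  {l | 0 ≤ l.im ∧ 0 ≤ l.re * (κ ^ 2 + l.re ^ 2 - l.im ^ 2)}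

/-- The closed second quadrant. -/
def leftQuadrant : Set ℂ := {l | l.re ≤ 0 ∧ 0 ≤ l.im}

/-- The closed first quadrant. -/
def rightQuadrant : Set ℂ := {l | 0 ≤ l.re ∧ 0 ≤ l.im}

/-- The part of the closed second quadrant where `π/4 ≤ arg (-l² - 2κ²) ≤ π`, so that no cut of
`√·*` with `ε < π/4` is met. -/
def leftBranchRegion (κ : ℝ) : Set ℂ :=
  leftQuadrant ∩ {l | l.im ^ 2 - l.re ^ 2 - 2 * κ ^ 2 ≤ -2 * (l.re * l.im)}

theorem le_sqrt_sq_add_sq (κ s : ℝ) : s ≤ Real.sqrt (κ ^ 2 + s ^ 2) :=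
  Real.le_sqrt_of_sq_le (le_add_of_nonneg_left (sq_nonneg κ))

theorem sqrt_sq_add_sq_le (κ : ℝ) {s : ℝ} (hs : 0 ≤ s) : Real.sqrt (κ ^ 2 + s ^ 2) ≤ |κ| + s := by
  rw [Real.sqrt_le_left (by positivity), ← sq_abs κ]
  nlinarith [mul_nonneg (abs_nonneg κ) hs]

@[simp] theorem leftHyperbola_re (κ s : ℝ) : (leftHyperbola κ s).re = -s := by
  simp [leftHyperbola]

@[simp] theorem leftHyperbola_im (κ s : ℝ) :
    (leftHyperbola κ s).im = Real.sqrt (κ ^ 2 + s ^ 2) := by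
  simp [leftHyperbola]

@[simp] theorem rightHyperbola_re (κ s : ℝ) : (rightHyperbola κ s).re = s := by
  simp [rightHyperbola]

@[simp] theorem rightHyperbola_im (κ s : ℝ) :
    (rightHyperbola κ s).im = Real.sqrt (κ ^ 2 + s ^ 2) := by
  simp [rightHyperbola]

@[simp] theorem leftRay_re (κ s : ℝ) : (leftRay κ s).re = -s := by simp [leftRay]

@[simp] theorem leftRay_im (κ s : ℝ) : (leftRay κ s).im = |κ| + s := by simp [leftRay]

theorem leftHyperbola_zero (κ : ℝ) : leftHyperbola κ 0 = |κ| * Complex.I := by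
  simp [leftHyperbola, Real.sqrt_sq_eq_abs]

theorem rightHyperbola_zero (κ : ℝ) : rightHyperbola κ 0 = |κ| * Complex.I := by
  simp [rightHyperbola, Real.sqrt_sq_eq_abs]

theorem mem_boundedRegion_of_sqrt_le_im {κ s : ℝ} {l : ℂ} (hs : -s ≤ l.re) (hre : l.re ≤ 0)
    (him : Real.sqrt (κ ^ 2 + s ^ 2) ≤ l.im) : l ∈ boundedRegion κ := by
  have him0 : 0 ≤ l.im := (Real.sqrt_nonneg _).trans him
  rw [Real.sqrt_le_left him0] at him
  exact ⟨him0, mul_nonneg_of_nonpos_of_nonpos hre (by nlinarith)⟩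

theorem mem_boundedRegion_of_im_le_sqrt {κ : ℝ} {l : ℂ} (hre : 0 ≤ l.re) (him : 0 ≤ l.im)
    (h : l.im ≤ Real.sqrt (κ ^ 2 + l.re ^ 2)) : l ∈ boundedRegion κ := by
  rw [Real.le_sqrt him (by positivity)] at h
  exact ⟨him, mul_nonneg hre (sub_nonneg.2 h)⟩

theorem mul_I_mem_boundedRegion (κ : ℝ) {s : ℝ} (hs : 0 ≤ s) :
    (s * Complex.I : ℂ) ∈ boundedRegion κ := by
  simpa [boundedRegion] using hs

theorem mul_I_mem_leftQuadrant {s : ℝ} (hs : 0 ≤ s) : (s * Complex.I : ℂ) ∈ leftQuadrant := by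
  simpa [leftQuadrant] using hs

theorem mul_I_mem_rightQuadrant {s : ℝ} (hs : 0 ≤ s) : (s * Complex.I : ℂ) ∈ rightQuadrant := by
  simpa [rightQuadrant] using hs

theorem convex_leftQuadrant : Convex ℝ leftQuadrant :=
  (convex_halfSpace_re_le 0).inter (convex_halfSpace_im_ge 0)

theorem convex_rightQuadrant : Convex ℝ rightQuadrant :=
  (convex_halfSpace_re_ge 0).inter (convex_halfSpace_im_ge 0)

section Slide

variable {a b : ℝ → ℂ}

theorem slide_re (a b : ℝ → ℂ) (s θ : ℝ) :
    (slide a b s θ).re = (a s).re + θ * ((b s).re - (a s).re) := by simp [slide]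

theorem slide_im (a b : ℝ → ℂ) (s θ : ℝ) :
    (slide a b s θ).im = (a s).im + θ * ((b s).im - (a s).im) := by simp [slide]

theorem slide_mem {S : Set ℂ} (hS : Convex ℝ S) {s : ℝ} (ha : a s ∈ S) (hb : b s ∈ S) {θ : ℝ}
    (hθ : θ ∈ Icc (0 : ℝ) 1) : slide a b s θ ∈ S := by
  simpa only [slide, Complex.real_smul] using hS.add_smul_sub_mem ha hb hθ

theorem isDeformation_of_re_eq (ha : IsTameCurve a) (hb : IsTameCurve b)
    (hre : ∀ s, (a s).re = (b s).re) (habs : ∀ s, 0 ≤ s → |(a s).re| = s)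
    (hima : ∀ s, 0 ≤ s → 0 ≤ (a s).im) (himb : ∀ s, 0 ≤ s → s ≤ (b s).im) :
    IsDeformation a b where
  left := ha
  right := hb
  re_ne_zero s hs θ _ := by
    rw [slide_re, hre, sub_self, mul_zero, add_zero, ← abs_pos, ← hre, habs s hs.le]
    exact hs
  mul_le_im s hs θ hθ := by
    rw [slide_im]
    nlinarith [hima s hs, himb s hs, hθ.1, hθ.2]
  le_norm s hs θ _ := by
    refine le_trans ?_ (Complex.abs_re_le_norm _)
    rw [slide_re, hre, sub_self, mul_zero, add_zero, ← hre, habs s hs]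

theorem isDeformation_of_re_eq_zero (ha : IsTameCurve a) (hb : IsTameCurve b)
    (hrea : ∀ s, (a s).re = 0) (hreb : ∀ s, 0 < s → (b s).re ≠ 0)
    (hima : ∀ s, 0 ≤ s → s ≤ (a s).im) (himb : ∀ s, 0 ≤ s → s ≤ (b s).im) :
    IsDeformation a b := by
  have him : ∀ s, 0 ≤ s → ∀ θ ∈ Icc (0 : ℝ) 1, s ≤ (slide a b s θ).im := fun s hs θ hθ =>
    slide_mem (convex_halfSpace_im_ge s) (hima s hs) (himb s hs) hθ
  refine ⟨ha, hb, fun s hs θ hθ => ?_, fun s hs θ hθ => ?_, fun s hs θ hθ => ?_⟩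
  · simpa [slide_re, hrea] using ⟨hθ.1.ne', hreb s hs⟩
  · exact (mul_le_of_le_one_left hs hθ.2).trans (him s hs θ hθ)
  · exact (him s hs θ hθ).trans (Complex.im_le_norm _)

end Slide

section Curves

variable (κ : ℝ)

theorem isDeformation_negAxis_leftHyperbola : IsDeformation negAxis (leftHyperbola κ) :=
  isDeformation_of_re_eq isTameCurve_negAxis (isTameCurve_leftHyperbola κ)
    (by simp [negAxis, leftHyperbola]) (fun s hs => by simp [negAxis, abs_of_nonneg hs])
    (by simp [negAxis]) (fun s _ => by simpa [leftHyperbola] using le_sqrt_sq_add_sq κ s)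

theorem isDeformation_leftHyperbola_leftRay : IsDeformation (leftHyperbola κ) (leftRay κ) :=
  isDeformation_of_re_eq (isTameCurve_leftHyperbola κ) (isTameCurve_leftRay κ)
    (by simp [leftRay, leftHyperbola]) (fun s hs => by simp [leftHyperbola, abs_of_nonneg hs])
    (by simp [leftHyperbola]) (by simp [leftRay])

theorem isDeformation_ofReal_rightHyperbola :
    IsDeformation (fun s => (s : ℂ)) (rightHyperbola κ) :=
  isDeformation_of_re_eq isTameCurve_ofReal (isTameCurve_rightHyperbola κ)
    (by simp [rightHyperbola]) (fun s hs => by simp [abs_of_nonneg hs])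
    (by simp) (fun s _ => by simpa [rightHyperbola] using le_sqrt_sq_add_sq κ s)

theorem isDeformation_rightRay_rightHyperbola : IsDeformation rightRay (rightHyperbola κ) :=
  isDeformation_of_re_eq isTameCurve_rightRay (isTameCurve_rightHyperbola κ)
    (by simp [rightRay, rightHyperbola]) (fun s hs => by simp [rightRay, abs_of_nonneg hs])
    (by simp [rightRay]) (fun s _ => by simpa [rightHyperbola] using le_sqrt_sq_add_sq κ s)

theorem isDeformation_imAxis_leftHyperbola : IsDeformation (imAxis κ) (leftHyperbola κ) :=
  isDeformation_of_re_eq_zero (isTameCurve_imAxis κ) (isTameCurve_leftHyperbola κ)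
    (by simp [imAxis]) (fun s hs => by simpa [leftHyperbola] using hs.ne') (by simp [imAxis])
    (fun s _ => by simpa [leftHyperbola] using le_sqrt_sq_add_sq κ s)

theorem isDeformation_imAxis_rightHyperbola : IsDeformation (imAxis κ) (rightHyperbola κ) :=
  isDeformation_of_re_eq_zero (isTameCurve_imAxis κ) (isTameCurve_rightHyperbola κ)
    (by simp [imAxis]) (fun s hs => by simpa [rightHyperbola] using hs.ne') (by simp [imAxis])
    (fun s _ => by simpa [rightHyperbola] using le_sqrt_sq_add_sq κ s)

theorem leftHyperbola_mem_leftBranchRegion {s : ℝ} (hs : 0 ≤ s) :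
    leftHyperbola κ s ∈ leftBranchRegion κ := by
  refine ⟨by simpa [leftQuadrant] using hs, ?_⟩
  simp only [mem_ofPred_eq, leftHyperbola_re, leftHyperbola_im,
    Real.sq_sqrt (add_nonneg (sq_nonneg κ) (sq_nonneg s))]
  nlinarith [sq_nonneg κ, mul_nonneg hs (Real.sqrt_nonneg (κ ^ 2 + s ^ 2))]

theorem leftRay_mem_leftBranchRegion {s : ℝ} (hs : 0 ≤ s) :
    leftRay κ s ∈ leftBranchRegion κ := by
  refine ⟨⟨by simpa using hs, by simpa using add_nonneg (abs_nonneg κ) hs⟩, ?_⟩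
  simp only [mem_ofPred_eq, leftRay_re, leftRay_im]
  nlinarith [sq_abs κ, sq_nonneg s, sq_nonneg κ]

theorem negAxis_mem_leftBranchRegion {s : ℝ} (hs : 0 ≤ s) : negAxis s ∈ leftBranchRegion κ := by
  refine ⟨by simpa [leftQuadrant, negAxis] using hs, ?_⟩
  have him : (negAxis s).im = 0 := by simp [negAxis]
  simp only [mem_ofPred_eq, him]
  nlinarith [sq_nonneg (negAxis s).re, sq_nonneg κ]

theorem mul_I_mem_leftBranchRegion {s : ℝ} (hs : 0 ≤ s) (hsκ : s ≤ |κ|) :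
    (s * Complex.I : ℂ) ∈ leftBranchRegion κ := by
  refine ⟨mul_I_mem_leftQuadrant hs, ?_⟩
  have hre : (s * Complex.I : ℂ).re = 0 := by simp
  have him : (s * Complex.I : ℂ).im = s := by simp
  simp only [mem_ofPred_eq, hre, him]
  nlinarith [sq_le_sq.2 (show |s| ≤ |κ| by rwa [abs_of_nonneg hs]), sq_nonneg κ]

theorem rightHyperbola_mem_rightQuadrant {s : ℝ} (hs : 0 ≤ s) :
    rightHyperbola κ s ∈ rightQuadrant := by
  simpa [rightQuadrant, rightHyperbola] using hs

theorem imAxis_mem_rightQuadrant {s : ℝ} (hs : 0 ≤ s) : imAxis κ s ∈ rightQuadrant :=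
  mul_I_mem_rightQuadrant (by positivity)

theorem rightRay_mem_rightQuadrant {s : ℝ} (hs : 0 ≤ s) : rightRay s ∈ rightQuadrant := by
  simpa [rightQuadrant, rightRay] using hs

variable {κ} in
theorem slide_mem_boundedRegion_of_sqrt_le_im {a b : ℝ → ℂ} {s θ : ℝ} (hθ : θ ∈ Icc (0 : ℝ) 1)
    (hrea : (a s).re ∈ Icc (-s) 0) (hreb : (b s).re ∈ Icc (-s) 0)
    (hima : Real.sqrt (κ ^ 2 + s ^ 2) ≤ (a s).im) (himb : Real.sqrt (κ ^ 2 + s ^ 2) ≤ (b s).im) :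
    slide a b s θ ∈ boundedRegion κ := by
  have hre_ge := slide_mem (convex_halfSpace_re_ge (-s)) hrea.1 hreb.1 hθ
  have hre_le := slide_mem (convex_halfSpace_re_le 0) hrea.2 hreb.2 hθ
  have him := slide_mem (convex_halfSpace_im_ge (Real.sqrt (κ ^ 2 + s ^ 2))) hima himb hθ
  exact mem_boundedRegion_of_sqrt_le_im hre_ge hre_le him

variable {κ} in
theorem slide_rightHyperbola_mem_boundedRegion {a : ℝ → ℂ} {s θ : ℝ} (hs : 0 ≤ s)
    (hθ : θ ∈ Icc (0 : ℝ) 1) (hre : (a s).re = s) (him : (a s).im ∈ Icc 0 s) :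
    slide a (rightHyperbola κ) s θ ∈ boundedRegion κ := by
  have hre' : (slide a (rightHyperbola κ) s θ).re = s := by simp [slide_re, hre]
  have him_ge := slide_mem (convex_halfSpace_im_ge 0) (b := rightHyperbola κ) him.1
    (by simp) hθ
  have him_le := slide_mem (convex_halfSpace_im_le (Real.sqrt (κ ^ 2 + s ^ 2)))
    (b := rightHyperbola κ) (him.2.trans (le_sqrt_sq_add_sq κ s)) (by simp) hθ
  exact mem_boundedRegion_of_im_le_sqrt (hre'.symm ▸ hs) him_ge (hre'.symm ▸ him_le)

end Curves

/-- `I = ∫ f(l) dl` along `-∞ → 0 → i|κ|` followed by the curve `γ` starting at `i|κ|`: the left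
component of both boundary contours. -/
def HasLeftContourIntegral (κ : ℝ) (γ : ℝ → ℂ) (f : ℂ → ℂ) (I : ℂ) : Prop :=
  ∃ I₁ I₂ I₃ : ℂ, HasCurveIntegral negAxis f I₁ ∧ HasSegmentIntegral κ f I₂ ∧
    HasCurveIntegral γ f I₃ ∧ I = -I₁ + I₂ + I₃

/-- `I = ∫ f(l) dl` along the curve `α` traversed backwards, followed by `β`: the right component
of both boundary contours. -/
def HasRightContourIntegral (α β : ℝ → ℂ) (f : ℂ → ℂ) (I : ℂ) : Prop :=
  ∃ I₄ I₅ : ℂ, HasCurveIntegral α f I₄ ∧ HasCurveIntegral β f I₅ ∧ I = -I₄ + I₅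

section ContourIntegrals

variable {κ y : ℝ} {α β γ : ℝ → ℂ} {F F₁ F₂ : ℂ → ℂ} {I J : ℂ}

namespace HasSegmentIntegral

theorem sub (hI : HasSegmentIntegral κ F₁ I) (hJ : HasSegmentIntegral κ F₂ J) :
    HasSegmentIntegral κ (fun l => F₁ l - F₂ l) (I - J) := by
  refine ⟨by simpa only [sub_mul] using hI.1.sub hJ.1, ?_⟩
  simp only [sub_mul, intervalIntegral.integral_sub hI.1 hJ.1, hI.2, hJ.2]

theorem congr (hI : HasSegmentIntegral κ F₁ I)
    (h : ∀ s : ℝ, 0 < s → s < |κ| → F₁ (s * Complex.I) = F₂ (s * Complex.I)) :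
    HasSegmentIntegral κ F₂ I := by
  have hae : (fun s : ℝ => F₁ (s * Complex.I) * Complex.I) =ᵐ[volume.restrict (uIoc 0 |κ|)]
      fun s => F₂ (s * Complex.I) * Complex.I := by
    rw [uIoc_of_le (abs_nonneg κ), ← restrict_Ioo_eq_restrict_Ioc]
    filter_upwards [ae_restrict_mem measurableSet_Ioo] with s hs
    rw [h s hs.1 hs.2]
  exact ⟨hI.1.congr_ae hae, hI.2.trans (intervalIntegral.integral_congr_ae_restrict hae)⟩

end HasSegmentIntegral

namespace HasLeftContourIntegral

theorem sub (hI : HasLeftContourIntegral κ γ F₁ I) (hJ : HasLeftContourIntegral κ γ F₂ J) :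
    HasLeftContourIntegral κ γ (fun l => F₁ l - F₂ l) (I - J) := by
  obtain ⟨I₁, I₂, I₃, h₁, h₂, h₃, rfl⟩ := hI
  obtain ⟨J₁, J₂, J₃, k₁, k₂, k₃, rfl⟩ := hJ
  exact ⟨_, _, _, h₁.sub k₁, h₂.sub k₂, h₃.sub k₃, by ring⟩

theorem congr (hI : HasLeftContourIntegral κ γ F₁ I)
    (hγ : ∀ s, 0 < s → γ s ∈ leftBranchRegion κ ∧ (γ s).re ≠ 0)
    (h : ∀ l ∈ leftBranchRegion κ, l ≠ |κ| * Complex.I → F₁ l = F₂ l) :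
    HasLeftContourIntegral κ γ F₂ I := by
  obtain ⟨I₁, I₂, I₃, h₁, h₂, h₃, rfl⟩ := hI
  refine ⟨I₁, I₂, I₃, h₁.congr_off 0 fun s hs _ => ?_,
    h₂.congr fun s hs hsκ => ?_, h₃.congr_off 0 fun s hs _ => ?_, rfl⟩
  · refine h _ (negAxis_mem_leftBranchRegion κ hs.le) fun heq => ?_
    simpa [negAxis, hs.ne'] using congrArg Complex.re heq
  · refine h _ (mul_I_mem_leftBranchRegion κ hs.le hsκ.le) fun heq => hsκ.ne ?_
    simpa using congrArg Complex.im heq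
  · refine h _ (hγ s hs).1 fun heq => (hγ s hs).2 ?_
    simpa using congrArg Complex.re heq

end HasLeftContourIntegral

namespace HasRightContourIntegral

theorem sub (hI : HasRightContourIntegral α β F₁ I) (hJ : HasRightContourIntegral α β F₂ J) :
    HasRightContourIntegral α β (fun l => F₁ l - F₂ l) (I - J) := by
  obtain ⟨I₄, I₅, h₄, h₅, rfl⟩ := hI
  obtain ⟨J₄, J₅, k₄, k₅, rfl⟩ := hJ
  exact ⟨_, _, h₄.sub k₄, h₅.sub k₅, by ring⟩

theorem congr {c : ℝ} (hI : HasRightContourIntegral (imAxis c) β F₁ I)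
    (hβ : ∀ s, 0 < s → β s ∈ rightQuadrant ∧ (β s).re ≠ 0)
    (h : ∀ l ∈ rightQuadrant, l ≠ |κ| * Complex.I → F₁ l = F₂ l) :
    HasRightContourIntegral (imAxis c) β F₂ I := by
  obtain ⟨I₄, I₅, h₄, h₅, rfl⟩ := hI
  refine ⟨I₄, I₅, h₄.congr_off (|κ| - |c|) fun s hs hne => ?_, h₅.congr_off 0 fun s hs _ => ?_, rfl⟩
  · refine h _ (imAxis_mem_rightQuadrant c hs.le) fun heq => hne (eq_sub_of_add_eq' ?_)
    simpa [imAxis] using congrArg Complex.im heq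
  · refine h _ (hβ s hs).1 fun heq => (hβ s hs).2 ?_
    simpa using congrArg Complex.re heq

end HasRightContourIntegral

theorem hasBoundaryIntegral_add (hI : HasLeftContourIntegral κ (leftHyperbola κ) F I)
    (hJ : HasRightContourIntegral (imAxis κ) (rightHyperbola κ) F J) :
    HasBoundaryIntegral κ F (I + J) := by
  obtain ⟨_, _, _, h₁, h₂, h₃, rfl⟩ := hI
  obtain ⟨_, _, h₄, h₅, rfl⟩ := hJ
  exact ⟨_, _, _, _, _, h₁, h₂, h₃, h₄, h₅, rfl⟩

theorem hasAsymptoticBoundaryIntegral_add (hI : HasLeftContourIntegral κ (leftRay κ) F I)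
    (hJ : HasRightContourIntegral (imAxis 0) rightRay F J) :
    HasAsymptoticBoundaryIntegral κ F (I + J) := by
  obtain ⟨_, _, _, h₁, h₂, h₃, rfl⟩ := hI
  obtain ⟨_, _, h₄, h₅, rfl⟩ := hJ
  exact ⟨_, _, _, _, _, h₁, h₂, h₃, h₄, h₅, rfl⟩

theorem deriv_imAxis (κ s : ℝ) : deriv (imAxis κ) s = Complex.I := by
  have h : HasDerivAt (imAxis κ) (((1 : ℝ) : ℂ) * Complex.I) s :=
    ((hasDerivAt_id s).const_add |κ|).ofReal_comp.mul_const _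
  simpa using h.deriv

namespace IsDecaying

variable {S : Set ℂ} (h : IsDecaying y S F)
include h

theorem intervalIntegrable_mul_I (hmem : ∀ s : ℝ, 0 ≤ s → (s * Complex.I : ℂ) ∈ S) {R : ℝ}
    (hR : 0 ≤ R) : IntervalIntegrable (fun s : ℝ => F (s * Complex.I) * Complex.I) volume 0 R := by
  refine ContinuousOn.intervalIntegrable ?_
  rw [uIcc_of_le hR]
  exact (h.continuousOn.comp (by fun_prop) fun s hs => hmem s hs.1).mul continuousOn_const

theorem hasCurveIntegral_imAxis_zero (hmem : ∀ s : ℝ, 0 ≤ s → (s * Complex.I : ℂ) ∈ S)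
    (hI : HasCurveIntegral (imAxis κ) F I) :
    HasCurveIntegral (imAxis 0) F ((∫ s in (0 : ℝ)..|κ|, F (s * Complex.I) * Complex.I) + I) := by
  have hint := fun R hR => h.intervalIntegrable_mul_I hmem (R := R) hR
  refine ⟨fun R hR => by simpa [imAxis, deriv_imAxis] using hint R hR, ?_⟩
  refine ((hI.2.const_add _).comp (tendsto_atTop_add_const_right atTop (-|κ|) tendsto_id)).congr' ?_
  filter_upwards [eventually_ge_atTop |κ|] with R hR
  simp only [Function.comp, deriv_imAxis, imAxis, id, abs_zero, zero_add]
  rw [intervalIntegral.integral_comp_add_left (fun s : ℝ => F (s * Complex.I) * Complex.I) |κ|,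
    add_zero, add_neg_cancel_comm_assoc, intervalIntegral.integral_add_adjacent_intervals
    (hint _ (abs_nonneg κ))
    ((hint _ (abs_nonneg κ)).symm.trans (hint R ((abs_nonneg κ).trans hR)))]

theorem exists_hasCurveIntegral_leftHyperbola (hy : 0 < y)
    (hmem : ∀ s, 0 ≤ s → ∀ θ ∈ Icc (0 : ℝ) 1, slide (leftHyperbola κ) (leftRay κ) s θ ∈ S) :
    ∃ I, HasCurveIntegral (leftHyperbola κ) F I ∧ HasCurveIntegral (leftRay κ) F I := by
  obtain ⟨I, hI⟩ := h.exists_hasCurveIntegral hy (isTameCurve_leftRay κ)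
    (fun s hs => by simpa using hmem s hs 1 (right_mem_Icc.2 zero_le_one)) (by simp)
  refine ⟨I, h.hasCurveIntegral_of_isDeformation_of_eq hy (isDeformation_leftHyperbola_leftRay κ)
    ?_ hmem hI, hI⟩
  simp [leftHyperbola_zero, leftRay]

theorem exists_hasCurveIntegral_rightHyperbola (hy : 0 < y)
    (hmem : ∀ s, 0 ≤ s → ∀ θ ∈ Icc (0 : ℝ) 1, slide rightRay (rightHyperbola κ) s θ ∈ S) :
    ∃ I, HasCurveIntegral (rightHyperbola κ) F I ∧ HasCurveIntegral rightRay F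
      ((∫ s in (0 : ℝ)..|κ|, F (s * Complex.I) * Complex.I) + I) := by
  obtain ⟨I, hI⟩ := h.exists_hasCurveIntegral hy (isTameCurve_rightHyperbola κ)
    (fun s hs => by simpa using hmem s hs 1 (right_mem_Icc.2 zero_le_one))
    (fun s _ => by simpa using le_sqrt_sq_add_sq κ s)
  exact ⟨I, hI, h.hasCurveIntegral_of_isDeformation_of_segment hy
    (isDeformation_rightRay_rightHyperbola κ) (by simp [rightRay]) (rightHyperbola_zero κ) hmem hI⟩

end IsDecaying

theorem hasLeftContourIntegral_zero (hy : 0 < y) (hF : IsDecaying y leftQuadrant F) :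
    HasLeftContourIntegral κ (leftHyperbola κ) F 0 ∧ HasLeftContourIntegral κ (leftRay κ) F 0 := by
  have hhyp : ∀ s, 0 ≤ s → leftHyperbola κ s ∈ leftQuadrant := fun s hs =>
    (leftHyperbola_mem_leftBranchRegion κ hs).1
  obtain ⟨I, hI, hI'⟩ := hF.exists_hasCurveIntegral_leftHyperbola hy fun s hs θ hθ =>
    slide_mem convex_leftQuadrant (hhyp s hs) (leftRay_mem_leftBranchRegion κ hs).1 hθ
  have hneg := hF.hasCurveIntegral_of_isDeformation_of_segment hy
    (isDeformation_negAxis_leftHyperbola κ) (by simp [negAxis]) (leftHyperbola_zero κ)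
    (fun s hs θ hθ => slide_mem convex_leftQuadrant (negAxis_mem_leftBranchRegion κ hs).1
      (hhyp s hs) hθ) hI
  have hseg : HasSegmentIntegral κ F _ :=
    ⟨hF.intervalIntegrable_mul_I (fun s => mul_I_mem_leftQuadrant) (abs_nonneg κ), rfl⟩
  exact ⟨⟨_, _, _, hneg, hseg, hI, by ring⟩, ⟨_, _, _, hneg, hseg, hI', by ring⟩⟩

theorem hasRightContourIntegral_zero (hy : 0 < y) (hF : IsDecaying y rightQuadrant F) :
    HasRightContourIntegral (imAxis κ) (rightHyperbola κ) F 0 ∧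
      HasRightContourIntegral (imAxis 0) rightRay F 0 := by
  have hhyp : ∀ s, 0 ≤ s → rightHyperbola κ s ∈ rightQuadrant := fun s hs =>
    rightHyperbola_mem_rightQuadrant κ hs
  obtain ⟨I, hI, hI'⟩ := hF.exists_hasCurveIntegral_rightHyperbola hy fun s hs θ hθ =>
    slide_mem convex_rightQuadrant (rightRay_mem_rightQuadrant hs) (hhyp s hs) hθ
  have haxis := hF.hasCurveIntegral_of_isDeformation_of_eq hy
    (isDeformation_imAxis_rightHyperbola κ) (by simp [imAxis, rightHyperbola_zero])
    (fun s hs θ hθ => slide_mem convex_rightQuadrant (imAxis_mem_rightQuadrant κ hs)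
      (hhyp s hs) hθ) hI
  have haxis' := hF.hasCurveIntegral_imAxis_zero (fun s => mul_I_mem_rightQuadrant) haxis
  exact ⟨⟨_, _, haxis, hI, by ring⟩, ⟨_, _, haxis', hI', by ring⟩⟩

theorem exists_hasContourIntegral_boundedRegion (hy : 0 < y)
    (hF : IsDecaying y (boundedRegion κ) F) (hJ : HasCurveIntegral negAxis F J) :
    ∃ A B I, HasCurveIntegral (fun s => (s : ℂ)) F I ∧ A + B = -J + I ∧
      HasLeftContourIntegral κ (leftHyperbola κ) F A ∧
      HasLeftContourIntegral κ (leftRay κ) F A ∧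
      HasRightContourIntegral (imAxis κ) (rightHyperbola κ) F B ∧
      HasRightContourIntegral (imAxis 0) rightRay F B := by
  have hsegmem : ∀ s : ℝ, 0 ≤ s → (s * Complex.I : ℂ) ∈ boundedRegion κ := fun s =>
    mul_I_mem_boundedRegion κ
  obtain ⟨L, hL, hL'⟩ := hF.exists_hasCurveIntegral_leftHyperbola (κ := κ) hy fun s hs θ hθ =>
    slide_mem_boundedRegion_of_sqrt_le_im (κ := κ) hθ (by simpa using hs) (by simpa using hs)
      (by simp) (by simpa using sqrt_sq_add_sq_le κ hs)
  obtain ⟨P, hP, hP'⟩ := hF.exists_hasCurveIntegral_rightHyperbola hy fun s hs θ hθ =>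
    slide_rightHyperbola_mem_boundedRegion (κ := κ) hs hθ (by simp [rightRay])
      (by simpa [rightRay] using hs)
  have haxis := hF.hasCurveIntegral_of_isDeformation_of_eq hy
    (isDeformation_imAxis_leftHyperbola κ) (by simp [imAxis, leftHyperbola_zero])
    (fun s hs θ hθ => slide_mem_boundedRegion_of_sqrt_le_im (κ := κ) hθ (by simpa [imAxis] using hs)
      (by simpa using hs) (by simpa [imAxis] using sqrt_sq_add_sq_le κ hs) (by simp)) hL
  have haxis' := hF.hasCurveIntegral_imAxis_zero hsegmem haxis
  have hpos := hF.hasCurveIntegral_of_isDeformation_of_segment hy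
    (isDeformation_ofReal_rightHyperbola κ) Complex.ofReal_zero (rightHyperbola_zero κ)
    (fun s hs θ hθ => slide_rightHyperbola_mem_boundedRegion (κ := κ) hs hθ (by simp)
      (by simpa using hs)) hP
  have hseg : HasSegmentIntegral κ F _ :=
    ⟨hF.intervalIntegrable_mul_I hsegmem (abs_nonneg κ), rfl⟩
  exact ⟨_, _, _, hpos, by ring, ⟨_, _, _, hJ, hseg, hL, rfl⟩, ⟨_, _, _, hJ, hseg, hL', rfl⟩,
    ⟨_, _, haxis, hP, rfl⟩, ⟨_, _, haxis', hP', by ring⟩⟩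

theorem exists_hasBoundaryIntegral {FL FR : ℂ → ℂ} {f : ℂ → ℂ} (hy : 0 < y)
    (hF : IsDecaying y (boundedRegion κ) F) (hFL : IsDecaying y leftQuadrant FL)
    (hFR : IsDecaying y rightQuadrant FR)
    (hfL : ∀ l ∈ leftBranchRegion κ, l ≠ |κ| * Complex.I → f l = F l - FL l)
    (hfR : ∀ l ∈ rightQuadrant, l ≠ |κ| * Complex.I → f l = F l - FR l)
    (hJ : HasCurveIntegral negAxis F J) :
    ∃ I, HasCurveIntegral (fun s => (s : ℂ)) F I ∧ HasBoundaryIntegral κ f (-J + I) ∧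
      HasAsymptoticBoundaryIntegral κ f (-J + I) := by
  obtain ⟨A, B, I, hpos, hAB, hAh, hAr, hBh, hBr⟩ :=
    exists_hasContourIntegral_boundedRegion hy hF hJ
  obtain ⟨hLh, hLr⟩ := hasLeftContourIntegral_zero (κ := κ) hy hFL
  obtain ⟨hRh, hRr⟩ := hasRightContourIntegral_zero (κ := κ) hy hFR
  have hsum : (A - 0) + (B - 0) = -J + I := by rw [sub_zero, sub_zero, hAB]
  have hfL' := fun l hl hne => (hfL l hl hne).symm
  have hfR' := fun l hl hne => (hfR l hl hne).symm
  refine ⟨I, hpos, hsum ▸ hasBoundaryIntegral_add ((hAh.sub hLh).congr (fun s hs => ?_) hfL')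
    ((hBh.sub hRh).congr (fun s hs => ?_) hfR'), hsum ▸ hasAsymptoticBoundaryIntegral_add
    ((hAr.sub hLr).congr (fun s hs => ?_) hfL') ((hBr.sub hRr).congr (fun s hs => ?_) hfR')⟩
  · exact ⟨leftHyperbola_mem_leftBranchRegion κ hs.le, by simpa using hs.ne'⟩
  · exact ⟨rightHyperbola_mem_rightQuadrant κ hs.le, by simpa using hs.ne'⟩
  · exact ⟨leftRay_mem_leftBranchRegion κ hs.le, by simpa using hs.ne'⟩
  · exact ⟨rightRay_mem_rightQuadrant hs.le, by simpa [rightRay] using hs.ne'⟩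

end ContourIntegrals

/-! ### Analytic branches of the square root -/

theorem argStar_sq {ε : ℝ} (hε : 0 < ε) {v : ℂ} (h : ε ≤ 2 * v.arg) :
    argStar ε (v ^ 2) = 2 * v.arg := by
  obtain ⟨k, hk⟩ := Real.Angle.angle_eq_iff_two_pi_dvd_sub.1
    ((Complex.arg_pow_coe_angle v 2).trans (Real.Angle.coe_nsmul 2 v.arg).symm)
  have harg : (v ^ 2).arg = 2 * v.arg + k • (2 * Real.pi) := by
    rw [nsmul_eq_mul, Nat.cast_ofNat] at hk
    rw [zsmul_eq_mul]
    linarith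
  rw [argStar, harg, toIcoMod_add_zsmul, toIcoMod_eq_self]
  exact ⟨h, by linarith [v.arg_le_pi]⟩

theorem sqrtStar_sq {ε : ℝ} (hε : 0 < ε) {v : ℂ} (h : v ≠ 0 → ε ≤ 2 * v.arg) :
    sqrtStar ε (v ^ 2) = v := by
  rcases eq_or_ne v 0 with rfl | hv
  · simp [sqrtStar]
  · rw [sqrtStar, argStar_sq hε (h hv), norm_pow, Real.sqrt_sq (norm_nonneg v),
      mul_div_cancel_left₀ _ two_ne_zero, mul_comm Complex.I, Complex.norm_mul_exp_arg_mul_I]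

theorem pi_div_eight_le_arg {v : ℂ} (hv : v ≠ 0) (him : 0 ≤ v.im) (h : (v ^ 2).re ≤ (v ^ 2).im) :
    Real.pi / 8 ≤ v.arg := by
  by_contra! hlt
  have hre : (v ^ 2).re = ‖v‖ ^ 2 * Real.cos (2 * v.arg) := by
    rw [sq, Complex.mul_re, ← Complex.norm_mul_cos_arg, ← Complex.norm_mul_sin_arg,
      Real.cos_two_mul']
    ring
  have him' : (v ^ 2).im = ‖v‖ ^ 2 * Real.sin (2 * v.arg) := by
    rw [sq, Complex.mul_im, ← Complex.norm_mul_cos_arg, ← Complex.norm_mul_sin_arg,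
      Real.sin_two_mul]
    ring
  have harg : 0 ≤ v.arg := Complex.arg_nonneg_iff.2 him
  have hsin : Real.sin (2 * v.arg) < Real.sin (Real.pi / 4) :=
    Real.sin_lt_sin_of_lt_of_le_pi_div_two (by linarith) (by linarith) (by linarith)
  have hcos : Real.cos (Real.pi / 4) < Real.cos (2 * v.arg) :=
    Real.cos_lt_cos_of_nonneg_of_le_pi (by linarith) (by linarith) (by linarith)
  rw [hre, him'] at h
  rw [Real.sin_pi_div_four, ← Real.cos_pi_div_four] at hsin
  exact (hsin.trans hcos).not_ge (le_of_mul_le_mul_left h (by positivity))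

/-- A continuous branch of `√(-l² - 2κ²)` on `S` with values in the closed upper half plane,
holomorphic off the coordinate axes. -/
structure IsRootBranch (κ : ℝ) (S : Set ℂ) (ν : ℂ → ℂ) : Prop where
  sq_eq : ∀ l ∈ S, ν l ^ 2 = -l ^ 2 - 2 * (κ : ℂ) ^ 2
  im_nonneg : ∀ l ∈ S, 0 ≤ (ν l).im
  continuousOn : ContinuousOn ν S
  differentiableAt : ∀ l ∈ S, l.re ≠ 0 → 0 < l.im → DifferentiableAt ℂ ν l

theorem cpow_inv_two_sq (z : ℂ) : (z ^ (2⁻¹ : ℂ)) ^ 2 = z := by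
  exact_mod_cast Complex.cpow_nat_inv_pow z two_ne_zero

theorem abs_im_cpow_inv_two_le {z : ℂ} (hz : 0 ≤ z.re) :
    |(z ^ (2⁻¹ : ℂ)).im| ≤ (z ^ (2⁻¹ : ℂ)).re := by
  have hre : 0 ≤ (z ^ (2⁻¹ : ℂ)).re := by
    rw [Complex.cpow_inv_two_re]
    positivity
  have hsq := congrArg Complex.re (cpow_inv_two_sq z)
  rw [sq, Complex.mul_re] at hsq
  exact abs_le_of_sq_le_sq (by nlinarith) hre

theorem isRootBranch_cpow_inv_two {κ : ℝ} {S : Set ℂ} {c d : ℂ} (hcd : c ^ 2 * d = -1)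
    (hc : |c.re| ≤ c.im) (hre : ∀ l ∈ S, 0 ≤ (d * (l ^ 2 + 2 * (κ : ℂ) ^ 2)).re)
    (hre_pos : ∀ l ∈ S, l.re ≠ 0 → 0 < l.im → 0 < (d * (l ^ 2 + 2 * (κ : ℂ) ^ 2)).re) :
    IsRootBranch κ S fun l => c * (d * (l ^ 2 + 2 * (κ : ℂ) ^ 2)) ^ (2⁻¹ : ℂ) where
  sq_eq l _ := by
    rw [mul_pow, cpow_inv_two_sq]
    linear_combination (l ^ 2 + 2 * (κ : ℂ) ^ 2) * hcd
  im_nonneg l hl := by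
    have him := abs_im_cpow_inv_two_le (hre l hl)
    have hprod := mul_le_mul hc him (abs_nonneg _) ((abs_nonneg _).trans hc)
    rw [← abs_mul] at hprod
    rw [Complex.mul_im]
    linarith [neg_le_of_abs_le hprod]
  continuousOn l hl := by
    have hroot : ContinuousAt (fun z : ℂ => z ^ (2⁻¹ : ℂ)) (d * (l ^ 2 + 2 * (κ : ℂ) ^ 2)) :=
      Complex.continuousAt_cpow_const_of_re_pos (Or.inl (hre l hl)) (by norm_num)
    refine (ContinuousAt.const_mul ?_ c).continuousWithinAt
    exact hroot.comp_of_eq (by fun_prop : ContinuousAt (fun l : ℂ => d * (l ^ 2 + 2 * κ ^ 2)) l) rfl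
  differentiableAt l hl hl_re hl_im :=
    (DifferentiableAt.cpow_const (f := fun l : ℂ => d * (l ^ 2 + 2 * (κ : ℂ) ^ 2)) (by fun_prop)
      (Or.inl (hre_pos l hl hl_re hl_im))).const_mul c

/-- The branch of `√(-l² - 2κ²)` on the second quadrant with values in `0 ≤ arg ≤ π/2`; it agrees
with `ν_κ` on `leftBranchRegion κ`. -/
def leftRoot (κ : ℝ) (l : ℂ) : ℂ :=
  (1 + Complex.I) * (Complex.I / 2 * (l ^ 2 + 2 * (κ : ℂ) ^ 2)) ^ (2⁻¹ : ℂ)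

/-- The branch of `√(-l² - 2κ²)` on the first quadrant with values in `π/2 ≤ arg ≤ π`; it agrees
with `ν_κ` there. -/
def rightRoot (κ : ℝ) (l : ℂ) : ℂ :=
  (-1 + Complex.I) * (-(Complex.I / 2) * (l ^ 2 + 2 * (κ : ℂ) ^ 2)) ^ (2⁻¹ : ℂ)

theorem re_I_div_two_mul (κ : ℝ) (l : ℂ) :
    (Complex.I / 2 * (l ^ 2 + 2 * (κ : ℂ) ^ 2)).re = -(l.re * l.im) := by
  simp [pow_two]
  ring

theorem re_neg_I_div_two_mul (κ : ℝ) (l : ℂ) :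
    (-(Complex.I / 2) * (l ^ 2 + 2 * (κ : ℂ) ^ 2)).re = l.re * l.im := by
  rw [neg_mul, Complex.neg_re, re_I_div_two_mul, neg_neg]

theorem isRootBranch_leftRoot (κ : ℝ) : IsRootBranch κ leftQuadrant (leftRoot κ) := by
  refine isRootBranch_cpow_inv_two ?_ (by simp) (fun l hl => ?_) fun l hl hre him => ?_
  · linear_combination (1 + Complex.I / 2) * Complex.I_sq
  · rw [re_I_div_two_mul]
    exact neg_nonneg.2 (mul_nonpos_of_nonpos_of_nonneg hl.1 hl.2)
  · rw [re_I_div_two_mul]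
    exact neg_pos.2 (mul_neg_of_neg_of_pos (lt_of_le_of_ne hl.1 hre) him)

theorem isRootBranch_rightRoot (κ : ℝ) : IsRootBranch κ rightQuadrant (rightRoot κ) := by
  refine isRootBranch_cpow_inv_two ?_ (by simp) (fun l hl => ?_) fun l hl hre him => ?_
  · linear_combination (1 - Complex.I / 2) * Complex.I_sq
  · rw [re_neg_I_div_two_mul]
    exact mul_nonneg hl.1 hl.2
  · rw [re_neg_I_div_two_mul]
    exact mul_pos (lt_of_le_of_ne hl.1 hre.symm) him

theorem rightRoot_re_nonpos (κ : ℝ) {l : ℂ} (hl : l ∈ rightQuadrant) : (rightRoot κ l).re ≤ 0 := by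
  have him := abs_le.1 (abs_im_cpow_inv_two_le
    ((re_neg_I_div_two_mul κ l).symm ▸ mul_nonneg hl.1 hl.2))
  rw [rightRoot, Complex.mul_re, Complex.add_re, Complex.add_im, Complex.neg_re, Complex.neg_im,
    Complex.one_re, Complex.one_im, Complex.I_re, Complex.I_im]
  linarith

theorem nu_eq_leftRoot {ε κ : ℝ} (hε : 0 < ε) (hε' : ε < Real.pi / 4) {l : ℂ}
    (hl : l ∈ leftBranchRegion κ) : nu ε κ l = leftRoot κ l := by
  have hsq := (isRootBranch_leftRoot κ).sq_eq l hl.1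
  have hre_im : (leftRoot κ l ^ 2).re ≤ (leftRoot κ l ^ 2).im := by
    have hre : (-l ^ 2 - 2 * (κ : ℂ) ^ 2).re = l.im ^ 2 - l.re ^ 2 - 2 * κ ^ 2 := by
      simp [pow_two]
    have him : (-l ^ 2 - 2 * (κ : ℂ) ^ 2).im = -2 * (l.re * l.im) := by
      simp [pow_two]
      ring
    rw [hsq, hre, him]
    exact hl.2
  rw [nu, ← hsq]
  refine sqrtStar_sq hε fun hv => ?_
  linarith [pi_div_eight_le_arg hv ((isRootBranch_leftRoot κ).im_nonneg l hl.1) hre_im]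

theorem nu_eq_rightRoot {ε κ : ℝ} (hε : 0 < ε) (hε' : ε < Real.pi / 4) {l : ℂ}
    (hl : l ∈ rightQuadrant) : nu ε κ l = rightRoot κ l := by
  have hb := isRootBranch_rightRoot κ
  rw [nu, ← hb.sq_eq l hl]
  refine sqrtStar_sq hε fun hv => ?_
  have harg : Real.pi / 2 ≤ (rightRoot κ l).arg := by
    by_contra! hlt
    have habs : |(rightRoot κ l).arg| < Real.pi / 2 := by
      rwa [abs_of_nonneg (Complex.arg_nonneg_iff.2 (hb.im_nonneg l hl))]
    rcases Complex.abs_arg_lt_pi_div_two_iff.1 habs with hre | hzero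
    · exact hre.not_ge (rightRoot_re_nonpos κ hl)
    · exact hv hzero
  linarith [Real.pi_pos]

/-! ### The Fourier transform on the half line -/

/-- Fourier transform on the half line (used for `Im l ≤ 0`). -/
def halfLineFT (f : ℝ → ℂ) (l : ℂ) : ℂ :=
  ∫ y in Ioi (0 : ℝ), Complex.exp (-Complex.I * y * l) * f y

/-- The first moment `-iy f(y)`, whose transform is the derivative of the transform of `f`. -/
def momentFun (f : ℝ → ℂ) (y : ℝ) : ℂ := -Complex.I * y * f y

/-- The divided difference `(halfLineFT f b - halfLineFT f a) / (b - a)`, written as an average of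
the derivative so that it makes sense, and is continuous, across `a = b`. -/
def ftSlope (f : ℝ → ℂ) (p : ℂ × ℂ) : ℂ :=
  ∫ s in (0 : ℝ)..1, halfLineFT (momentFun f) (p.1 + s * (p.2 - p.1))

theorem norm_exp_I_mul (l : ℂ) (y : ℝ) :
    ‖Complex.exp (Complex.I * l * y)‖ = Real.exp (-y * l.im) := by
  rw [Complex.norm_exp]
  congr 1
  simp
  ring

theorem norm_exp_neg_I_mul_mul_le {y : ℝ} (hy : 0 ≤ y) {l : ℂ} (hl : l.im ≤ 0) (c : ℂ) :
    ‖Complex.exp (-Complex.I * y * l) * c‖ ≤ ‖c‖ := by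
  rw [norm_mul, Complex.norm_exp]
  refine mul_le_of_le_one_left (norm_nonneg _) (Real.exp_le_one_iff.2 ?_)
  simpa using mul_nonpos_of_nonneg_of_nonpos hy hl

theorem ae_norm_exp_neg_I_mul_mul_le {l : ℂ} (hl : l.im ≤ 0) (f : ℝ → ℂ) :
    ∀ᵐ y : ℝ ∂volume.restrict (Ioi 0), ‖Complex.exp (-Complex.I * y * l) * f y‖ ≤ ‖f y‖ :=
  ae_restrict_of_forall_mem measurableSet_Ioi fun _ hy =>
    norm_exp_neg_I_mul_mul_le (le_of_lt hy) hl _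

theorem aestronglyMeasurable_exp_neg_I_mul_mul {f : ℝ → ℂ} {μ : Measure ℝ}
    (hf : AEStronglyMeasurable f μ) (l : ℂ) :
    AEStronglyMeasurable (fun y : ℝ => Complex.exp (-Complex.I * y * l) * f y) μ :=
  (Continuous.aestronglyMeasurable (by fun_prop)).mul hf

theorem im_segment_nonpos {a b : ℂ} (ha : a.im ≤ 0) (hb : b.im ≤ 0) {s : ℝ}
    (hs : s ∈ Icc (0 : ℝ) 1) : (a + s * (b - a)).im ≤ 0 := by
  rw [Complex.add_im, Complex.im_ofReal_mul, Complex.sub_im]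
  nlinarith [hs.1, hs.2]

theorem hasDerivAt_exp_mul_ofReal (η : ℂ) (τ : ℝ) :
    HasDerivAt (fun τ : ℝ => Complex.exp (η * τ)) (η * Complex.exp (η * τ)) τ := by
  have hlin : HasDerivAt (fun τ : ℝ => η * (τ : ℂ)) η τ := by
    simpa using (Complex.ofRealCLM.hasDerivAt (x := τ)).const_mul η
  exact hlin.cexp.congr_deriv (by ring)

theorem hasDerivAt_exp_neg_I_mul_mul (l : ℂ) (y : ℝ) :
    HasDerivAt (fun y : ℝ => Complex.exp (-Complex.I * y * l))
      (-Complex.I * l * Complex.exp (-Complex.I * y * l)) y := by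
  simpa only [mul_right_comm] using hasDerivAt_exp_mul_ofReal (-Complex.I * l) y

section HalfLine

variable {f f' : ℝ → ℂ} {a b l : ℂ}

theorem integrableOn_exp_neg_I_mul_mul (hf : IntegrableOn f (Ioi 0)) (hl : l.im ≤ 0) :
    IntegrableOn (fun y : ℝ => Complex.exp (-Complex.I * y * l) * f y) (Ioi 0) :=
  hf.norm.mono' (aestronglyMeasurable_exp_neg_I_mul_mul hf.aestronglyMeasurable l)
    (ae_norm_exp_neg_I_mul_mul_le hl f)

theorem norm_halfLineFT_le (hf : IntegrableOn f (Ioi 0)) (hl : l.im ≤ 0) :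
    ‖halfLineFT f l‖ ≤ ∫ y in Ioi (0 : ℝ), ‖f y‖ :=
  norm_integral_le_of_norm_le hf.norm (ae_norm_exp_neg_I_mul_mul_le hl f)

theorem continuousOn_halfLineFT (hf : IntegrableOn f (Ioi 0)) :
    ContinuousOn (halfLineFT f) {l | l.im ≤ 0} :=
  continuousOn_of_dominated
    (fun l _ => aestronglyMeasurable_exp_neg_I_mul_mul hf.aestronglyMeasurable l)
    (fun _ hl => ae_norm_exp_neg_I_mul_mul_le hl f) hf.norm
    (Eventually.of_forall fun y => by fun_prop)

theorem differentiableAt_halfLineFT (hf : IntegrableOn f (Ioi 0))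
    (hm : IntegrableOn (momentFun f) (Ioi 0)) (hl : l.im < 0) :
    DifferentiableAt ℂ (halfLineFT f) l := by
  refine (hasDerivAt_integral_of_dominated_loc_of_deriv_le (𝕜 := ℂ)
    (F := fun l (y : ℝ) => Complex.exp (-Complex.I * y * l) * f y)
    (F' := fun l (y : ℝ) => Complex.exp (-Complex.I * y * l) * momentFun f y)
    (bound := fun y => ‖momentFun f y‖) (s := {l | l.im < 0})
    ((isOpen_lt Complex.continuous_im continuous_const).mem_nhds hl)
    (Eventually.of_forall (aestronglyMeasurable_exp_neg_I_mul_mul hf.aestronglyMeasurable))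
    (integrableOn_exp_neg_I_mul_mul hf hl.le)
    (aestronglyMeasurable_exp_neg_I_mul_mul hm.aestronglyMeasurable l)
    ?_ hm.norm (Eventually.of_forall fun y l _ => ?_)).2.differentiableAt
  · exact ae_restrict_of_forall_mem measurableSet_Ioi fun y hy l hl =>
      norm_exp_neg_I_mul_mul_le (le_of_lt hy) (le_of_lt hl) _
  · have hlin : HasDerivAt (fun l : ℂ => -Complex.I * y * l) (-Complex.I * y) l := by
      simpa using (hasDerivAt_id l).const_mul (-Complex.I * y)
    refine (hlin.cexp.mul_const (f y)).congr_deriv ?_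
    rw [momentFun]
    ring

theorem hasDerivAt_halfLineFT_line (hf : IntegrableOn f (Ioi 0))
    (hm : IntegrableOn (momentFun f) (Ioi 0)) {d : ℂ} {U : Set ℝ} {s : ℝ}
    (hU : U ∈ 𝓝 s) (him : ∀ r ∈ U, (a + r * d).im ≤ 0) :
    HasDerivAt (fun r : ℝ => halfLineFT f (a + r * d))
      (d * halfLineFT (momentFun f) (a + s * d)) s := by
  rw [halfLineFT, ← integral_const_mul]
  refine (hasDerivAt_integral_of_dominated_loc_of_deriv_le (𝕜 := ℝ)
    (F := fun (r : ℝ) (y : ℝ) => Complex.exp (-Complex.I * y * (a + r * d)) * f y)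
    (F' := fun (r : ℝ) (y : ℝ) => d * (Complex.exp (-Complex.I * y * (a + r * d)) * momentFun f y))
    (bound := fun y => ‖d‖ * ‖momentFun f y‖) hU
    (Eventually.of_forall fun r =>
      aestronglyMeasurable_exp_neg_I_mul_mul hf.aestronglyMeasurable (a + r * d))
    (integrableOn_exp_neg_I_mul_mul hf (him s (mem_of_mem_nhds hU)))
    ((aestronglyMeasurable_exp_neg_I_mul_mul hm.aestronglyMeasurable (a + s * d)).const_mul d)
    ?_ (hm.norm.const_mul _) (Eventually.of_forall fun y r _ => ?_)).2
  · refine ae_restrict_of_forall_mem measurableSet_Ioi fun y hy r hr => ?_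
    rw [norm_mul]
    exact mul_le_mul_of_nonneg_left
      (norm_exp_neg_I_mul_mul_le (le_of_lt hy) (him r hr) _) (norm_nonneg _)
  · have hlin : HasDerivAt (fun r : ℝ => -Complex.I * y * (a + r * d)) (-Complex.I * y * d) r := by
      simpa using (((Complex.ofRealCLM.hasDerivAt (x := r)).mul_const d).const_add a).const_mul
        (-Complex.I * y)
    refine (hlin.cexp.mul_const (f y)).congr_deriv ?_
    rw [momentFun]
    ring

theorem halfLineFT_deriv (hc : ContinuousOn f (Ici 0))
    (hd : ∀ y, 0 < y → HasDerivAt f (f' y) y) (hf : IntegrableOn f (Ioi 0))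
    (hf' : IntegrableOn f' (Ioi 0)) (hl : l.im ≤ 0) :
    halfLineFT f' l = -f 0 + Complex.I * l * halfLineFT f l := by
  have hzero : Tendsto (fun y : ℝ => Complex.exp (-Complex.I * y * l) * f y) (𝓝[>] 0)
      (𝓝 (f 0)) := by
    have hcont := (Continuous.continuousWithinAt (x := (0 : ℝ)) (s := Ioi 0)
      (f := fun y : ℝ => Complex.exp (-Complex.I * y * l)) (by fun_prop)).mul
        ((hc 0 self_mem_Ici).mono Ioi_subset_Ici_self)
    simpa [Function.comp_def, Pi.mul_def] using hcont.tendsto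
  have hinfty : Tendsto (fun y : ℝ => Complex.exp (-Complex.I * y * l) * f y) atTop (𝓝 0) := by
    refine squeeze_zero_norm' ((eventually_ge_atTop 0).mono fun y hy =>
      norm_exp_neg_I_mul_mul_le hy hl _) (tendsto_zero_iff_norm_tendsto_zero.1 ?_)
    exact tendsto_zero_of_hasDerivAt_of_integrableOn_Ioi (a := 0) (fun y hy => hd y hy) hf' hf
  have hparts := integral_Ioi_mul_deriv_eq_deriv_mul
    (fun y _ => hasDerivAt_exp_neg_I_mul_mul l y) (fun y hy => hd y hy)
    (integrableOn_exp_neg_I_mul_mul hf' hl)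
    (((integrableOn_exp_neg_I_mul_mul hf hl).const_mul (-Complex.I * l)).congr
      (Eventually.of_forall fun y => by simp only [Pi.mul_apply]; ring)) hzero hinfty
  simp only [mul_assoc, integral_const_mul] at hparts
  simp only [halfLineFT, mul_assoc, hparts]
  ring

theorem norm_mul_norm_halfLineFT_le (hc : ContinuousOn f (Ici 0))
    (hd : ∀ y, 0 < y → HasDerivAt f (f' y) y) (hf : IntegrableOn f (Ioi 0))
    (hf' : IntegrableOn f' (Ioi 0)) (hl : l.im ≤ 0) :
    ‖l‖ * ‖halfLineFT f l‖ ≤ ‖f 0‖ + ∫ y in Ioi (0 : ℝ), ‖f' y‖ := by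
  have heq : Complex.I * l * halfLineFT f l = f 0 + halfLineFT f' l := by
    rw [halfLineFT_deriv hc hd hf hf' hl]
    ring
  calc ‖l‖ * ‖halfLineFT f l‖ = ‖f 0 + halfLineFT f' l‖ := by simp [← heq]
    _ ≤ ‖f 0‖ + ∫ y in Ioi (0 : ℝ), ‖f' y‖ :=
      (norm_add_le _ _).trans (by gcongr; exact norm_halfLineFT_le hf' hl)

theorem exists_norm_halfLineFT_le (hc : ContinuousOn f (Ici 0))
    (hd : ∀ y, 0 < y → HasDerivAt f (f' y) y) (hf : IntegrableOn f (Ioi 0))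
    (hf' : IntegrableOn f' (Ioi 0)) :
    ∃ C, 0 ≤ C ∧ ∀ l : ℂ, l.im ≤ 0 → ‖halfLineFT f l‖ ≤ C / (1 + ‖l‖) := by
  refine ⟨(∫ y in Ioi (0 : ℝ), ‖f y‖) + (‖f 0‖ + ∫ y in Ioi (0 : ℝ), ‖f' y‖), by positivity,
    fun l hl => ?_⟩
  rw [le_div_iff₀ (by positivity)]
  linarith [norm_halfLineFT_le hf hl, norm_mul_norm_halfLineFT_le hc hd hf hf' hl]

theorem mul_ftSlope (hf : IntegrableOn f (Ioi 0)) (hm : IntegrableOn (momentFun f) (Ioi 0))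
    (ha : a.im ≤ 0) (hb : b.im ≤ 0) :
    (b - a) * ftSlope f (a, b) = halfLineFT f b - halfLineFT f a := by
  have hcont : ∀ {g : ℝ → ℂ}, IntegrableOn g (Ioi 0) →
      ContinuousOn (fun s : ℝ => halfLineFT g (a + s * (b - a))) (Icc 0 1) := fun hg =>
    (continuousOn_halfLineFT hg).comp (by fun_prop) fun s hs => im_segment_nonpos ha hb hs
  have hftc := intervalIntegral.integral_eq_sub_of_hasDerivAt_of_le zero_le_one (hcont hf)
    (fun s hs => hasDerivAt_halfLineFT_line hf hm (Icc_mem_nhds hs.1 hs.2)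
      fun r hr => im_segment_nonpos ha hb hr)
    ((continuousOn_const.mul (hcont hm)).intervalIntegrable_of_Icc zero_le_one)
  rw [intervalIntegral.integral_const_mul] at hftc
  simpa [ftSlope] using hftc

theorem continuousOn_ftSlope (hm : IntegrableOn (momentFun f) (Ioi 0)) :
    ContinuousOn (ftSlope f) {p | p.1.im ≤ 0 ∧ p.2.im ≤ 0} := by
  have hcont := continuousOn_halfLineFT hm
  simp only [funext fun p => ftSlope.eq_1 f p, intervalIntegral.integral_of_le zero_le_one]
  refine continuousOn_of_dominated (bound := fun _ => ∫ y in Ioi (0 : ℝ), ‖momentFun f y‖)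
    (fun p hp => ContinuousOn.aestronglyMeasurable ?_ measurableSet_Ioc)
    (fun p hp => ae_restrict_of_forall_mem measurableSet_Ioc fun s hs => ?_)
    (integrable_const _) (ae_restrict_of_forall_mem measurableSet_Ioc fun s hs => ?_)
  · exact hcont.comp (by fun_prop) fun s hs =>
      im_segment_nonpos hp.1 hp.2 (Ioc_subset_Icc_self hs)
  · exact norm_halfLineFT_le hm (im_segment_nonpos hp.1 hp.2 (Ioc_subset_Icc_self hs))
  · exact hcont.comp (by fun_prop) fun p hp =>
      im_segment_nonpos hp.1 hp.2 (Ioc_subset_Icc_self hs)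

theorem norm_ftSlope_le (hm : IntegrableOn (momentFun f) (Ioi 0)) (ha : a.im ≤ 0)
    (hb : b.im ≤ 0) : ‖ftSlope f (a, b)‖ ≤ ∫ y in Ioi (0 : ℝ), ‖momentFun f y‖ := by
  simpa [ftSlope] using intervalIntegral.norm_integral_le_of_norm_le_const (a := 0) (b := 1)
    (f := fun s : ℝ => halfLineFT (momentFun f) (a + s * (b - a))) fun s hs =>
      norm_halfLineFT_le hm
        (im_segment_nonpos ha hb (Ioc_subset_Icc_self (uIoc_of_le (zero_le_one' ℝ) ▸ hs)))

end HalfLine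

section RootBranch

variable {κ : ℝ} {S : Set ℂ} {ν : ℂ → ℂ} {f f' : ℝ → ℂ} {l : ℂ}

theorem IsRootBranch.re_mul_im (hν : IsRootBranch κ S ν) (hl : l ∈ S) :
    (ν l).re * (ν l).im = -(l.re * l.im) := by
  have him := congrArg Complex.im (hν.sq_eq l hl)
  simp only [pow_two, Complex.mul_im, Complex.sub_im, Complex.neg_im, Complex.ofReal_im,
    Complex.ofReal_re, Complex.re_ofNat, Complex.im_ofNat, mul_zero, zero_mul, add_zero] at him
  linarith

theorem IsRootBranch.im_pos (hν : IsRootBranch κ S ν) (hl : l ∈ S) (hre : l.re ≠ 0)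
    (him : 0 < l.im) : 0 < (ν l).im := by
  refine (hν.im_nonneg l hl).lt_of_ne fun h => mul_ne_zero hre him.ne' ?_
  simpa [← h] using (hν.re_mul_im hl).symm

theorem IsRootBranch.ne_self (hν : IsRootBranch κ S ν) (hl : l ∈ S) (hre : l.re ≠ 0)
    (him : 0 < l.im) : ν l ≠ l := by
  intro h
  refine mul_ne_zero hre him.ne' ?_
  have := hν.re_mul_im hl
  rw [h] at this
  linarith

theorem IsRootBranch.norm_le_two_mul (hν : IsRootBranch κ S ν) (hl : l ∈ S)
    (hlarge : 4 * κ ^ 2 + 1 ≤ ‖l‖ ^ 2) : ‖ν l‖ ≤ 2 * ‖l‖ ∧ ‖l‖ ≤ 2 * ‖ν l‖ := by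
  have hκ : ‖2 * (κ : ℂ) ^ 2‖ = 2 * κ ^ 2 := by simp
  have hsq : ‖ν l‖ ^ 2 = ‖l ^ 2 + 2 * (κ : ℂ) ^ 2‖ := by
    rw [← norm_pow, hν.sq_eq l hl, ← norm_neg]
    congr 1
    ring
  have hle : ‖ν l‖ ^ 2 ≤ ‖l‖ ^ 2 + 2 * κ ^ 2 := by
    rw [hsq, ← hκ, ← norm_pow]
    exact norm_add_le _ _
  have hge : ‖l‖ ^ 2 - 2 * κ ^ 2 ≤ ‖ν l‖ ^ 2 := by
    rw [hsq, ← hκ, ← norm_pow]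
    exact norm_sub_le_norm_add _ _
  exact ⟨abs_le_of_sq_le_sq' (by nlinarith) (by positivity) |>.2,
    abs_le_of_sq_le_sq' (by nlinarith) (by positivity) |>.2⟩

theorem IsRootBranch.two_mul_sq_add_sq_mul_ftSlope (hν : IsRootBranch κ S ν)
    (hS : S ⊆ {l | 0 ≤ l.im}) (hf : IntegrableOn f (Ioi 0))
    (hm : IntegrableOn (momentFun f) (Ioi 0)) (hl : l ∈ S) :
    2 * (l ^ 2 + (κ : ℂ) ^ 2) * ftSlope f (-l, -ν l) =
      (l + ν l) * (halfLineFT f (-ν l) - halfLineFT f (-l)) := by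
  rw [← mul_ftSlope hf hm (by simpa using hS hl) (by simpa using hν.im_nonneg l hl)]
  linear_combination ftSlope f (-l, -ν l) * hν.sq_eq l hl

theorem IsRootBranch.norm_mul_norm_ftSlope_le (hν : IsRootBranch κ S ν)
    (hS : S ⊆ {l | 0 ≤ l.im}) (hf : IntegrableOn f (Ioi 0))
    (hm : IntegrableOn (momentFun f) (Ioi 0)) {C : ℝ}
    (hC : ∀ l : ℂ, l.im ≤ 0 → ‖halfLineFT f l‖ ≤ C / (1 + ‖l‖)) (hl : l ∈ S)
    (hlarge : 4 * κ ^ 2 + 1 ≤ ‖l‖ ^ 2) :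
    ‖l‖ * ‖ftSlope f (-l, -ν l)‖ ≤ 9 * C / (1 + ‖l‖) := by
  obtain ⟨hle, hge⟩ := hν.norm_le_two_mul hl hlarge
  have hC0 : 0 ≤ C := by simpa using (norm_nonneg _).trans (hC 0 (by simp))
  have hpos : 0 < ‖l‖ := (norm_nonneg l).lt_of_ne fun h => by
    rw [← h] at hlarge
    nlinarith
  have hl_le : ‖halfLineFT f (-l)‖ ≤ C / (1 + ‖l‖) := by
    simpa using hC (-l) (by simpa using hS hl)
  have hν_le : ‖halfLineFT f (-ν l)‖ ≤ 2 * C / (1 + ‖l‖) := by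
    refine (hC (-ν l) (by simpa using hν.im_nonneg l hl)).trans ?_
    rw [norm_neg, div_le_div_iff₀ (by positivity) (by positivity)]
    nlinarith
  have hlow : ‖l‖ ^ 2 ≤ ‖2 * (l ^ 2 + (κ : ℂ) ^ 2)‖ := by
    have := norm_sub_le_norm_add (l ^ 2) ((κ : ℂ) ^ 2)
    simp only [norm_pow, Complex.norm_real, Real.norm_eq_abs, sq_abs] at this
    rw [norm_mul, Complex.norm_ofNat]
    linarith [sq_nonneg κ]
  refine le_of_mul_le_mul_left ?_ hpos
  calc ‖l‖ * (‖l‖ * ‖ftSlope f (-l, -ν l)‖)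
      = ‖l‖ ^ 2 * ‖ftSlope f (-l, -ν l)‖ := by ring
    _ ≤ ‖2 * (l ^ 2 + (κ : ℂ) ^ 2)‖ * ‖ftSlope f (-l, -ν l)‖ := by gcongr
    _ = ‖l + ν l‖ * ‖halfLineFT f (-ν l) - halfLineFT f (-l)‖ := by
      rw [← norm_mul, hν.two_mul_sq_add_sq_mul_ftSlope hS hf hm hl, norm_mul]
    _ ≤ (3 * ‖l‖) * (2 * C / (1 + ‖l‖) + C / (1 + ‖l‖)) := by
      gcongr
      · exact (norm_add_le _ _).trans (by linarith)
      · exact (norm_sub_le _ _).trans (add_le_add hν_le hl_le)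
    _ = ‖l‖ * (9 * C / (1 + ‖l‖)) := by ring

theorem IsRootBranch.exists_norm_mul_norm_ftSlope_le (hν : IsRootBranch κ S ν)
    (hS : S ⊆ {l | 0 ≤ l.im}) (hf : IntegrableOn f (Ioi 0))
    (hm : IntegrableOn (momentFun f) (Ioi 0)) {C : ℝ}
    (hC : ∀ l : ℂ, l.im ≤ 0 → ‖halfLineFT f l‖ ≤ C / (1 + ‖l‖)) :
    ∃ C', 0 ≤ C' ∧ ∀ l ∈ S, ‖l‖ * ‖ftSlope f (-l, -ν l)‖ ≤ C' / (1 + ‖l‖) := by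
  set M := ∫ y in Ioi (0 : ℝ), ‖momentFun f y‖
  set ρ : ℝ := 4 * κ ^ 2 + 1
  have hC0 : 0 ≤ C := by simpa using (norm_nonneg _).trans (hC 0 (by simp))
  have : 0 ≤ M := by positivity
  have hρ : 1 ≤ ρ := le_add_of_nonneg_left (by positivity)
  refine ⟨9 * C + ρ * M * (1 + ρ), by positivity, fun l hl => ?_⟩
  rcases le_or_gt ρ (‖l‖ ^ 2) with hlarge | hsmall
  · refine (hν.norm_mul_norm_ftSlope_le hS hf hm hC hl hlarge).trans ?_
    gcongr
    exact le_add_of_nonneg_right (by positivity)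
  · have hle : ‖l‖ ≤ ρ := by nlinarith
    have hslope : ‖ftSlope f (-l, -ν l)‖ ≤ M :=
      norm_ftSlope_le hm (by simpa using hS hl) (by simpa using hν.im_nonneg l hl)
    rw [le_div_iff₀ (by positivity)]
    calc ‖l‖ * ‖ftSlope f (-l, -ν l)‖ * (1 + ‖l‖) ≤ ρ * M * (1 + ρ) := by gcongr
      _ ≤ 9 * C + ρ * M * (1 + ρ) := le_add_of_nonneg_left (by positivity)

theorem IsRootBranch.differentiableAt_ftSlope (hν : IsRootBranch κ S ν)
    (hf : IntegrableOn f (Ioi 0)) (hm : IntegrableOn (momentFun f) (Ioi 0)) (hl : l ∈ S)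
    (hre : l.re ≠ 0) (him : 0 < l.im) :
    DifferentiableAt ℂ (fun l => ftSlope f (-l, -ν l)) l := by
  have hνl := hν.ne_self hl hre him
  have hνd := hν.differentiableAt l hl hre him
  have hνim := hν.im_pos hl hre him
  have hquot : (fun l => ftSlope f (-l, -ν l)) =ᶠ[𝓝 l]
      fun l => (halfLineFT f (-ν l) - halfLineFT f (-l)) / (-ν l - -l) := by
    filter_upwards [Complex.continuous_im.continuousAt.eventually (lt_mem_nhds him),
      (Complex.continuous_im.continuousAt.comp hνd.continuousAt).eventually (lt_mem_nhds hνim),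
      (hνd.continuousAt.ne_iff_eventually_ne continuousAt_id).1 hνl] with z hz hνz hne
    have hne' : -ν z ≠ -z := fun h => hne (neg_injective h)
    rw [eq_div_iff (sub_ne_zero.2 hne'), mul_comm,
      mul_ftSlope hf hm (by simpa using hz.le) (by simpa using le_of_lt hνz)]
  refine DifferentiableAt.congr_of_eventuallyEq ?_ hquot
  have hl_diff : DifferentiableAt ℂ (fun l => halfLineFT f (-l)) l :=
    DifferentiableAt.fun_comp' l (g := halfLineFT f)
      (differentiableAt_halfLineFT hf hm (by simpa using him)) differentiableAt_id.neg
  have hν_diff : DifferentiableAt ℂ (fun l => halfLineFT f (-ν l)) l :=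
    DifferentiableAt.fun_comp' l (g := halfLineFT f)
      (differentiableAt_halfLineFT hf hm (by simpa using hνim)) hνd.neg
  exact (hν_diff.sub hl_diff).div (hνd.neg.sub differentiableAt_id.neg)
    (sub_ne_zero.2 fun h => hνl (neg_injective h))

theorem IsRootBranch.isDecaying_halfLineFT (hν : IsRootBranch κ S ν) (y : ℝ)
    (hS : S ⊆ {l | 0 ≤ l.im}) (hc : ContinuousOn f (Ici 0))
    (hd : ∀ y, 0 < y → HasDerivAt f (f' y) y) (hf : IntegrableOn f (Ioi 0))
    (hf' : IntegrableOn f' (Ioi 0)) (hm : IntegrableOn (momentFun f) (Ioi 0)) (c : ℂ) :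
    IsDecaying y S (fun l => c * Complex.exp (Complex.I * l * y) *
      (halfLineFT f (-l) + 2 * l * ftSlope f (-l, -ν l))) where
  continuousOn := by
    have hFT : ContinuousOn (fun l => halfLineFT f (-l)) S :=
      (continuousOn_halfLineFT hf).comp continuousOn_neg fun l hl => by simpa using hS hl
    have hslope : ContinuousOn (fun l => ftSlope f (-l, -ν l)) S :=
      (continuousOn_ftSlope hm).comp (continuousOn_neg.prodMk hν.continuousOn.neg) fun l hl => by
        simpa using ⟨hS hl, hν.im_nonneg l hl⟩
    exact (Continuous.continuousOn (by fun_prop)).mul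
      (hFT.add ((Continuous.continuousOn (by fun_prop)).mul hslope))
  exists_norm_le := by
    obtain ⟨C, hC0, hC⟩ := exists_norm_halfLineFT_le hc hd hf hf'
    obtain ⟨C', hC0', hC'⟩ := hν.exists_norm_mul_norm_ftSlope_le hS hf hm hC
    refine ⟨‖c‖ * (C + 2 * C'), by positivity, fun l hl => ?_⟩
    rw [norm_mul, norm_mul, norm_exp_I_mul]
    calc ‖c‖ * Real.exp (-y * l.im) * ‖halfLineFT f (-l) + 2 * l * ftSlope f (-l, -ν l)‖
        ≤ ‖c‖ * Real.exp (-y * l.im) * (C / (1 + ‖l‖) + 2 * (C' / (1 + ‖l‖))) := by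
          gcongr
          refine (norm_add_le _ _).trans (add_le_add ?_ ?_)
          · simpa using hC (-l) (by simpa using hS hl)
          · rw [norm_mul, norm_mul, Complex.norm_ofNat, mul_assoc]
            exact mul_le_mul_of_nonneg_left (hC' l hl) zero_le_two
      _ = ‖c‖ * (C + 2 * C') * Real.exp (-y * l.im) / (1 + ‖l‖) := by ring
  differentiableAt l hl hre him := by
    have hFT : DifferentiableAt ℂ (fun l => halfLineFT f (-l)) l :=
      DifferentiableAt.fun_comp' l (g := halfLineFT f)
        (differentiableAt_halfLineFT hf hm (by simpa using him)) differentiableAt_id.neg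
    exact DifferentiableAt.mul (by fun_prop)
      (hFT.add (DifferentiableAt.mul (by fun_prop) (hν.differentiableAt_ftSlope hf hm hl hre him)))

end RootBranch

/-! ### Time transforms of boundary data -/

/-- The transform `∫₀ᵗ exp(η τ) b(τ) dτ` of a boundary datum that has already been transformed in
`x`, so that `tTransform g κ = timeFT (xFT g κ)`. -/
def timeFT (b : ℝ → ℂ) (η : ℂ) (t : ℝ) : ℂ :=
  ∫ τ in (0 : ℝ)..t, Complex.exp (η * τ) * b τ

/-- `b` is continuously differentiable on `[0, t]` with derivative `b'`; the derivative is two-sided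
and asserted in the interior only. -/
structure IsC1Data (t : ℝ) (b b' : ℝ → ℂ) : Prop where
  continuousOn : ContinuousOn b (Icc 0 t)
  continuousOn_deriv : ContinuousOn b' (Icc 0 t)
  hasDerivAt : ∀ τ ∈ Ioo 0 t, HasDerivAt b (b' τ) τ

/-- The exponent `η = -i(κ² + l²)²` of the time transforms. -/
def timeExponent (κ : ℝ) (l : ℂ) : ℂ := -Complex.I * ((κ : ℂ) ^ 2 + l ^ 2) ^ 2

/-- The combination of the transforms of `∂ᵧʲu(·, 0, ·)`, `j ≤ 3`, in the global relation. -/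
def boundaryTerm (b₀ b₁ b₂ b₃ : ℝ → ℂ) (κ : ℝ) (l : ℂ) (t : ℝ) : ℂ :=
  -Complex.I * timeFT b₃ (timeExponent κ l) t + l * timeFT b₂ (timeExponent κ l) t
    + Complex.I * (l ^ 2 + 2 * (κ : ℂ) ^ 2) * timeFT b₁ (timeExponent κ l) t
    - l * (l ^ 2 + 2 * (κ : ℂ) ^ 2) * timeFT b₀ (timeExponent κ l) t

theorem continuousOn_exp_mul {b : ℝ → ℂ} {s : Set ℝ} (hb : ContinuousOn b s) (η : ℂ) :
    ContinuousOn (fun τ : ℝ => Complex.exp (η * τ) * b τ) s :=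
  (Continuous.continuousOn (by fun_prop)).mul hb

theorem boundaryTerm_eq_integral {t : ℝ} (ht : 0 ≤ t) {b₀ b₁ b₂ b₃ : ℝ → ℂ}
    (h₀ : ContinuousOn b₀ (Icc 0 t)) (h₁ : ContinuousOn b₁ (Icc 0 t))
    (h₂ : ContinuousOn b₂ (Icc 0 t)) (h₃ : ContinuousOn b₃ (Icc 0 t)) (κ : ℝ) (l : ℂ) :
    boundaryTerm b₀ b₁ b₂ b₃ κ l t = ∫ τ in (0 : ℝ)..t, Complex.exp (timeExponent κ l * τ) *
      (-Complex.I * b₃ τ + l * b₂ τ + Complex.I * (l ^ 2 + 2 * (κ : ℂ) ^ 2) * b₁ τ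
        - l * (l ^ 2 + 2 * (κ : ℂ) ^ 2) * b₀ τ) := by
  have hint : ∀ {b : ℝ → ℂ}, ContinuousOn b (Icc 0 t) → ∀ c : ℂ, IntervalIntegrable
      (fun τ : ℝ => c * (Complex.exp (timeExponent κ l * τ) * b τ)) volume 0 t := fun hb c =>
    ((continuousOn_exp_mul hb _).intervalIntegrable_of_Icc ht).const_mul c
  simp only [boundaryTerm, timeFT, ← intervalIntegral.integral_const_mul]
  rw [← intervalIntegral.integral_add (hint h₃ _) (hint h₂ _),
    ← intervalIntegral.integral_add ((hint h₃ _).add (hint h₂ _)) (hint h₁ _),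
    ← intervalIntegral.integral_sub (((hint h₃ _).add (hint h₂ _)).add (hint h₁ _)) (hint h₀ _)]
  congr 1 with τ
  ring

section TimeTransform

variable {t : ℝ} {b b' : ℝ → ℂ} {η : ℂ}

theorem norm_exp_neg_mul_timeFT_le (ht : 0 ≤ t) {B : ℝ} (hB : ∀ τ ∈ Icc 0 t, ‖b τ‖ ≤ B)
    (hη : 0 ≤ η.re) : ‖Complex.exp (-η * t) * timeFT b η t‖ ≤ B * t := by
  rw [timeFT, ← intervalIntegral.integral_const_mul]
  refine (intervalIntegral.norm_integral_le_of_norm_le_const (C := B) fun τ hτ => ?_).trans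
    (by rw [sub_zero, abs_of_nonneg ht])
  rw [uIoc_of_le ht] at hτ
  have hre : (-η * t + η * τ).re ≤ 0 := by
    simp only [neg_mul, Complex.add_re, Complex.neg_re, Complex.re_mul_ofReal]
    nlinarith [hτ.2]
  rw [← mul_assoc, ← Complex.exp_add, norm_mul, Complex.norm_exp]
  exact (mul_le_of_le_one_left (norm_nonneg _) (Real.exp_le_one_iff.2 hre)).trans
    (hB τ (Ioc_subset_Icc_self hτ))

theorem IsC1Data.mul_timeFT (hb : IsC1Data t b b') (ht : 0 ≤ t) (η : ℂ) :
    η * timeFT b η t = Complex.exp (η * t) * b t - b 0 - timeFT b' η t := by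
  have hint := (continuousOn_exp_mul hb.continuousOn η).intervalIntegrable_of_Icc (μ := volume) ht
  have hint' := (continuousOn_exp_mul hb.continuousOn_deriv η).intervalIntegrable_of_Icc
    (μ := volume) ht
  have hftc := intervalIntegral.integral_eq_sub_of_hasDerivAt_of_le ht
    (f' := fun τ : ℝ => η * (Complex.exp (η * τ) * b τ) + Complex.exp (η * τ) * b' τ)
    (continuousOn_exp_mul hb.continuousOn η)
    (fun τ hτ => ((hasDerivAt_exp_mul_ofReal η τ).mul (hb.hasDerivAt τ hτ)).congr_deriv (by ring))
    ((hint.const_mul η).add hint')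
  rw [intervalIntegral.integral_add (hint.const_mul η) hint',
    intervalIntegral.integral_const_mul] at hftc
  simp only [Complex.ofReal_zero, mul_zero, Complex.exp_zero, one_mul] at hftc
  rw [timeFT, timeFT]
  linear_combination hftc

theorem IsC1Data.exists_norm_timeFT_le (hb : IsC1Data t b b') (ht : 0 ≤ t) :
    ∃ C, 0 ≤ C ∧ ∀ η : ℂ, 0 ≤ η.re →
      ‖Complex.exp (-η * t) * timeFT b η t‖ ≤ C / (1 + ‖η‖) := by
  obtain ⟨B, hB⟩ := isCompact_Icc.exists_bound_of_continuousOn hb.continuousOn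
  obtain ⟨B', hB'⟩ := isCompact_Icc.exists_bound_of_continuousOn hb.continuousOn_deriv
  have hB0 : 0 ≤ B := (norm_nonneg _).trans (hB 0 (left_mem_Icc.2 ht))
  have hB0' : 0 ≤ B' := (norm_nonneg _).trans (hB' 0 (left_mem_Icc.2 ht))
  refine ⟨B * t + (B + B + B' * t), by positivity, fun η hη => ?_⟩
  have hparts : Complex.exp (-η * t) * timeFT b η t * η =
      b t - Complex.exp (-η * t) * b 0 - Complex.exp (-η * t) * timeFT b' η t := by
    rw [mul_assoc, mul_comm (timeFT b η t), hb.mul_timeFT ht, mul_sub, mul_sub, ← mul_assoc,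
      ← Complex.exp_add]
    simp
  have hzero : ‖Complex.exp (-η * t) * b 0‖ ≤ B := by
    rw [norm_mul, Complex.norm_exp]
    refine (mul_le_of_le_one_left (norm_nonneg _) (Real.exp_le_one_iff.2 ?_)).trans
      (hB 0 (left_mem_Icc.2 ht))
    simpa using mul_nonneg hη ht
  rw [le_div_iff₀ (by positivity), mul_add, mul_one, ← norm_mul, hparts]
  refine add_le_add (norm_exp_neg_mul_timeFT_le ht hB hη) ((norm_sub_le _ _).trans ?_)
  exact add_le_add ((norm_sub_le _ _).trans (add_le_add (hB t (right_mem_Icc.2 ht)) hzero))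
    (norm_exp_neg_mul_timeFT_le ht hB' hη)

theorem differentiable_timeFT (ht : 0 ≤ t) (hb : ContinuousOn b (Icc 0 t)) :
    Differentiable ℂ (fun η => timeFT b η t) := by
  intro η
  have hmeas : ∀ z, AEStronglyMeasurable (fun τ : ℝ => Complex.exp (z * τ) * b τ)
      (volume.restrict (uIoc 0 t)) := fun z =>
    ((continuousOn_exp_mul hb z).intervalIntegrable_of_Icc
      (μ := volume) ht).def'.aestronglyMeasurable
  have hcont : ContinuousOn (fun p : ℂ × ℝ => p.2 * (Complex.exp (p.1 * p.2) * b p.2))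
      (Metric.closedBall η 1 ×ˢ Icc 0 t) :=
    (Continuous.continuousOn (by fun_prop)).mul
      ((Continuous.continuousOn (by fun_prop)).mul
        (hb.comp continuousOn_snd fun p hp => hp.2))
  obtain ⟨B, hB⟩ :=
    ((isCompact_closedBall η 1).prod isCompact_Icc).exists_bound_of_continuousOn hcont
  refine (intervalIntegral.hasDerivAt_integral_of_dominated_loc_of_deriv_le (𝕜 := ℂ)
    (F' := fun z (τ : ℝ) => τ * (Complex.exp (z * τ) * b τ)) (bound := fun _ => B)
    (Metric.ball_mem_nhds η one_pos) (Eventually.of_forall hmeas)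
    ((continuousOn_exp_mul hb η).intervalIntegrable_of_Icc ht)
    ((Continuous.aestronglyMeasurable (by fun_prop)).mul (hmeas η))
    (Eventually.of_forall fun τ hτ z hz => ?_) intervalIntegrable_const
    (Eventually.of_forall fun τ _ z _ => ?_)).2.differentiableAt
  · rw [uIoc_of_le ht] at hτ
    exact hB (z, τ) ⟨Metric.ball_subset_closedBall hz, Ioc_subset_Icc_self hτ⟩
  · have hlin : HasDerivAt (fun z : ℂ => z * (τ : ℂ)) τ z := by
      simpa using (hasDerivAt_id z).mul_const (τ : ℂ)
    exact (hlin.cexp.mul_const (b τ)).congr_deriv (by ring)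

end TimeTransform

section Exponent

variable (κ : ℝ) (l : ℂ)

theorem re_timeExponent_nonneg {κ : ℝ} {l : ℂ} (hl : l ∈ boundedRegion κ) :
    0 ≤ (timeExponent κ l).re := by
  have hre : (timeExponent κ l).re = 4 * l.im * (l.re * (κ ^ 2 + l.re ^ 2 - l.im ^ 2)) := by
    simp [timeExponent, pow_two]
    ring
  rw [hre]
  exact mul_nonneg (mul_nonneg zero_le_four hl.1) hl.2

theorem differentiable_timeExponent : Differentiable ℂ (timeExponent κ) := by
  unfold timeExponent
  fun_prop

theorem E_eq_mul_exp_timeExponent (x y t : ℝ) :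
    E κ l x y t = Complex.exp (Complex.I * κ * x) * Complex.exp (Complex.I * l * y) *
      Complex.exp (-timeExponent κ l * t) := by
  rw [E, ← Complex.exp_add, ← Complex.exp_add, timeExponent]
  congr 1
  ring

theorem one_add_norm_pow_four_le :
    (1 + ‖l‖) ^ 4 ≤ 2 * (2 + 2 * κ ^ 2) ^ 2 * (1 + ‖timeExponent κ l‖) := by
  set q := ‖(κ : ℂ) ^ 2 + l ^ 2‖ with hq
  have hη : ‖timeExponent κ l‖ = q ^ 2 := by
    rw [timeExponent, norm_mul, norm_neg, Complex.norm_I, one_mul, norm_pow]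
  have hl_sq : ‖l‖ ^ 2 ≤ q + κ ^ 2 := by
    have := norm_sub_le_norm_add (l ^ 2) ((κ : ℂ) ^ 2)
    rw [add_comm (l ^ 2), ← hq] at this
    simp only [norm_pow, Complex.norm_real, Real.norm_eq_abs, sq_abs] at this
    linarith
  have hone_add : (1 + ‖l‖) ^ 2 ≤ (2 + 2 * κ ^ 2) * (1 + q) := by
    nlinarith [sq_nonneg (1 - ‖l‖), mul_nonneg (sq_nonneg κ) (norm_nonneg ((κ : ℂ) ^ 2 + l ^ 2))]
  rw [hη]
  calc (1 + ‖l‖) ^ 4 = ((1 + ‖l‖) ^ 2) ^ 2 := by ring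
    _ ≤ ((2 + 2 * κ ^ 2) * (1 + q)) ^ 2 := by gcongr
    _ = (2 + 2 * κ ^ 2) ^ 2 * (1 + q) ^ 2 := by ring
    _ ≤ (2 + 2 * κ ^ 2) ^ 2 * (2 * (1 + q ^ 2)) := by
      gcongr
      nlinarith [sq_nonneg (1 - q)]
    _ = 2 * (2 + 2 * κ ^ 2) ^ 2 * (1 + q ^ 2) := by ring

theorem norm_sq_add_le : ‖l ^ 2 + 2 * (κ : ℂ) ^ 2‖ ≤ (1 + 2 * κ ^ 2) * (1 + ‖l‖) ^ 2 := by
  have h := norm_add_le (l ^ 2) (2 * (κ : ℂ) ^ 2)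
  simp only [norm_mul, norm_pow, Complex.norm_real, Real.norm_eq_abs, sq_abs,
    Complex.norm_ofNat] at h
  nlinarith [mul_nonneg (sq_nonneg κ) (norm_nonneg l), norm_nonneg l,
    mul_nonneg (sq_nonneg κ) (sq_nonneg ‖l‖)]

end Exponent

theorem IsDecaying.add {y : ℝ} {S : Set ℂ} {F₁ F₂ : ℂ → ℂ} (h₁ : IsDecaying y S F₁)
    (h₂ : IsDecaying y S F₂) : IsDecaying y S (fun l => F₁ l + F₂ l) where
  continuousOn := h₁.continuousOn.add h₂.continuousOn
  exists_norm_le := by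
    obtain ⟨C₁, hC₁, hF₁⟩ := h₁.exists_norm_le
    obtain ⟨C₂, hC₂, hF₂⟩ := h₂.exists_norm_le
    refine ⟨C₁ + C₂, add_nonneg hC₁ hC₂, fun l hl => ?_⟩
    rw [add_mul, add_div]
    exact (norm_add_le _ _).trans (add_le_add (hF₁ l hl) (hF₂ l hl))
  differentiableAt l hl hre him :=
    (h₁.differentiableAt l hl hre him).add (h₂.differentiableAt l hl hre him)

theorem IsC1Data.isDecaying_mul_timeFT {t : ℝ} {b b' : ℝ → ℂ} (hb : IsC1Data t b b')
    (ht : 0 ≤ t) (κ x y : ℝ) {p : ℂ → ℂ} (hp : Differentiable ℂ p) {K : ℝ}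
    (hK : ∀ l, ‖p l‖ ≤ K * (1 + ‖l‖) ^ 3) :
    IsDecaying y (boundedRegion κ)
      (fun l => E κ l x y t * (p l * timeFT b (timeExponent κ l) t)) := by
  have hdiff : Differentiable ℂ
      (fun l => E κ l x y t * (p l * timeFT b (timeExponent κ l) t)) := by
    have := (differentiable_timeFT ht hb.continuousOn).comp (differentiable_timeExponent κ)
    unfold E
    fun_prop
  obtain ⟨C, hC0, hC⟩ := hb.exists_norm_timeFT_le ht
  have hK0 : 0 ≤ K := by simpa using (norm_nonneg _).trans (hK 0)
  refine ⟨hdiff.continuous.continuousOn, ⟨K * C * (2 * (2 + 2 * κ ^ 2) ^ 2), by positivity,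
    fun l hl => ?_⟩, fun l _ _ _ => hdiff l⟩
  set η := timeExponent κ l with hη
  have hfrac : (1 + ‖l‖) ^ 3 / (1 + ‖η‖) ≤ 2 * (2 + 2 * κ ^ 2) ^ 2 / (1 + ‖l‖) := by
    rw [div_le_div_iff₀ (by positivity) (by positivity), ← pow_succ]
    exact one_add_norm_pow_four_le κ l
  calc ‖E κ l x y t * (p l * timeFT b η t)‖
      = Real.exp (-y * l.im) * (‖p l‖ * ‖Complex.exp (-η * t) * timeFT b η t‖) := by
        simp only [E_eq_mul_exp_timeExponent, ← hη, norm_mul, norm_exp_I_mul, Complex.ofReal_im,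
          mul_zero, Real.exp_zero]
        ring
    _ ≤ Real.exp (-y * l.im) * (K * (1 + ‖l‖) ^ 3 * (C / (1 + ‖η‖))) := by
        gcongr
        exacts [hK l, hC η (re_timeExponent_nonneg hl)]
    _ = K * C * Real.exp (-y * l.im) * ((1 + ‖l‖) ^ 3 / (1 + ‖η‖)) := by ring
    _ ≤ K * C * Real.exp (-y * l.im) * (2 * (2 + 2 * κ ^ 2) ^ 2 / (1 + ‖l‖)) := by gcongr
    _ = K * C * (2 * (2 + 2 * κ ^ 2) ^ 2) * Real.exp (-y * l.im) / (1 + ‖l‖) := by ring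

theorem isDecaying_boundaryTerm {t : ℝ} (ht : 0 ≤ t) {b₀ b₀' b₁ b₁' b₂ b₂' b₃ b₃' : ℝ → ℂ}
    (h₀ : IsC1Data t b₀ b₀') (h₁ : IsC1Data t b₁ b₁') (h₂ : IsC1Data t b₂ b₂')
    (h₃ : IsC1Data t b₃ b₃') (κ x y : ℝ) :
    IsDecaying y (boundedRegion κ) (fun l => E κ l x y t * boundaryTerm b₀ b₁ b₂ b₃ κ l t) := by
  have hpow : ∀ (l : ℂ) (n : ℕ), 1 ≤ (1 + ‖l‖) ^ n := fun l n =>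
    one_le_pow₀ (le_add_of_nonneg_right (norm_nonneg l))
  have hd₃ := h₃.isDecaying_mul_timeFT ht κ x y (differentiable_const (-Complex.I)) (K := 1)
    fun l => by simpa using hpow l 3
  have hd₂ := h₂.isDecaying_mul_timeFT ht κ x y differentiable_id (K := 1) fun l => by
    simp only [id, one_mul]
    nlinarith [norm_nonneg l, hpow l 2]
  have hd₁ := h₁.isDecaying_mul_timeFT ht κ x y (p := fun l => Complex.I * (l ^ 2 + 2 * κ ^ 2))
    (by fun_prop) (K := 1 + 2 * κ ^ 2) fun l => by
      rw [norm_mul, Complex.norm_I, one_mul]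
      refine (norm_sq_add_le κ l).trans (mul_le_mul_of_nonneg_left ?_ (by positivity))
      nlinarith [norm_nonneg l, hpow l 2]
  have hd₀ := h₀.isDecaying_mul_timeFT ht κ x y (p := fun l => -(l * (l ^ 2 + 2 * κ ^ 2)))
    (by fun_prop) (K := 1 + 2 * κ ^ 2) fun l => by
      rw [norm_neg, norm_mul, pow_succ' (1 + ‖l‖) 2, mul_left_comm]
      gcongr
      exacts [le_add_of_nonneg_left zero_le_one, norm_sq_add_le κ l]
  convert ((hd₃.add hd₂).add hd₁).add hd₀ using 2 with l
  simp only [boundaryTerm, id]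
  ring

/-! ### Oscillatory integrals on the real line -/

theorem integrableOn_Ioi_div_sq {a : ℝ} (ha : 0 < a) (D : ℝ) :
    IntegrableOn (fun s : ℝ => D / s ^ 2) (Ioi a) := by
  refine IntegrableOn.congr_fun
    ((integrableOn_Ioi_rpow_of_lt (by norm_num : (-2 : ℝ) < -1) ha).const_mul D)
    (fun s hs => ?_) measurableSet_Ioi
  rw [Real.rpow_neg (ha.trans hs).le, Real.rpow_ofNat, div_eq_mul_inv]

theorem integral_Ioi_div_sq {a : ℝ} (ha : 0 < a) (D : ℝ) :
    ∫ s in Ioi a, D / s ^ 2 = D / a := by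
  have hderiv : ∀ s ∈ Ici a, HasDerivAt (fun s : ℝ => -D / s) (D / s ^ 2) s := fun s hs =>
    ((hasDerivAt_inv (ha.trans_le hs).ne').const_mul (-D)).congr_deriv (by ring)
  rw [integral_Ioi_of_hasDerivAt_of_tendsto' hderiv (integrableOn_Ioi_div_sq ha D)
    (tendsto_const_nhds.div_atTop tendsto_id)]
  ring

theorem exists_tendsto_integral_of_hasDerivAt_add {E : Type*} [NormedAddCommGroup E]
    [NormedSpace ℝ E] [CompleteSpace E] {a C D : ℝ} (ha : 0 < a) {f r P : ℝ → E}
    (hP : ∀ s ∈ Ici a, HasDerivAt P (f s + r s) s) (hf : ContinuousOn f (Ici a))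
    (hr : ContinuousOn r (Ici a)) (hPC : ∀ s ∈ Ici a, ‖P s‖ ≤ C / s ^ 2)
    (hrD : ∀ s ∈ Ici a, ‖r s‖ ≤ D / s ^ 2) :
    ∃ I, Tendsto (fun R : ℝ => ∫ s in a..R, f s) atTop (𝓝 I) ∧ ‖I‖ ≤ C / a ^ 2 + D / a := by
  have hbound : ∀ᵐ s ∂volume.restrict (Ioi a), ‖r s‖ ≤ D / s ^ 2 :=
    (ae_restrict_mem measurableSet_Ioi).mono fun s hs => hrD s (Ioi_subset_Ici_self hs)
  have hrint : IntegrableOn r (Ioi a) := (integrableOn_Ioi_div_sq ha D).mono'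
    ((hr.mono Ioi_subset_Ici_self).aestronglyMeasurable measurableSet_Ioi) hbound
  have hPlim : Tendsto P atTop (𝓝 0) :=
    squeeze_zero_norm' ((eventually_ge_atTop a).mono hPC)
      (tendsto_const_nhds.div_atTop (tendsto_pow_atTop two_ne_zero))
  refine ⟨0 - P a - ∫ s in Ioi a, r s, ?_, ?_⟩
  · refine ((hPlim.sub_const (P a)).sub
      (intervalIntegral_tendsto_integral_Ioi a hrint tendsto_id)).congr' ?_
    filter_upwards [eventually_ge_atTop a] with R hR
    have hsub : uIcc a R ⊆ Ici a := by
      rw [uIcc_of_le hR]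
      exact Icc_subset_Ici_self
    have hfi : IntervalIntegrable f volume a R := (hf.mono hsub).intervalIntegrable
    have hri : IntervalIntegrable r volume a R := (hr.mono hsub).intervalIntegrable
    rw [id, ← intervalIntegral.integral_eq_sub_of_hasDerivAt (fun s hs => hP s (hsub hs))
      (hfi.add hri), intervalIntegral.integral_add hfi hri, add_sub_cancel_right]
  · have hrle : ‖∫ s in Ioi a, r s‖ ≤ D / a := by
      rw [← integral_Ioi_div_sq ha D]
      exact norm_integral_le_of_norm_le (integrableOn_Ioi_div_sq ha D) hbound
    rw [zero_sub]
    exact (norm_sub_le _ _).trans (add_le_add (by simpa using hPC a self_mem_Ici) hrle)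

theorem norm_div_I_mul_le {z : ℂ} {p q M : ℝ} (hz : ‖z‖ ≤ M) (hq : 0 < q) (hp : q ≤ p) :
    ‖z / (Complex.I * p)‖ ≤ M / q := by
  rw [norm_div, norm_mul, Complex.norm_I, one_mul, Complex.norm_of_nonneg (hq.le.trans hp)]
  exact div_le_div₀ ((norm_nonneg z).trans hz) hz hq hp

theorem norm_deriv_div_I_mul_le {z w : ℂ} {p p' q r d M : ℝ} (hz : ‖z‖ ≤ M) (hw : ‖w‖ ≤ M)
    (hq : 0 < q) (hp : q ≤ p) (hr : 0 < r) (hp' : |p'| * r ≤ d * p ^ 2) :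
    ‖(w * (Complex.I * p) - z * (Complex.I * p')) / (Complex.I * p) ^ 2‖ ≤
      M / q + M * d / r := by
  have hp0 : 0 < p := hq.trans_le hp
  have hne : Complex.I * (p : ℂ) ≠ 0 :=
    mul_ne_zero Complex.I_ne_zero (Complex.ofReal_ne_zero.2 hp0.ne')
  have hsq : ‖z * (Complex.I * p') / (Complex.I * p) ^ 2‖ ≤ M * d / r := by
    rw [norm_div, norm_pow, norm_mul, norm_mul, norm_mul, Complex.norm_I, one_mul, one_mul,
      Complex.norm_of_nonneg hp0.le, Complex.norm_real, Real.norm_eq_abs,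
      div_le_div_iff₀ (pow_pos hp0 2) hr, mul_assoc, mul_assoc]
    exact mul_le_mul hz hp' (by positivity) ((norm_nonneg z).trans hz)
  rw [sub_div, pow_two, mul_div_mul_right _ _ hne, ← pow_two]
  exact (norm_sub_le _ _).trans (add_le_add (norm_div_I_mul_le hw hq hp) hsq)

-- Integration by parts: `exp (i φ) h` is the derivative of `exp (i φ)` times `h / (i dφ/ds)`.
theorem exists_tendsto_integral_exp_I_mul {φ φ' φ'' : ℝ → ℝ} {h h' : ℝ → ℂ} {a c d M : ℝ}
    (ha : 0 < a) (hc : 0 < c) (hφ : ∀ s, HasDerivAt φ (φ' s) s)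
    (hφ' : ∀ s, HasDerivAt φ' (φ'' s) s) (hφ'' : Continuous φ'')
    (hlow : ∀ s ∈ Ici a, c * s ^ 2 ≤ φ' s) (hupp : ∀ s ∈ Ici a, |φ'' s| * s ^ 2 ≤ d * φ' s ^ 2)
    (hh : ∀ s, HasDerivAt h (h' s) s) (hh' : Continuous h') (hM : ∀ s, ‖h s‖ ≤ M)
    (hM' : ∀ s, ‖h' s‖ ≤ M) :
    ∃ I, Tendsto (fun R : ℝ => ∫ s in a..R, Complex.exp (Complex.I * φ s) * h s) atTop (𝓝 I) ∧
      ‖I‖ ≤ M / c / a ^ 2 + (M / c + M * d) / a := by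
  have hsq : ∀ s ∈ Ici a, 0 < s ^ 2 := fun s hs => pow_pos (ha.trans_le hs) 2
  have hcsq : ∀ s ∈ Ici a, 0 < c * s ^ 2 := fun s hs => mul_pos hc (hsq s hs)
  have hne : ∀ s ∈ Ici a, Complex.I * (φ' s : ℂ) ≠ 0 := fun s hs =>
    mul_ne_zero Complex.I_ne_zero
      (Complex.ofReal_ne_zero.2 ((hcsq s hs).trans_le (hlow s hs)).ne')
  have cφ' : Continuous φ' := continuous_iff_continuousAt.2 fun s => (hφ' s).continuousAt
  have ch : Continuous h := continuous_iff_continuousAt.2 fun s => (hh s).continuousAt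
  have hexp : ∀ s, HasDerivAt (fun s => Complex.exp (Complex.I * φ s))
      (Complex.exp (Complex.I * φ s) * (Complex.I * φ' s)) s := fun s =>
    ((hφ s).ofReal_comp.const_mul Complex.I).cexp
  have cexp : Continuous fun s => Complex.exp (Complex.I * φ s) :=
    continuous_iff_continuousAt.2 fun s => (hexp s).continuousAt
  have hnorm : ∀ s z, ‖Complex.exp (Complex.I * φ s) * z‖ = ‖z‖ := fun s z => by
    rw [norm_mul, mul_comm Complex.I, Complex.norm_exp_ofReal_mul_I, one_mul]
  refine exists_tendsto_integral_of_hasDerivAt_add ha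
    (P := fun s => Complex.exp (Complex.I * φ s) * (h s / (Complex.I * φ' s)))
    (r := fun s => Complex.exp (Complex.I * φ s) *
      ((h' s * (Complex.I * φ' s) - h s * (Complex.I * φ'' s)) / (Complex.I * φ' s) ^ 2))
    (fun s hs => ?_) (cexp.mul ch).continuousOn ?_ (fun s hs => ?_) (fun s hs => ?_)
  · refine ((hexp s).mul ((hh s).fun_div ((hφ' s).ofReal_comp.const_mul Complex.I)
      (hne s hs))).congr_deriv ?_
    rw [mul_assoc, mul_div_cancel₀ _ (hne s hs)]
  · exact cexp.continuousOn.mul (ContinuousOn.div (by fun_prop) (by fun_prop)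
      fun s hs => pow_ne_zero 2 (hne s hs))
  · rw [hnorm, div_div]
    exact norm_div_I_mul_le (hM s) (hcsq s hs) (hlow s hs)
  · rw [hnorm, add_div, div_div M]
    exact norm_deriv_div_I_mul_le (hM s) (hM' s) (hcsq s hs) (hlow s hs) (hsq s hs) (hupp s hs)

section Phase

variable {t : ℝ} (κ y : ℝ)

theorem hasDerivAt_quarticPhase (t s : ℝ) :
    HasDerivAt (fun s : ℝ => (κ ^ 2 + s ^ 2) ^ 2 * t + s * y)
      (4 * s * (κ ^ 2 + s ^ 2) * t + y) s := by
  refine ((((hasDerivAt_pow 2 s).const_add (κ ^ 2)).fun_pow 2).mul_const t |>.add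
    ((hasDerivAt_id s).mul_const y)).congr_deriv ?_
  simp only [Nat.cast_ofNat, Nat.reduceSub, pow_one]
  ring

theorem hasDerivAt_deriv_quarticPhase (t s : ℝ) :
    HasDerivAt (fun s : ℝ => 4 * s * (κ ^ 2 + s ^ 2) * t + y) ((12 * s ^ 2 + 4 * κ ^ 2) * t) s := by
  refine (((((hasDerivAt_id s).const_mul 4).mul
    ((hasDerivAt_pow 2 s).const_add (κ ^ 2))).mul_const t).add_const y).congr_deriv ?_
  simp only [id, Nat.cast_ofNat, Nat.reduceSub, pow_one]
  ring

variable {κ y} {s : ℝ}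

theorem le_deriv_quarticPhase (ht : 0 < t) (hs : 1 + |y| / (2 * t) ≤ s) :
    2 * s * (κ ^ 2 + s ^ 2) * t ≤ 4 * s * (κ ^ 2 + s ^ 2) * t + y := by
  have hs1 : 1 ≤ s := le_trans (le_add_of_nonneg_right (by positivity)) hs
  have hy : |y| ≤ s * (2 * t) := by
    rw [← div_le_iff₀ (by positivity)]
    linarith
  have hsq : 1 ≤ κ ^ 2 + s ^ 2 := by nlinarith [sq_nonneg κ]
  have hle : s * (2 * t) ≤ s * (2 * t) * (κ ^ 2 + s ^ 2) :=
    le_mul_of_one_le_right (by positivity) hsq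
  linarith [neg_abs_le y]

theorem sq_le_deriv_quarticPhase (ht : 0 < t) (hs : 1 + |y| / (2 * t) ≤ s) :
    2 * t * s ^ 2 ≤ 4 * s * (κ ^ 2 + s ^ 2) * t + y := by
  have hs1 : 1 ≤ s := le_trans (le_add_of_nonneg_right (by positivity)) hs
  refine le_trans ?_ (le_deriv_quarticPhase ht hs)
  calc 2 * t * s ^ 2 ≤ 2 * t * (s * (κ ^ 2 + s ^ 2)) := by
        gcongr
        nlinarith [mul_nonneg (zero_le_one.trans hs1) (sq_nonneg κ)]
    _ = 2 * s * (κ ^ 2 + s ^ 2) * t := by ring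

theorem abs_deriv_deriv_quarticPhase_le (ht : 0 < t) (hs : 1 + |y| / (2 * t) ≤ s) :
    |(12 * s ^ 2 + 4 * κ ^ 2) * t| * s ^ 2 ≤
      3 / t * (4 * s * (κ ^ 2 + s ^ 2) * t + y) ^ 2 := by
  have hs1 : 1 ≤ s := le_trans (le_add_of_nonneg_right (by positivity)) hs
  have hsq : 1 ≤ κ ^ 2 + s ^ 2 := by nlinarith [sq_nonneg κ]
  rw [abs_of_nonneg (by positivity)]
  calc (12 * s ^ 2 + 4 * κ ^ 2) * t * s ^ 2
      ≤ 12 * (κ ^ 2 + s ^ 2) * t * s ^ 2 := by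
        gcongr
        linarith [sq_nonneg κ]
    _ ≤ 12 * (κ ^ 2 + s ^ 2) * t * s ^ 2 * (κ ^ 2 + s ^ 2) :=
        le_mul_of_one_le_right (by positivity) hsq
    _ = 3 / t * (2 * s * (κ ^ 2 + s ^ 2) * t) ^ 2 := by field_simp; ring
    _ ≤ _ := by
        gcongr
        exact le_deriv_quarticPhase ht hs

end Phase

theorem exists_oscillatory_limit {t : ℝ} (ht : 0 < t) (κ y : ℝ) {h h' : ℝ → ℂ}
    (hh : ∀ s, HasDerivAt h (h' s) s) (hh' : Continuous h') {M : ℝ} (hM : ∀ s, ‖h s‖ ≤ M)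
    (hM' : ∀ s, ‖h' s‖ ≤ M) :
    ∃ I, Tendsto (fun R : ℝ => ∫ s in (0 : ℝ)..R,
        Complex.exp (Complex.I * (((κ ^ 2 + s ^ 2) ^ 2 * t + s * y : ℝ) : ℂ)) * h s)
        atTop (𝓝 I) ∧ ‖I‖ ≤ M * (1 + |y| / (2 * t) + 4 / t) := by
  have hM0 : 0 ≤ M := (norm_nonneg _).trans (hM 0)
  set a : ℝ := 1 + |y| / (2 * t)
  have ha1 : 1 ≤ a := le_add_of_nonneg_right (by positivity)
  have ha0 : 0 < a := by linarith
  obtain ⟨I, hI, hIle⟩ := exists_tendsto_integral_exp_I_mul ha0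
    (mul_pos two_pos ht) (hasDerivAt_quarticPhase κ y t) (hasDerivAt_deriv_quarticPhase κ y t)
    (by fun_prop) (fun s hs => sq_le_deriv_quarticPhase ht hs)
    (fun s hs => abs_deriv_deriv_quarticPhase_le ht hs) hh hh' hM hM'
  have ch : Continuous h := continuous_iff_continuousAt.2 fun s => (hh s).continuousAt
  set f : ℝ → ℂ := fun s =>
    Complex.exp (Complex.I * (((κ ^ 2 + s ^ 2) ^ 2 * t + s * y : ℝ) : ℂ)) * h s with hf
  have hfi : ∀ p q : ℝ, IntervalIntegrable f volume p q := fun p q =>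
    Continuous.intervalIntegrable (by fun_prop) p q
  have hle : ‖∫ s in (0 : ℝ)..a, f s‖ ≤ M * a := by
    refine (intervalIntegral.norm_integral_le_of_norm_le_const fun s _ => ?_).trans_eq
      (by rw [sub_zero, abs_of_pos ha0])
    rw [hf, norm_mul, mul_comm Complex.I, Complex.norm_exp_ofReal_mul_I, one_mul]
    exact hM s
  refine ⟨(∫ s in (0 : ℝ)..a, f s) + I, (hI.const_add _).congr fun R =>
    intervalIntegral.integral_add_adjacent_intervals (hfi 0 a) (hfi a R), ?_⟩
  calc ‖(∫ s in (0 : ℝ)..a, f s) + I‖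
      ≤ M * a + (M / (2 * t) / a ^ 2 + (M / (2 * t) + M * (3 / t)) / a) :=
        (norm_add_le _ _).trans (add_le_add hle hIle)
    _ ≤ M * a + (M / (2 * t) + (M / (2 * t) + M * (3 / t))) := by
        gcongr M * a + (?_ + ?_)
        · exact div_le_self (by positivity) (one_le_pow₀ ha1)
        · exact div_le_self (by positivity) ha1
    _ = M * (a + 4 / t) := by field_simp; ring

theorem deriv_negAxis (s : ℝ) : deriv negAxis s = -1 :=
  ((hasDerivAt_id s).ofReal_comp.neg.congr_deriv (by simp) : HasDerivAt negAxis (-1) s).deriv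

theorem deriv_ofReal (s : ℝ) : deriv (fun s : ℝ => (s : ℂ)) s = 1 :=
  Complex.ofRealCLM.hasDerivAt.deriv.trans (by simp)

theorem hasRealLineIntegral_of_tendsto {F : ℂ → ℂ} {I₁ I₂ : ℂ} (hF : Continuous fun s : ℝ => F s)
    (h₁ : Tendsto (fun R : ℝ => ∫ s in -R..0, F s) atTop (𝓝 I₁))
    (h₂ : Tendsto (fun R : ℝ => ∫ s in (0 : ℝ)..R, F s) atTop (𝓝 I₂)) :
    HasRealLineIntegral F (I₁ + I₂) := by
  have hneg : (fun s => F (negAxis s) * deriv negAxis s) = fun s : ℝ => -F ((-s : ℝ) : ℂ) := by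
    ext s
    rw [deriv_negAxis, negAxis, mul_neg_one, Complex.ofReal_neg]
  have hpos : (fun s : ℝ => F s * deriv (fun s : ℝ => (s : ℂ)) s) = fun s : ℝ => F s := by
    ext s
    rw [deriv_ofReal, mul_one]
  refine ⟨-I₁, I₂, ⟨fun R _ => ?_, ?_⟩, ⟨fun R _ => ?_, ?_⟩, by rw [neg_neg]⟩
  · rw [hneg]
    exact (hF.comp continuous_neg).neg.intervalIntegrable _ _
  · simp only [hneg, intervalIntegral.integral_neg,
      intervalIntegral.integral_comp_neg (fun s : ℝ => F s), neg_zero]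
    exact h₁.neg
  · rw [hpos]
    exact hF.intervalIntegrable _ _
  · rwa [hpos]

theorem hasRealLineIntegral_of_hasDerivAt_add {F : ℂ → ℂ} {P r : ℝ → ℂ}
    (hF : Continuous fun s : ℝ => F s) (hP : ∀ s : ℝ, HasDerivAt P (F s + r s) s)
    (hr : Continuous r) (hri : Integrable r) (htop : Tendsto P atTop (𝓝 0))
    (hbot : Tendsto P atBot (𝓝 0)) : HasRealLineIntegral F (-∫ s, r s) := by
  have hint : ∀ a b : ℝ, ∫ s in a..b, F s = P b - P a - ∫ s in a..b, r s := by
    intro a b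
    rw [← intervalIntegral.integral_eq_sub_of_hasDerivAt (fun s _ => hP s)
      ((hF.add hr).intervalIntegrable a b), intervalIntegral.integral_add
      (hF.intervalIntegrable a b) (hr.intervalIntegrable a b), add_sub_cancel_right]
  have hneg : Tendsto (fun R : ℝ => ∫ s in -R..0, F s) atTop
      (𝓝 (P 0 - 0 - ∫ s in Iic 0, r s)) := by
    simp only [hint]
    exact ((hbot.comp tendsto_neg_atTop_atBot).const_sub (P 0)).sub
      (intervalIntegral_tendsto_integral_Iic 0 hri.integrableOn tendsto_neg_atTop_atBot)
  have hpos : Tendsto (fun R : ℝ => ∫ s in (0 : ℝ)..R, F s) atTop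
      (𝓝 (0 - P 0 - ∫ s in Ioi 0, r s)) := by
    simp only [hint]
    exact (htop.sub_const (P 0)).sub
      (intervalIntegral_tendsto_integral_Ioi 0 hri.integrableOn tendsto_id)
  convert hasRealLineIntegral_of_tendsto hF hneg hpos using 1
  rw [← intervalIntegral.integral_Iic_add_Ioi (b := 0) hri.integrableOn hri.integrableOn]
  ring

theorem continuous_halfLineFT_ofReal {f : ℝ → ℂ} (hf : IntegrableOn f (Ioi 0)) :
    Continuous fun s : ℝ => halfLineFT f s :=
  (continuousOn_halfLineFT hf).comp_continuous Complex.continuous_ofReal fun _ => by simp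

theorem hasDerivAt_halfLineFT_ofReal {f : ℝ → ℂ} (hf : IntegrableOn f (Ioi 0))
    (hm : IntegrableOn (momentFun f) (Ioi 0)) (s : ℝ) :
    HasDerivAt (fun s : ℝ => halfLineFT f s) (halfLineFT (momentFun f) s) s := by
  simpa using hasDerivAt_halfLineFT_line hf hm (a := 0) (d := 1) (s := s) univ_mem (by simp)

theorem E_ofReal (κ s x y t : ℝ) : E κ s x y t = Complex.exp (Complex.I * κ * x) *
    Complex.exp (Complex.I * (((κ ^ 2 + s ^ 2) ^ 2 * t + s * y : ℝ) : ℂ)) := by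
  rw [E, ← Complex.exp_add]
  congr 1
  push_cast
  ring

theorem norm_exp_I_mul_ofReal_mul (a b : ℝ) : ‖Complex.exp (Complex.I * a * b)‖ = 1 := by
  rw [norm_exp_I_mul, Complex.ofReal_im, mul_zero, Real.exp_zero]

theorem exists_hasRealLineIntegral {t : ℝ} (ht : 0 < t) (κ x y : ℝ) {f : ℝ → ℂ}
    (hf : IntegrableOn f (Ioi 0)) (hm : IntegrableOn (momentFun f) (Ioi 0)) {M : ℝ}
    (hfM : ∫ y in Ioi (0 : ℝ), ‖f y‖ ≤ M) (hmM : ∫ y in Ioi (0 : ℝ), ‖momentFun f y‖ ≤ M) :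
    ∃ A, HasRealLineIntegral (fun l => E κ l x y t * halfLineFT f l) A ∧
      ‖A‖ ≤ M * (2 * (1 + |y| / (2 * t) + 4 / t)) := by
  have hle : ∀ s : ℝ, ‖halfLineFT f s‖ ≤ M := fun s =>
    (norm_halfLineFT_le hf (by simp)).trans hfM
  have hle' : ∀ s : ℝ, ‖halfLineFT (momentFun f) s‖ ≤ M := fun s =>
    (norm_halfLineFT_le hm (by simp)).trans hmM
  have hd := hasDerivAt_halfLineFT_ofReal hf hm
  have hc := continuous_halfLineFT_ofReal hf
  have hcm := continuous_halfLineFT_ofReal hm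
  have hdneg : ∀ s : ℝ, HasDerivAt (fun s : ℝ => halfLineFT f ((-s : ℝ) : ℂ))
      (-halfLineFT (momentFun f) ((-s : ℝ) : ℂ)) s := fun s => by
    simpa [Function.comp_def] using (hd (-s)).scomp s (hasDerivAt_neg s)
  obtain ⟨I₂, hI₂, hI₂le⟩ := exists_oscillatory_limit ht κ y hd hcm hle hle'
  obtain ⟨I₁, hI₁, hI₁le⟩ := exists_oscillatory_limit ht κ (-y) hdneg
    (hcm.comp continuous_neg).neg (fun s => hle (-s))
    (fun s => (norm_neg _).trans_le (hle' (-s)))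
  rw [abs_neg] at hI₁le
  have hneg : Tendsto (fun R : ℝ => ∫ s in -R..0, E κ s x y t * halfLineFT f s) atTop
      (𝓝 (Complex.exp (Complex.I * κ * x) * I₁)) := by
    refine (hI₁.const_mul _).congr fun R => ?_
    conv_rhs => rw [← neg_zero, ← intervalIntegral.integral_comp_neg]
    rw [← intervalIntegral.integral_const_mul]
    refine intervalIntegral.integral_congr fun s _ => ?_
    simp only [E_ofReal, neg_sq, neg_mul_comm, mul_assoc]
  have hpos : Tendsto (fun R : ℝ => ∫ s in (0 : ℝ)..R, E κ s x y t * halfLineFT f s) atTop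
      (𝓝 (Complex.exp (Complex.I * κ * x) * I₂)) := by
    refine (hI₂.const_mul _).congr fun R => ?_
    rw [← intervalIntegral.integral_const_mul]
    simp only [E_ofReal, mul_assoc]
  refine ⟨_, hasRealLineIntegral_of_tendsto (by unfold E; fun_prop) hneg hpos, ?_⟩
  rw [← mul_add, norm_mul, norm_exp_I_mul_ofReal_mul, one_mul]
  linarith [norm_add_le I₁ I₂]

/-! ### Fourier inversion -/

open FourierTransform in
theorem fourier_eq_integral_angular (g : ℝ → ℂ) (w : ℝ) :
    𝓕 g w = ∫ v : ℝ, Complex.exp (-Complex.I * v * (2 * Real.pi * w : ℝ)) * g v := by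
  rw [Real.fourier_real_eq_integral_exp_smul]
  refine integral_congr_ae (Eventually.of_forall fun v => ?_)
  simp only [smul_eq_mul]
  congr 2
  push_cast
  ring

open FourierTransform in
theorem fourier_inversion_angular {g : ℝ → ℂ} (hg : Integrable g)
    (hG : Integrable fun s : ℝ => ∫ v : ℝ, Complex.exp (-Complex.I * v * s) * g v) {v : ℝ}
    (hv : ContinuousAt g v) :
    ∫ s : ℝ, Complex.exp (Complex.I * s * v) * ∫ w : ℝ, Complex.exp (-Complex.I * w * s) * g w =
      2 * Real.pi * g v := by
  have hFint : Integrable (𝓕 g) := by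
    simp only [funext (fourier_eq_integral_angular g)]
    exact hG.comp_mul_left' (by positivity)
  have hinv : ∫ w : ℝ, Complex.exp (Complex.I * (2 * Real.pi * w : ℝ) * v) *
      ∫ x : ℝ, Complex.exp (-Complex.I * x * (2 * Real.pi * w : ℝ)) * g x = g v := by
    rw [← hg.fourierInv_fourier_eq hFint hv, Real.fourierInv_eq']
    refine integral_congr_ae (Eventually.of_forall fun w => ?_)
    simp only [smul_eq_mul, fourier_eq_integral_angular, RCLike.inner_apply, conj_trivial]
    congr 2
    push_cast
    ring
  rw [Measure.integral_comp_mul_left (fun s : ℝ => Complex.exp (Complex.I * s * v) *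
    ∫ x : ℝ, Complex.exp (-Complex.I * x * s) * g x), abs_of_pos (by positivity),
    Complex.real_smul] at hinv
  rw [← hinv, ← mul_assoc, Complex.ofReal_inv, Complex.ofReal_mul, Complex.ofReal_ofNat,
    mul_inv_cancel₀ (by simp), one_mul]

/-- `f` is continuous on the closed half line and decays to third order. This makes the first moment
of `f` integrable, hence the half line transform of `f` differentiable on the real line. -/
structure IsCubeDecaying (f : ℝ → ℂ) : Prop where
  continuousOn : ContinuousOn f (Ici 0)
  exists_norm_le : ∃ C, ∀ y, 0 ≤ y → ‖f y‖ ≤ C * ((1 + y) ^ 3)⁻¹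

/-- `f` is twice continuously differentiable on the half line with derivatives `f'`, `f''`, and all
three decay to third order; the derivatives are asserted in the interior only. -/
structure IsC2Decaying (f f' f'' : ℝ → ℂ) : Prop where
  decaying : IsCubeDecaying f
  decaying_deriv : IsCubeDecaying f'
  decaying_deriv₂ : IsCubeDecaying f''
  hasDerivAt : ∀ y, 0 < y → HasDerivAt f (f' y) y
  hasDerivAt_deriv : ∀ y, 0 < y → HasDerivAt f' (f'' y) y

theorem integrable_inv_one_add_abs_sq : Integrable fun x : ℝ => ((1 + |x|) ^ 2)⁻¹ := by
  refine (integrable_one_add_norm (E := ℝ) (μ := volume) (r := 2) (by simp)).congr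
    (Eventually.of_forall fun x => ?_)
  simp only [Real.norm_eq_abs]
  rw [Real.rpow_neg (by positivity), Real.rpow_ofNat]

theorem integrableOn_of_norm_le_inv_sq {f : ℝ → ℂ} (hc : ContinuousOn f (Ici 0)) {C : ℝ}
    (hb : ∀ y, 0 ≤ y → ‖f y‖ ≤ C * ((1 + y) ^ 2)⁻¹) : IntegrableOn f (Ioi 0) := by
  refine (integrable_inv_one_add_abs_sq.integrableOn.const_mul C).mono'
    ((hc.mono Ioi_subset_Ici_self).aestronglyMeasurable measurableSet_Ioi)
    (ae_restrict_of_forall_mem measurableSet_Ioi fun y hy => ?_)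
  rw [abs_of_pos hy]
  exact hb y (le_of_lt hy)

theorem norm_momentFun {y : ℝ} (hy : 0 ≤ y) (f : ℝ → ℂ) : ‖momentFun f y‖ = y * ‖f y‖ := by
  rw [momentFun, norm_mul, norm_mul, norm_neg, Complex.norm_I, one_mul,
    Complex.norm_of_nonneg hy]

theorem continuousOn_momentFun {f : ℝ → ℂ} {s : Set ℝ} (hf : ContinuousOn f s) :
    ContinuousOn (momentFun f) s := by
  unfold momentFun
  fun_prop

theorem hasDerivAt_momentFun {f : ℝ → ℂ} {f' : ℝ → ℂ} {y : ℝ} (hf : HasDerivAt f (f' y) y) :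
    HasDerivAt (momentFun f) (-Complex.I * f y + momentFun f' y) y :=
  ((Complex.ofRealCLM.hasDerivAt.const_mul (-Complex.I)).mul hf).congr_deriv
    (by simp [momentFun])

theorem IsCubeDecaying.integrableOn {f : ℝ → ℂ} (h : IsCubeDecaying f) :
    IntegrableOn f (Ioi 0) := by
  obtain ⟨C, hC⟩ := h.exists_norm_le
  have hC0 : 0 ≤ C := by simpa using (norm_nonneg _).trans (hC 0 le_rfl)
  refine integrableOn_of_norm_le_inv_sq (C := C) h.continuousOn fun y hy => (hC y hy).trans ?_
  gcongr
  · linarith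
  · norm_num

theorem IsCubeDecaying.integrableOn_momentFun {f : ℝ → ℂ} (h : IsCubeDecaying f) :
    IntegrableOn (momentFun f) (Ioi 0) := by
  obtain ⟨C, hC⟩ := h.exists_norm_le
  refine integrableOn_of_norm_le_inv_sq (C := C) (continuousOn_momentFun h.continuousOn)
    fun y hy => ?_
  rw [norm_momentFun hy]
  calc y * ‖f y‖ ≤ (1 + y) * (C * ((1 + y) ^ 3)⁻¹) :=
        mul_le_mul (by linarith) (hC y hy) (norm_nonneg _) (by linarith)
    _ = C * ((1 + y) ^ 2)⁻¹ := by field_simp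

namespace IsC2Decaying

variable {f f' f'' : ℝ → ℂ}

-- The moment vanishes at `y = 0`, so two integrations by parts leave no term of order `1 / s`.
theorem exists_norm_halfLineFT_momentFun_le (h : IsC2Decaying f f' f'') :
    ∃ C, ∀ s : ℝ, ‖halfLineFT (momentFun f) s‖ ≤ C * (1 + s ^ 2)⁻¹ := by
  set m' : ℝ → ℂ := fun y => -Complex.I * f y + momentFun f' y
  set m'' : ℝ → ℂ := fun y => -Complex.I * f' y + (-Complex.I * f' y + momentFun f'' y)
  have him : IntegrableOn (momentFun f) (Ioi 0) := h.decaying.integrableOn_momentFun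
  have him' : IntegrableOn m' (Ioi 0) :=
    (h.decaying.integrableOn.const_mul _).add h.decaying_deriv.integrableOn_momentFun
  have him'' : IntegrableOn m'' (Ioi 0) :=
    (h.decaying_deriv.integrableOn.const_mul _).add
      ((h.decaying_deriv.integrableOn.const_mul _).add h.decaying_deriv₂.integrableOn_momentFun)
  have hcm : ContinuousOn (momentFun f) (Ici 0) := continuousOn_momentFun h.decaying.continuousOn
  have hcm' : ContinuousOn m' (Ici 0) :=
    (continuousOn_const.mul h.decaying.continuousOn).add
      (continuousOn_momentFun h.decaying_deriv.continuousOn)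
  have hdm : ∀ y, 0 < y → HasDerivAt (momentFun f) (m' y) y := fun y hy =>
    hasDerivAt_momentFun (h.hasDerivAt y hy)
  have hdm' : ∀ y, 0 < y → HasDerivAt m' (m'' y) y := fun y hy =>
    ((h.hasDerivAt y hy).const_mul (-Complex.I)).add
      (hasDerivAt_momentFun (h.hasDerivAt_deriv y hy))
  refine ⟨(∫ y in Ioi (0 : ℝ), ‖momentFun f y‖) + (‖m' 0‖ + ∫ y in Ioi (0 : ℝ), ‖m'' y‖),
    fun s => ?_⟩
  have hs : ((s : ℝ) : ℂ).im ≤ 0 := by simp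
  have hle := norm_mul_norm_halfLineFT_le hcm' hdm' him' him'' hs
  have hzero : momentFun f 0 = 0 := by simp [momentFun]
  rw [halfLineFT_deriv hcm hdm him him' hs, hzero, neg_zero, zero_add, norm_mul, norm_mul,
    Complex.norm_I, one_mul, Complex.norm_real, Real.norm_eq_abs, ← mul_assoc,
    abs_mul_abs_self] at hle
  rw [← div_eq_mul_inv, le_div_iff₀ (by positivity)]
  linarith [norm_halfLineFT_le him hs]

theorem integrable_halfLineFT_momentFun (h : IsC2Decaying f f' f'') :
    Integrable fun s : ℝ => halfLineFT (momentFun f) s := by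
  obtain ⟨C, hC⟩ := h.exists_norm_halfLineFT_momentFun_le
  exact (integrable_inv_one_add_sq.const_mul C).mono'
    (continuous_halfLineFT_ofReal h.decaying.integrableOn_momentFun).aestronglyMeasurable
    (Eventually.of_forall hC)

theorem integral_exp_mul_halfLineFT_momentFun (h : IsC2Decaying f f' f'') {y : ℝ} (hy : 0 < y) :
    ∫ s : ℝ, Complex.exp (Complex.I * s * y) * halfLineFT (momentFun f) s =
      2 * Real.pi * momentFun f y := by
  have hindicator : ∀ s : ℝ, ∫ v : ℝ, Complex.exp (-Complex.I * v * s) *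
      indicator (Ioi 0) (momentFun f) v = halfLineFT (momentFun f) s := by
    intro s
    rw [halfLineFT, ← integral_indicator measurableSet_Ioi]
    refine integral_congr_ae (Eventually.of_forall fun v => ?_)
    exact (indicator_mul_right (Ioi 0) (fun v : ℝ => Complex.exp (-Complex.I * v * s)) _).symm
  have hcont : ContinuousAt (indicator (Ioi 0) (momentFun f)) y :=
    (hasDerivAt_momentFun (h.hasDerivAt y hy)).continuousAt.congr
      (eventually_of_mem (Ioi_mem_nhds hy) fun v hv => (indicator_of_mem hv _).symm)
  have hinv := fourier_inversion_angular
    ((integrable_indicator_iff measurableSet_Ioi).2 h.decaying.integrableOn_momentFun)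
    (by simpa only [hindicator] using h.integrable_halfLineFT_momentFun) hcont
  simpa only [hindicator, indicator_of_mem (mem_Ioi.2 hy)] using hinv

theorem tendsto_halfLineFT_cocompact (h : IsC2Decaying f f' f'') :
    Tendsto (fun s : ℝ => halfLineFT f s) (cocompact ℝ) (𝓝 0) := by
  obtain ⟨C, -, hC⟩ := exists_norm_halfLineFT_le h.decaying.continuousOn h.hasDerivAt
    h.decaying.integrableOn h.decaying_deriv.integrableOn
  refine squeeze_zero_norm (fun s => hC s (by simp)) (tendsto_const_nhds.div_atTop ?_)
  simp only [Complex.norm_real]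
  exact tendsto_atTop_add_const_left _ _ tendsto_norm_cocompact_atTop

-- Integration by parts trades `f` for its moment, whose transform is absolutely integrable.
theorem hasRealLineIntegral (h : IsC2Decaying f f' f'') (c : ℂ) {y : ℝ} (hy : 0 < y) :
    HasRealLineIntegral (fun l => c * Complex.exp (Complex.I * l * y) * halfLineFT f l)
      (c * (2 * Real.pi * f y)) := by
  have hy0 : (y : ℂ) ≠ 0 := Complex.ofReal_ne_zero.2 hy.ne'
  have hexp : ∀ s : ℝ, HasDerivAt (fun s : ℝ => Complex.exp (Complex.I * s * y))
      (Complex.I * y * Complex.exp (Complex.I * s * y)) s := by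
    simpa only [mul_right_comm] using hasDerivAt_exp_mul_ofReal (Complex.I * y)
  have hm := h.decaying.integrableOn_momentFun
  have hc := continuous_halfLineFT_ofReal h.decaying.integrableOn
  have hcm := continuous_halfLineFT_ofReal hm
  have hint : Integrable fun s : ℝ =>
      Complex.exp (Complex.I * s * y) * halfLineFT (momentFun f) s :=
    h.integrable_halfLineFT_momentFun.bdd_mul (c := 1)
      (Continuous.aestronglyMeasurable (by fun_prop))
      (Eventually.of_forall fun s => (norm_exp_I_mul_ofReal_mul s y).le)
  have hlim : Tendsto (fun s : ℝ => c / (Complex.I * y) *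
      (Complex.exp (Complex.I * s * y) * halfLineFT f s)) (cocompact ℝ) (𝓝 0) := by
    rw [← mul_zero (c / (Complex.I * y))]
    have hnorm := h.tendsto_halfLineFT_cocompact.norm
    rw [norm_zero] at hnorm
    refine (squeeze_zero_norm (fun s => ?_) hnorm).const_mul _
    rw [norm_mul, norm_exp_I_mul_ofReal_mul, one_mul]
  have hparts := hasRealLineIntegral_of_hasDerivAt_add
    (F := fun l => c * Complex.exp (Complex.I * l * y) * halfLineFT f l)
    (r := fun s : ℝ => c / (Complex.I * y) *
      (Complex.exp (Complex.I * s * y) * halfLineFT (momentFun f) s))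
    (by fun_prop) (fun s => ?_) (by fun_prop) (hint.const_mul _)
    (hlim.mono_left atTop_le_cocompact) (hlim.mono_left atBot_le_cocompact)
  · convert hparts using 1
    rw [integral_const_mul, h.integral_exp_mul_halfLineFT_momentFun hy, momentFun]
    field_simp
  · refine (((hexp s).mul (hasDerivAt_halfLineFT_ofReal h.decaying.integrableOn hm s)).const_mul
      (c / (Complex.I * y))).congr_deriv ?_
    field_simp

end IsC2Decaying

/-! ### Regularity on the closed domain -/

/-- `v` is of class `C^n` up to the boundary of the domain and its derivatives of order at most `n`
decay like `(1 + |x| + |y|)^{-m}`. Separating the weight `m` from the order `n` makes the notion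
stable under differentiation. -/
structure SmoothDecay (m n : ℕ) (T : ℝ) (v : ℝ × ℝ × ℝ → ℂ) : Prop where
  contDiffOn : ContDiffOn ℝ n v (closedDomain T)
  exists_weight_mul_norm_le : ∀ k ≤ n, ∃ C : ℝ, ∀ p ∈ closedDomain T,
    (1 + |p.1| + |p.2.1|) ^ m * ‖iteratedFDerivWithin ℝ k v (closedDomain T) p‖ ≤ C

/-- The derivative of `v` in the direction `e`, one-sided where the closed domain forces it. -/
def dirDeriv (T : ℝ) (e : ℝ × ℝ × ℝ) (v : ℝ × ℝ × ℝ → ℂ) (p : ℝ × ℝ × ℝ) : ℂ :=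
  fderivWithin ℝ v (closedDomain T) p e

/-- `∂ₓ` on the closed domain. -/
abbrev Dx (T : ℝ) := dirDeriv T (1, 0, 0)

/-- `∂ᵧ` on the closed domain. -/
abbrev Dy (T : ℝ) := dirDeriv T (0, 1, 0)

/-- `∂ₜ` on the closed domain. -/
abbrev Dt (T : ℝ) := dirDeriv T (0, 0, 1)

/-- `v` is continuous up to the boundary and decays like `(1 + |x|)^{-2}(1 + y)^{-3}`: integrably
in `x`, and in `y` to the order that `IsCubeDecaying` asks of its transform. -/
structure HasDecay (T : ℝ) (v : ℝ × ℝ × ℝ → ℂ) : Prop where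
  continuousOn : ContinuousOn v (closedDomain T)
  exists_norm_le : ∃ C, 0 ≤ C ∧ ∀ x y t : ℝ, 0 ≤ y → t ∈ Icc 0 T →
    ‖v (x, y, t)‖ ≤ C * ((1 + |x|) ^ 2)⁻¹ * ((1 + y) ^ 3)⁻¹

section Regularity

variable {m n k : ℕ} {T x y t : ℝ} {v : ℝ × ℝ × ℝ → ℂ}

theorem mem_closedDomain : (x, y, t) ∈ closedDomain T ↔ 0 ≤ y ∧ t ∈ Icc 0 T := by
  simp [closedDomain]

theorem uniqueDiffOn_closedDomain (hT : 0 < T) : UniqueDiffOn ℝ (closedDomain T) :=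
  uniqueDiffOn_univ.prod ((uniqueDiffOn_Ici 0).prod (uniqueDiffOn_Icc hT))

theorem SmoothDecaying.smoothDecay (h : SmoothDecaying n T v) : SmoothDecay n n T v where
  contDiffOn := h.1
  exists_weight_mul_norm_le k hk := (h.2 k hk).imp fun _ hC ⟨x, y, t⟩ hp =>
    hC x y t (mem_closedDomain.1 hp).1 (mem_closedDomain.1 hp).2.1 (mem_closedDomain.1 hp).2.2

namespace SmoothDecay

theorem mono (h : SmoothDecay m n T v) (hk : k ≤ n) : SmoothDecay m k T v where
  contDiffOn := h.contDiffOn.of_le (by exact_mod_cast hk)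
  exists_weight_mul_norm_le j hj := h.exists_weight_mul_norm_le j (hj.trans hk)

theorem dirDeriv (hT : 0 < T) (h : SmoothDecay m (n + 1) T v) (e : ℝ × ℝ × ℝ) :
    SmoothDecay m n T (dirDeriv T e v) := by
  have hu := uniqueDiffOn_closedDomain hT
  have hc : ContDiffOn ℝ n (fderivWithin ℝ v (closedDomain T)) (closedDomain T) :=
    h.contDiffOn.fderivWithin hu (by norm_cast)
  refine ⟨hc.clm_apply contDiffOn_const, fun k hk => ?_⟩
  obtain ⟨C, hC⟩ := h.exists_weight_mul_norm_le (k + 1) (by omega)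
  refine ⟨‖e‖ * C, fun p hp => ?_⟩
  have happly := norm_iteratedFDerivWithin_clm_apply_const (c := e) (hc p hp) hu hp
    (by exact_mod_cast hk : (k : WithTop ℕ∞) ≤ n)
  rw [norm_iteratedFDerivWithin_fderivWithin hu hp] at happly
  calc _ ≤ (1 + |p.1| + |p.2.1|) ^ m *
        (‖e‖ * ‖iteratedFDerivWithin ℝ (k + 1) v (closedDomain T) p‖) :=
        mul_le_mul_of_nonneg_left happly (by positivity)
    _ = ‖e‖ * ((1 + |p.1| + |p.2.1|) ^ m *
        ‖iteratedFDerivWithin ℝ (k + 1) v (closedDomain T) p‖) := mul_left_comm _ _ _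
    _ ≤ ‖e‖ * C := mul_le_mul_of_nonneg_left (hC p hp) (norm_nonneg _)

theorem iterate_dirDeriv (hT : 0 < T) (e : ℝ × ℝ × ℝ) (h : SmoothDecay m (n + k) T v) :
    SmoothDecay m n T ((BiharmonicSchrodinger.dirDeriv T e)^[k] v) := by
  induction k generalizing v with
  | zero => exact h
  | succ k ih => exact ih (h.dirDeriv hT e)

theorem hasDecay (h : SmoothDecay 5 n T v) : HasDecay T v := by
  refine ⟨h.contDiffOn.continuousOn, ?_⟩
  obtain ⟨C, hC⟩ := h.exists_weight_mul_norm_le 0 (Nat.zero_le _)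
  refine ⟨max C 0, le_max_right _ _, fun x y t hy ht => ?_⟩
  have hv := hC (x, y, t) (mem_closedDomain.2 ⟨hy, ht⟩)
  rw [norm_iteratedFDerivWithin_zero] at hv
  simp only [abs_of_nonneg hy] at hv
  have hweight : (1 + |x|) ^ 2 * (1 + y) ^ 3 ≤ (1 + |x| + y) ^ 5 := by
    calc (1 + |x|) ^ 2 * (1 + y) ^ 3 ≤ (1 + |x| + y) ^ 2 * (1 + |x| + y) ^ 3 := by
          have hx := abs_nonneg x
          gcongr ?_ ^ 2 * ?_ ^ 3 <;> linarith
      _ = (1 + |x| + y) ^ 5 := (pow_add _ 2 3).symm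
  rw [mul_assoc, ← mul_inv, ← div_eq_mul_inv, le_div_iff₀ (by positivity), mul_comm]
  exact (mul_le_mul_of_nonneg_right hweight (norm_nonneg _)).trans (hv.trans (le_max_left _ _))

theorem hasFDerivWithinAt (h : SmoothDecay m (n + 1) T v) {p : ℝ × ℝ × ℝ}
    (hp : p ∈ closedDomain T) :
    HasFDerivWithinAt v (fderivWithin ℝ v (closedDomain T) p) (closedDomain T) p :=
  (h.contDiffOn.differentiableOn (by simp) p hp).hasFDerivWithinAt

theorem hasDerivAt_x (h : SmoothDecay m (n + 1) T v) (hy : 0 ≤ y) (ht : t ∈ Icc 0 T) :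
    HasDerivAt (fun ξ => v (ξ, y, t)) (Dx T v (x, y, t)) x := by
  have hline : HasDerivWithinAt (fun ξ : ℝ => (ξ, y, t)) (1, 0, 0) univ x :=
    ((hasDerivAt_id x).prodMk (hasDerivAt_const x (y, t))).hasDerivWithinAt
  exact hasDerivWithinAt_univ.1 ((h.hasFDerivWithinAt
    (mem_closedDomain.2 ⟨hy, ht⟩)).comp_hasDerivWithinAt x hline
      fun ξ _ => mem_closedDomain.2 ⟨hy, ht⟩)

theorem hasDerivWithinAt_y (h : SmoothDecay m (n + 1) T v) (hy : 0 ≤ y) (ht : t ∈ Icc 0 T) :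
    HasDerivWithinAt (fun η => v (x, η, t)) (Dy T v (x, y, t)) (Ici 0) y := by
  have hline : HasDerivWithinAt (fun η : ℝ => (x, η, t)) (0, 1, 0) (Ici 0) y :=
    ((hasDerivAt_const y x).prodMk ((hasDerivAt_id y).prodMk
      (hasDerivAt_const y t))).hasDerivWithinAt
  exact (h.hasFDerivWithinAt (mem_closedDomain.2 ⟨hy, ht⟩)).comp_hasDerivWithinAt y hline
    fun η hη => mem_closedDomain.2 ⟨hη, ht⟩

theorem hasDerivAt_y (h : SmoothDecay m (n + 1) T v) (hy : 0 < y) (ht : t ∈ Icc 0 T) :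
    HasDerivAt (fun η => v (x, η, t)) (Dy T v (x, y, t)) y :=
  (h.hasDerivWithinAt_y hy.le ht).hasDerivAt (Ici_mem_nhds hy)

theorem hasDerivAt_t (h : SmoothDecay m (n + 1) T v) (hy : 0 ≤ y) (ht : t ∈ Ioo 0 T) :
    HasDerivAt (fun τ => v (x, y, τ)) (Dt T v (x, y, t)) t := by
  have hline : HasDerivWithinAt (fun τ : ℝ => (x, y, τ)) (0, 0, 1) (Icc 0 T) t :=
    ((hasDerivAt_const t x).prodMk ((hasDerivAt_const t y).prodMk
      (hasDerivAt_id t))).hasDerivWithinAt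
  exact ((h.hasFDerivWithinAt
    (mem_closedDomain.2 ⟨hy, Ioo_subset_Icc_self ht⟩)).comp_hasDerivWithinAt t hline
    fun τ hτ => mem_closedDomain.2 ⟨hy, hτ⟩).hasDerivAt (Icc_mem_nhds ht.1 ht.2)

theorem iteratedDeriv_x (hT : 0 < T) (h : SmoothDecay m k T v) (hy : 0 ≤ y) (ht : t ∈ Icc 0 T) :
    iteratedDeriv k (fun ξ => v (ξ, y, t)) = fun ξ => (Dx T)^[k] v (ξ, y, t) := by
  induction k with
  | zero => simp
  | succ k ih =>
    rw [add_comm] at h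
    ext ξ
    rw [iteratedDeriv_succ, ih (h.mono (by omega)), Function.iterate_succ_apply']
    exact ((h.iterate_dirDeriv (n := 0 + 1) hT _).hasDerivAt_x hy ht).deriv

theorem iteratedDeriv_y (hT : 0 < T) (h : SmoothDecay m k T v) (hy : 0 < y) (ht : t ∈ Icc 0 T) :
    iteratedDeriv k (fun η => v (x, η, t)) y = (Dy T)^[k] v (x, y, t) := by
  induction k generalizing y with
  | zero => simp
  | succ k ih =>
    rw [add_comm] at h
    have hev : iteratedDeriv k (fun η => v (x, η, t)) =ᶠ[𝓝 y] fun η => (Dy T)^[k] v (x, η, t) :=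
      eventually_of_mem (Ioi_mem_nhds hy) fun η hη => ih (h.mono (by omega)) hη
    rw [iteratedDeriv_succ, hev.deriv_eq, Function.iterate_succ_apply']
    exact ((h.iterate_dirDeriv (n := 0 + 1) hT _).hasDerivAt_y hy ht).deriv

theorem biLaplacian_eq (hT : 0 < T) (h : SmoothDecay m 4 T v) (hy : 0 < y) (ht : t ∈ Icc 0 T) :
    biLaplacian v x y t = (Dx T)^[4] v (x, y, t) + 2 * (Dx T)^[2] ((Dy T)^[2] v) (x, y, t)
      + (Dy T)^[4] v (x, y, t) := by
  have hyy : (fun ξ => iteratedDeriv 2 (fun η => v (ξ, η, t)) y) =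
      fun ξ => (Dy T)^[2] v (ξ, y, t) :=
    funext fun ξ => (h.mono (by omega)).iteratedDeriv_y hT hy ht
  rw [biLaplacian, h.iteratedDeriv_x hT hy.le ht, hyy,
    (h.iterate_dirDeriv (n := 2) hT _).iteratedDeriv_x hT hy.le ht, h.iteratedDeriv_y hT hy ht]

end SmoothDecay

end Regularity

/-! ### Fourier transformation in `x` -/

/-- The Fourier transform of `v` in `x`, with the sign convention of `xFT`. -/
def xTransform (v : ℝ × ℝ × ℝ → ℂ) (κ y t : ℝ) : ℂ :=
  ∫ x : ℝ, Complex.exp (-Complex.I * x * κ) * v (x, y, t)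

theorem norm_exp_neg_I_mul_ofReal_mul (x κ : ℝ) : ‖Complex.exp (-Complex.I * x * κ)‖ = 1 := by
  simp [Complex.norm_exp]

theorem integrableOn_inv_one_add_pow_three :
    IntegrableOn (fun y : ℝ => ((1 + y) ^ 3)⁻¹) (Ioi 0) := by
  refine (integrableOn_add_rpow_Ioi_of_lt (a := -3) (m := 1) (by norm_num)
    (by norm_num : -(1 : ℝ) < 0)).congr_fun (fun y _ => ?_) measurableSet_Ioi
  simp only [add_comm y 1]
  norm_cast

namespace HasDecay

variable {T κ y t : ℝ} {l : ℂ} {v w : ℝ × ℝ × ℝ → ℂ}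

theorem continuous_exp_mul (h : HasDecay T v) (hy : 0 ≤ y) (ht : t ∈ Icc 0 T) :
    Continuous fun x : ℝ => Complex.exp (-Complex.I * x * κ) * v (x, y, t) :=
  Continuous.mul (by fun_prop) (h.continuousOn.comp_continuous (by fun_prop)
    fun _ => mem_closedDomain.2 ⟨hy, ht⟩)

theorem exists_norm_exp_mul_le (h : HasDecay T v) :
    ∃ C, ∀ x κ y t : ℝ, 0 ≤ y → t ∈ Icc 0 T →
      ‖Complex.exp (-Complex.I * x * κ) * v (x, y, t)‖ ≤ C * ((1 + |x|) ^ 2)⁻¹ := by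
  obtain ⟨C, hC0, hC⟩ := h.exists_norm_le
  refine ⟨C, fun x κ y t hy ht => ?_⟩
  rw [norm_mul, norm_exp_neg_I_mul_ofReal_mul, one_mul]
  exact (hC x y t hy ht).trans (mul_le_of_le_one_right (by positivity)
    (inv_le_one_of_one_le₀ (one_le_pow₀ (by linarith))))

theorem integrable_exp_mul (h : HasDecay T v) (hy : 0 ≤ y) (ht : t ∈ Icc 0 T) :
    Integrable fun x : ℝ => Complex.exp (-Complex.I * x * κ) * v (x, y, t) := by
  obtain ⟨C, hC⟩ := h.exists_norm_exp_mul_le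
  exact (integrable_inv_one_add_abs_sq.const_mul C).mono'
    (h.continuous_exp_mul hy ht).aestronglyMeasurable
    (Eventually.of_forall fun x => hC x κ y t hy ht)

theorem continuousOn_xTransform (h : HasDecay T v) (κ : ℝ) :
    ContinuousOn (fun p : ℝ × ℝ => xTransform v κ p.1 p.2) (Ici 0 ×ˢ Icc 0 T) := by
  obtain ⟨C, hC⟩ := h.exists_norm_exp_mul_le
  exact continuousOn_of_dominated (bound := fun x => C * ((1 + |x|) ^ 2)⁻¹)
    (fun p hp => (h.continuous_exp_mul hp.1 hp.2).aestronglyMeasurable)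
    (fun p hp => Eventually.of_forall fun x => hC x κ p.1 p.2 hp.1 hp.2)
    (integrable_inv_one_add_abs_sq.const_mul C) (Eventually.of_forall fun x =>
      continuousOn_const.mul (h.continuousOn.comp (by fun_prop) fun p hp =>
        mem_closedDomain.2 ⟨hp.1, hp.2⟩))

theorem continuousOn_xTransform_y (h : HasDecay T v) (κ : ℝ) (ht : t ∈ Icc 0 T) :
    ContinuousOn (fun y => xTransform v κ y t) (Ici 0) :=
  ContinuousOn.comp (f := fun y : ℝ => (y, t)) (g := fun p : ℝ × ℝ => xTransform v κ p.1 p.2)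
    (h.continuousOn_xTransform κ) (by fun_prop) fun _ hy => ⟨hy, ht⟩

theorem continuousOn_xTransform_t (h : HasDecay T v) (κ : ℝ) (hy : 0 ≤ y) :
    ContinuousOn (fun t => xTransform v κ y t) (Icc 0 T) :=
  ContinuousOn.comp (f := fun t : ℝ => (y, t)) (g := fun p : ℝ × ℝ => xTransform v κ p.1 p.2)
    (h.continuousOn_xTransform κ) (by fun_prop) fun _ ht => ⟨hy, ht⟩

theorem exists_norm_xTransform_le (h : HasDecay T v) :
    ∃ C, ∀ κ y t : ℝ, 0 ≤ y → t ∈ Icc 0 T → ‖xTransform v κ y t‖ ≤ C * ((1 + y) ^ 3)⁻¹ := by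
  obtain ⟨C, -, hC⟩ := h.exists_norm_le
  refine ⟨C * ∫ x : ℝ, ((1 + |x|) ^ 2)⁻¹, fun κ y t hy ht => ?_⟩
  rw [← integral_const_mul, ← integral_mul_const]
  refine norm_integral_le_of_norm_le
    ((integrable_inv_one_add_abs_sq.const_mul C).mul_const _) (Eventually.of_forall fun x => ?_)
  rw [norm_mul, norm_exp_neg_I_mul_ofReal_mul, one_mul]
  exact hC x y t hy ht

theorem isCubeDecaying_xTransform (h : HasDecay T v) (κ : ℝ) (ht : t ∈ Icc 0 T) :
    IsCubeDecaying fun y => xTransform v κ y t where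
  continuousOn := h.continuousOn_xTransform_y κ ht
  exists_norm_le := h.exists_norm_xTransform_le.imp fun _ hC y hy => hC κ y t hy ht

theorem integrableOn_exp_mul_xTransform (h : HasDecay T v) (κ : ℝ) (ht : t ∈ Icc 0 T)
    (hl : l.im ≤ 0) :
    IntegrableOn (fun y : ℝ => Complex.exp (-Complex.I * y * l) * xTransform v κ y t) (Ioi 0) :=
  integrableOn_exp_neg_I_mul_mul (h.isCubeDecaying_xTransform κ ht).integrableOn hl

theorem continuousOn_halfLineFT_xTransform (h : HasDecay T v) (κ : ℝ) (hl : l.im ≤ 0) :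
    ContinuousOn (fun t => halfLineFT (fun y => xTransform v κ y t) l) (Icc 0 T) := by
  obtain ⟨C, hC⟩ := h.exists_norm_xTransform_le
  exact continuousOn_of_dominated (bound := fun y => C * ((1 + y) ^ 3)⁻¹)
    (fun t ht => (h.integrableOn_exp_mul_xTransform κ ht hl).aestronglyMeasurable)
    (fun t ht => ae_restrict_of_forall_mem measurableSet_Ioi fun y hy =>
      (norm_exp_neg_I_mul_mul_le (le_of_lt hy) hl _).trans (hC κ y t (le_of_lt hy) ht))
    (integrableOn_inv_one_add_pow_three.const_mul C)
    (ae_restrict_of_forall_mem measurableSet_Ioi fun y hy =>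
      continuousOn_const.mul (h.continuousOn_xTransform_t κ (le_of_lt hy)))

theorem hasDerivAt_xTransform_comp (hv : HasDecay T v) (hw : HasDecay T w) (κ : ℝ)
    {γ : ℝ → ℝ × ℝ} {U : Set ℝ} {s : ℝ} (hU : U ∈ 𝓝 s)
    (hγ : ∀ σ ∈ U, 0 ≤ (γ σ).1 ∧ (γ σ).2 ∈ Icc 0 T)
    (hd : ∀ x, ∀ σ ∈ U, HasDerivAt (fun σ => v (x, γ σ)) (w (x, γ σ)) σ) :
    HasDerivAt (fun σ => xTransform v κ (γ σ).1 (γ σ).2) (xTransform w κ (γ s).1 (γ s).2) s := by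
  obtain ⟨C, hC⟩ := hw.exists_norm_exp_mul_le
  have hs := hγ s (mem_of_mem_nhds hU)
  exact (hasDerivAt_integral_of_dominated_loc_of_deriv_le (𝕜 := ℝ)
    (F := fun σ (x : ℝ) => Complex.exp (-Complex.I * x * κ) * v (x, γ σ))
    (F' := fun σ (x : ℝ) => Complex.exp (-Complex.I * x * κ) * w (x, γ σ))
    (bound := fun x => C * ((1 + |x|) ^ 2)⁻¹) hU
    (eventually_of_mem hU fun σ hσ =>
      (hv.continuous_exp_mul (hγ σ hσ).1 (hγ σ hσ).2).aestronglyMeasurable)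
    (hv.integrable_exp_mul hs.1 hs.2) (hw.continuous_exp_mul hs.1 hs.2).aestronglyMeasurable
    (Eventually.of_forall fun x σ hσ => hC x κ (γ σ).1 (γ σ).2 (hγ σ hσ).1 (hγ σ hσ).2)
    (integrable_inv_one_add_abs_sq.const_mul C)
    (Eventually.of_forall fun x σ hσ => (hd x σ hσ).const_mul _)).2

theorem xTransform_deriv_x (hv : HasDecay T v) (hw : HasDecay T w) (κ : ℝ) (hy : 0 ≤ y)
    (ht : t ∈ Icc 0 T) (hd : ∀ x, HasDerivAt (fun ξ => v (ξ, y, t)) (w (x, y, t)) x) :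
    xTransform w κ y t = Complex.I * κ * xTransform v κ y t := by
  have hint : Integrable fun x : ℝ =>
      (-Complex.I * κ * Complex.exp (-Complex.I * x * κ)) * v (x, y, t) := by
    simpa only [mul_assoc] using (hv.integrable_exp_mul hy ht).const_mul (-Complex.I * κ)
  rw [xTransform, integral_mul_deriv_eq_deriv_mul_of_integrable
    (fun x _ => hasDerivAt_exp_neg_I_mul_mul (κ : ℂ) x) (fun x _ => hd x)
    (hw.integrable_exp_mul hy ht) hint (hv.integrable_exp_mul hy ht),
    xTransform, ← integral_const_mul, ← integral_neg]
  simp only [neg_mul, neg_neg, mul_assoc]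

end HasDecay

namespace SmoothDecay

variable {n k : ℕ} {T y t : ℝ} {l : ℂ} {v : ℝ × ℝ × ℝ → ℂ}

theorem hasDerivAt_xTransform_y (hT : 0 < T) (h : SmoothDecay 5 (n + 1) T v) (κ : ℝ) (hy : 0 < y)
    (ht : t ∈ Icc 0 T) :
    HasDerivAt (fun y => xTransform v κ y t) (xTransform (Dy T v) κ y t) y :=
  h.hasDecay.hasDerivAt_xTransform_comp (γ := fun y => (y, t)) (h.dirDeriv hT _).hasDecay κ
    (Ioi_mem_nhds hy) (fun _ hη => ⟨le_of_lt hη, ht⟩) fun _ _ hη => h.hasDerivAt_y hη ht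

theorem hasDerivAt_xTransform_t (hT : 0 < T) (h : SmoothDecay 5 (n + 1) T v) (κ : ℝ) (hy : 0 ≤ y)
    (ht : t ∈ Ioo 0 T) :
    HasDerivAt (fun t => xTransform v κ y t) (xTransform (Dt T v) κ y t) t :=
  h.hasDecay.hasDerivAt_xTransform_comp (γ := fun t => (y, t)) (h.dirDeriv hT _).hasDecay κ
    (Ioo_mem_nhds ht.1 ht.2) (fun _ hτ => ⟨hy, Ioo_subset_Icc_self hτ⟩)
    fun _ _ hτ => h.hasDerivAt_t hy hτ

theorem xTransform_Dx (hT : 0 < T) (h : SmoothDecay 5 (n + 1) T v) (κ : ℝ) (hy : 0 ≤ y)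
    (ht : t ∈ Icc 0 T) : xTransform (Dx T v) κ y t = Complex.I * κ * xTransform v κ y t :=
  h.hasDecay.xTransform_deriv_x (h.dirDeriv hT _).hasDecay κ hy ht fun _ => h.hasDerivAt_x hy ht

theorem xTransform_iterate_Dx (hT : 0 < T) (h : SmoothDecay 5 k T v) (κ : ℝ) (hy : 0 ≤ y)
    (ht : t ∈ Icc 0 T) :
    xTransform ((Dx T)^[k] v) κ y t = (Complex.I * κ) ^ k * xTransform v κ y t := by
  induction k with
  | zero => simp
  | succ k ih =>
    rw [add_comm] at h
    rw [Function.iterate_succ_apply',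
      (h.iterate_dirDeriv (n := 0 + 1) hT _).xTransform_Dx hT κ hy ht,
      ih (h.mono (by omega)), pow_succ', mul_assoc (_ * _)]

theorem hasDerivAt_halfLineFT_xTransform (hT : 0 < T) (h : SmoothDecay 5 (n + 1) T v) (κ : ℝ)
    (ht : t ∈ Ioo 0 T) (hl : l.im ≤ 0) :
    HasDerivAt (fun t => halfLineFT (fun y => xTransform v κ y t) l)
      (halfLineFT (fun y => xTransform (Dt T v) κ y t) l) t := by
  have hw : HasDecay T (Dt T v) := (h.dirDeriv hT _).hasDecay
  obtain ⟨C, hC⟩ := hw.exists_norm_xTransform_le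
  have hIcc := Ioo_subset_Icc_self ht
  exact (hasDerivAt_integral_of_dominated_loc_of_deriv_le (𝕜 := ℝ)
    (F := fun t (y : ℝ) => Complex.exp (-Complex.I * y * l) * xTransform v κ y t)
    (F' := fun t (y : ℝ) => Complex.exp (-Complex.I * y * l) * xTransform (Dt T v) κ y t)
    (bound := fun y => C * ((1 + y) ^ 3)⁻¹) (Ioo_mem_nhds ht.1 ht.2)
    (eventually_of_mem (Ioo_mem_nhds ht.1 ht.2) fun τ hτ =>
      (h.hasDecay.integrableOn_exp_mul_xTransform κ
        (Ioo_subset_Icc_self hτ) hl).aestronglyMeasurable)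
    (h.hasDecay.integrableOn_exp_mul_xTransform κ hIcc hl)
    (hw.integrableOn_exp_mul_xTransform κ hIcc hl).aestronglyMeasurable
    (ae_restrict_of_forall_mem measurableSet_Ioi fun y hy τ hτ =>
      (norm_exp_neg_I_mul_mul_le (le_of_lt hy) hl _).trans
        (hC κ y τ (le_of_lt hy) (Ioo_subset_Icc_self hτ)))
    (integrableOn_inv_one_add_pow_three.const_mul C)
    (ae_restrict_of_forall_mem measurableSet_Ioi fun y hy τ hτ =>
      (h.hasDerivAt_xTransform_t hT κ (le_of_lt hy) hτ).const_mul _)).2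

theorem halfLineFT_xTransform_Dy (hT : 0 < T) (h : SmoothDecay 5 (n + 1) T v) (κ : ℝ)
    (ht : t ∈ Icc 0 T) (hl : l.im ≤ 0) :
    halfLineFT (fun y => xTransform (Dy T v) κ y t) l = -xTransform v κ 0 t
      + Complex.I * l * halfLineFT (fun y => xTransform v κ y t) l :=
  halfLineFT_deriv (h.hasDecay.continuousOn_xTransform_y κ ht)
    (fun _ hy => h.hasDerivAt_xTransform_y hT κ hy ht)
    (h.hasDecay.isCubeDecaying_xTransform κ ht).integrableOn
    ((h.dirDeriv hT _).hasDecay.isCubeDecaying_xTransform κ ht).integrableOn hl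

end SmoothDecay

/-! ### The global relation -/

/-- `u` solves `i uₜ + Δ²u = 0` in `ℝ × (0, ∞) × (0, T)`; no initial or boundary condition is
imposed. -/
def SolvesEquation (T : ℝ) (u : ℝ × ℝ × ℝ → ℂ) : Prop :=
  ∀ x y t : ℝ, 0 < y → 0 < t → t < T →
    Complex.I * deriv (fun τ => u (x, y, τ)) t + biLaplacian u x y t = 0

/-- The boundary combination of the global relation, for the actual boundary values of `u`. -/
def boundaryData (T : ℝ) (u : ℝ × ℝ × ℝ → ℂ) (κ : ℝ) (l : ℂ) (t : ℝ) : ℂ :=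
  boundaryTerm (xTransform u κ 0) (xTransform (Dy T u) κ 0) (xTransform ((Dy T)^[2] u) κ 0)
    (xTransform ((Dy T)^[3] u) κ 0) κ l t

theorem integral_linear_combination {α : Type*} [MeasurableSpace α] {μ : Measure α} {f g h : α → ℂ}
    (hf : Integrable f μ) (hg : Integrable g μ) (hh : Integrable h μ) (a b c : ℂ) :
    ∫ z, (a * f z + b * g z + c * h z) ∂μ =
      a * (∫ z, f z ∂μ) + b * (∫ z, g z ∂μ) + c * ∫ z, h z ∂μ := by
  have hfg : Integrable (fun z => a * f z + b * g z) μ := (hf.const_mul a).add (hg.const_mul b)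
  rw [integral_add hfg (hh.const_mul c), integral_add (hf.const_mul a) (hg.const_mul b),
    integral_const_mul, integral_const_mul, integral_const_mul]

section GlobalRelation

variable {n : ℕ} {T y t : ℝ} {l : ℂ} {u v : ℝ × ℝ × ℝ → ℂ}

theorem SolvesEquation.Dt_eq (hu : SolvesEquation T u) (hT : 0 < T) (h : SmoothDecay n 4 T u)
    (x : ℝ) (hy : 0 < y) (ht : t ∈ Ioo 0 T) :
    Dt T u (x, y, t) = Complex.I * ((Dx T)^[4] u (x, y, t)
      + 2 * (Dx T)^[2] ((Dy T)^[2] u) (x, y, t) + (Dy T)^[4] u (x, y, t)) := by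
  have heq := hu x y t hy ht.1 ht.2
  rw [(h.hasDerivAt_t hy.le ht).deriv, h.biLaplacian_eq hT hy (Ioo_subset_Icc_self ht)] at heq
  linear_combination (-Complex.I) * heq + Dt T u (x, y, t) * Complex.I_sq

theorem SolvesEquation.xTransform_Dt (hu : SolvesEquation T u) (hT : 0 < T)
    (h : SmoothDecay 5 4 T u) (κ : ℝ) (hy : 0 < y) (ht : t ∈ Ioo 0 T) :
    xTransform (Dt T u) κ y t = Complex.I * κ ^ 4 * xTransform u κ y t
      + -(2 * Complex.I * κ ^ 2) * xTransform ((Dy T)^[2] u) κ y t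
      + Complex.I * xTransform ((Dy T)^[4] u) κ y t := by
  have ht' := Ioo_subset_Icc_self ht
  have hyy : SmoothDecay 5 2 T ((Dy T)^[2] u) := h.iterate_dirDeriv (n := 2) hT _
  have hlin : xTransform (Dt T u) κ y t = Complex.I * xTransform ((Dx T)^[4] u) κ y t
      + 2 * Complex.I * xTransform ((Dx T)^[2] ((Dy T)^[2] u)) κ y t
      + Complex.I * xTransform ((Dy T)^[4] u) κ y t := by
    simp only [xTransform]
    rw [← integral_linear_combination
      ((h.iterate_dirDeriv (n := 0) hT _).hasDecay.integrable_exp_mul hy.le ht')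
      ((hyy.iterate_dirDeriv (n := 0) hT _).hasDecay.integrable_exp_mul hy.le ht')
      ((h.iterate_dirDeriv (n := 0) hT _).hasDecay.integrable_exp_mul hy.le ht')]
    congr 1 with x
    rw [hu.Dt_eq hT h x hy ht]
    ring
  rw [hlin, h.xTransform_iterate_Dx hT κ hy.le ht', hyy.xTransform_iterate_Dx hT κ hy.le ht',
    mul_pow, mul_pow, Complex.I_sq, Complex.I_pow_four]
  ring

theorem SmoothDecay.halfLineFT_xTransform_Dy_Dy (hT : 0 < T) (h : SmoothDecay 5 (n + 2) T v)
    (κ : ℝ) (ht : t ∈ Icc 0 T) (hl : l.im ≤ 0) :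
    halfLineFT (fun y => xTransform (Dy T (Dy T v)) κ y t) l = -xTransform (Dy T v) κ 0 t
      - Complex.I * l * xTransform v κ 0 t
      - l ^ 2 * halfLineFT (fun y => xTransform v κ y t) l := by
  rw [(h.dirDeriv hT _).halfLineFT_xTransform_Dy hT κ ht hl,
    h.halfLineFT_xTransform_Dy hT κ ht hl]
  linear_combination l ^ 2 * halfLineFT (fun y => xTransform v κ y t) l * Complex.I_sq

theorem SolvesEquation.halfLineFT_xTransform_Dt (hu : SolvesEquation T u) (hT : 0 < T)
    (h : SmoothDecay 5 4 T u) (κ : ℝ) (ht : t ∈ Ioo 0 T) (hl : l.im ≤ 0) :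
    halfLineFT (fun y => xTransform (Dt T u) κ y t) l =
      -timeExponent κ l * halfLineFT (fun y => xTransform u κ y t) l
        + (-Complex.I * xTransform ((Dy T)^[3] u) κ 0 t + l * xTransform ((Dy T)^[2] u) κ 0 t
          + Complex.I * (l ^ 2 + 2 * (κ : ℂ) ^ 2) * xTransform (Dy T u) κ 0 t
          - l * (l ^ 2 + 2 * (κ : ℂ) ^ 2) * xTransform u κ 0 t) := by
  have ht' := Ioo_subset_Icc_self ht
  have h₂ : SmoothDecay 5 2 T ((Dy T)^[2] u) := h.iterate_dirDeriv (n := 2) hT _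
  have h₄ : SmoothDecay 5 0 T ((Dy T)^[4] u) := h.iterate_dirDeriv (n := 0) hT _
  have hlin : halfLineFT (fun y => xTransform (Dt T u) κ y t) l =
      Complex.I * κ ^ 4 * halfLineFT (fun y => xTransform u κ y t) l
      + -(2 * Complex.I * κ ^ 2) * halfLineFT (fun y => xTransform ((Dy T)^[2] u) κ y t) l
      + Complex.I * halfLineFT (fun y => xTransform ((Dy T)^[4] u) κ y t) l := by
    simp only [halfLineFT]
    rw [← integral_linear_combination (h.hasDecay.integrableOn_exp_mul_xTransform κ ht' hl)
      (h₂.hasDecay.integrableOn_exp_mul_xTransform κ ht' hl)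
      (h₄.hasDecay.integrableOn_exp_mul_xTransform κ ht' hl)]
    refine setIntegral_congr_fun measurableSet_Ioi fun y hy => ?_
    simp only [hu.xTransform_Dt hT h κ hy ht]
    ring
  have htwo : halfLineFT (fun y => xTransform ((Dy T)^[2] u) κ y t) l = _ :=
    h.halfLineFT_xTransform_Dy_Dy hT κ ht' hl
  have hfour : halfLineFT (fun y => xTransform ((Dy T)^[4] u) κ y t) l =
      -xTransform ((Dy T)^[3] u) κ 0 t - _ - _ := h₂.halfLineFT_xTransform_Dy_Dy hT κ ht' hl
  rw [hlin, hfour, htwo, timeExponent]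
  linear_combination l * xTransform ((Dy T)^[2] u) κ 0 t * -Complex.I_sq
    - l * (l ^ 2 + 2 * κ ^ 2) * xTransform u κ 0 t * -Complex.I_sq

theorem HasDecay.continuousOn_xTransform_zero (hv : HasDecay T v) (κ : ℝ) (ht : t ∈ Ioo 0 T) :
    ContinuousOn (xTransform v κ 0) (Icc 0 t) :=
  (hv.continuousOn_xTransform_t κ le_rfl).mono (Icc_subset_Icc_right ht.2.le)

theorem SolvesEquation.global_relation (hu : SolvesEquation T u) (hT : 0 < T)
    (h : SmoothDecay 5 4 T u) (κ : ℝ) (ht : t ∈ Ioo 0 T) (hl : l.im ≤ 0) :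
    Complex.exp (timeExponent κ l * t) * halfLineFT (fun y => xTransform u κ y t) l
      - halfLineFT (fun y => xTransform u κ y 0) l = boundaryData T u κ l t := by
  set η := timeExponent κ l
  have hderiv : ∀ τ ∈ Ioo 0 t, HasDerivAt
      (fun τ : ℝ => Complex.exp (η * τ) * halfLineFT (fun y => xTransform u κ y τ) l)
      (Complex.exp (η * τ) * (-Complex.I * xTransform ((Dy T)^[3] u) κ 0 τ
        + l * xTransform ((Dy T)^[2] u) κ 0 τ
        + Complex.I * (l ^ 2 + 2 * (κ : ℂ) ^ 2) * xTransform (Dy T u) κ 0 τ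
        - l * (l ^ 2 + 2 * (κ : ℂ) ^ 2) * xTransform u κ 0 τ)) τ := fun τ hτ => by
    have hτT : τ ∈ Ioo 0 T := ⟨hτ.1, hτ.2.trans ht.2⟩
    refine ((hasDerivAt_exp_mul_ofReal η τ).mul
      (h.hasDerivAt_halfLineFT_xTransform hT κ hτT hl)).congr_deriv ?_
    rw [hu.halfLineFT_xTransform_Dt hT h κ hτT hl]
    ring
  have hcont := continuousOn_exp_mul
    ((h.hasDecay.continuousOn_halfLineFT_xTransform κ hl).mono (Icc_subset_Icc_right ht.2.le)) η
  have hc₀ := h.hasDecay.continuousOn_xTransform_zero κ ht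
  have hc₁ := (h.dirDeriv hT (0, 1, 0)).hasDecay.continuousOn_xTransform_zero κ ht
  have hc₂ := (h.iterate_dirDeriv (n := 2) (k := 2) hT
    (0, 1, 0)).hasDecay.continuousOn_xTransform_zero κ ht
  have hc₃ := (h.iterate_dirDeriv (n := 1) (k := 3) hT
    (0, 1, 0)).hasDecay.continuousOn_xTransform_zero κ ht
  rw [boundaryData, boundaryTerm_eq_integral ht.1.le hc₀ hc₁ hc₂ hc₃,
    intervalIntegral.integral_eq_sub_of_hasDerivAt_of_le ht.1.le hcont hderiv
      (ContinuousOn.intervalIntegrable_of_Icc ht.1.le (continuousOn_exp_mul (by fun_prop) η))]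
  simp

theorem SmoothDecay.isC1Data (hT : 0 < T) (h : SmoothDecay 5 (n + 1) T v) (κ : ℝ)
    (ht : t ∈ Ioo 0 T) : IsC1Data t (xTransform v κ 0) (xTransform (Dt T v) κ 0) where
  continuousOn := h.hasDecay.continuousOn_xTransform_zero κ ht
  continuousOn_deriv := (h.dirDeriv hT _).hasDecay.continuousOn_xTransform_zero κ ht
  hasDerivAt _ hτ := h.hasDerivAt_xTransform_t hT κ le_rfl ⟨hτ.1, hτ.2.trans ht.2⟩

theorem SmoothDecay.isDecaying_boundaryData (hT : 0 < T) (h : SmoothDecay 5 4 T u)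
    (κ x y : ℝ) (ht : t ∈ Ioo 0 T) :
    IsDecaying y (boundedRegion κ) (fun l => E κ l x y t * boundaryData T u κ l t) :=
  isDecaying_boundaryTerm ht.1.le (h.isC1Data hT κ ht)
    ((h.dirDeriv hT (0, 1, 0)).isC1Data hT κ ht)
    ((h.iterate_dirDeriv (n := 2) (k := 2) hT (0, 1, 0)).isC1Data hT κ ht)
    ((h.iterate_dirDeriv (n := 1) (k := 3) hT (0, 1, 0)).isC1Data hT κ ht) κ x y

end GlobalRelation

/-! ### The integrand on the contour -/

section Exponent

variable (κ : ℝ) (l : ℂ)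

theorem timeExponent_neg : timeExponent κ (-l) = timeExponent κ l := by
  rw [timeExponent, timeExponent, neg_sq]

variable {κ l}

theorem timeExponent_of_sq {ν : ℂ} (hν : ν ^ 2 = -l ^ 2 - 2 * (κ : ℂ) ^ 2) :
    timeExponent κ ν = timeExponent κ l := by
  rw [timeExponent, timeExponent, hν]
  ring

theorem sub_ne_zero_of_sq {ν : ℂ} (hν : ν ^ 2 = -l ^ 2 - 2 * (κ : ℂ) ^ 2) (hl : 0 ≤ l.im)
    (hne : l ≠ |κ| * Complex.I) : ν - l ≠ 0 := by
  intro hνl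
  have habs : ((|κ| : ℝ) : ℂ) ^ 2 = (κ : ℂ) ^ 2 := by exact_mod_cast sq_abs κ
  have hsq : l ^ 2 = (|κ| * Complex.I) ^ 2 := by
    rw [mul_pow, Complex.I_sq, habs]
    linear_combination hν / 2 - (ν + l) / 2 * hνl
  have hneg : l = -(|κ| * Complex.I) := (sq_eq_sq_iff_eq_or_eq_neg.1 hsq).resolve_left hne
  have hκ : |κ| = 0 := by
    have him : l.im = -|κ| := by simp [hneg]
    linarith [abs_nonneg κ]
  exact hne (by simp [hneg, hκ])

theorem E_mul_exp_timeExponent (κ : ℝ) (l : ℂ) (x y t : ℝ) :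
    E κ l x y t * Complex.exp (timeExponent κ l * t) =
      Complex.exp (Complex.I * κ * x) * Complex.exp (Complex.I * l * y) := by
  rw [E_eq_mul_exp_timeExponent, mul_assoc, ← Complex.exp_add (-timeExponent κ l * t),
    neg_mul, neg_add_cancel, Complex.exp_zero, mul_one]

end Exponent

/-- `hrel_l` and `hrel_ν` are the global relations at `-l` and `-ν`, where the time exponent has the
same value: they determine the unknown boundary values `T₂` and `T₃`. The terms with `e` collect
into a divided difference `S`, which removes the pole at `ν = l`. -/
theorem eliminate_boundary_values {l ν k e U U' V V' S T₀ T₁ T₂ T₃ : ℂ} (hne : ν - l ≠ 0)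
    (hν : ν ^ 2 = -l ^ 2 - 2 * k ^ 2)
    (hrel_l : e * U - U' = -Complex.I * T₃ + -l * T₂ + Complex.I * ((-l) ^ 2 + 2 * k ^ 2) * T₁
      - -l * ((-l) ^ 2 + 2 * k ^ 2) * T₀)
    (hrel_ν : e * V - V' = -Complex.I * T₃ + -ν * T₂ + Complex.I * ((-ν) ^ 2 + 2 * k ^ 2) * T₁
      - -ν * ((-ν) ^ 2 + 2 * k ^ 2) * T₀)
    (hS : (-ν - -l) * S = V - U) :
    (2 * l / (ν - l) * V' - (l + ν) / (ν - l) * U')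
      + (2 * (l ^ 2 * ν + l * ν ^ 2) * T₀ + 2 * Complex.I * (l ^ 2 + l * ν) * T₁) =
    (-Complex.I * T₃ + l * T₂ + Complex.I * (l ^ 2 + 2 * k ^ 2) * T₁
      - l * (l ^ 2 + 2 * k ^ 2) * T₀) - e * (U + 2 * l * S) := by
  have hk : 2 * k ^ 2 = -l ^ 2 - ν ^ 2 := by linear_combination hν
  rw [hk] at hrel_l hrel_ν ⊢
  have hU : U' = e * U - (-Complex.I * T₃ + -l * T₂ + Complex.I * ((-l) ^ 2 + (-l ^ 2 - ν ^ 2)) * T₁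
      - -l * ((-l) ^ 2 + (-l ^ 2 - ν ^ 2)) * T₀) := by linear_combination -hrel_l
  have hV : V' = e * V - (-Complex.I * T₃ + -ν * T₂ + Complex.I * ((-ν) ^ 2 + (-l ^ 2 - ν ^ 2)) * T₁
      - -ν * ((-ν) ^ 2 + (-l ^ 2 - ν ^ 2)) * T₀) := by linear_combination -hrel_ν
  have hVU : V = U + (-ν - -l) * S := by linear_combination -hS
  rw [hU, hV, hVU]
  field_simp
  ring

section Integrand

variable {T t ε κ : ℝ} {l : ℂ} {u₀ g₀ g₁ : ℝ → ℝ → ℂ} {u v : ℝ × ℝ × ℝ → ℂ}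

theorem HasDecay.integrable_prod (h : HasDecay T v) (κ : ℝ) (ht : t ∈ Icc 0 T)
    (hl : l.im ≤ 0) :
    Integrable (fun p : ℝ × ℝ => Complex.exp (-Complex.I * p.1 * κ - Complex.I * p.2 * l) *
      v (p.1, p.2, t)) (volume.prod (volume.restrict (Ioi 0))) := by
  obtain ⟨C, -, hC⟩ := h.exists_norm_le
  have hprod : (volume : Measure ℝ).prod (volume.restrict (Ioi (0 : ℝ))) =
      (volume.prod volume).restrict (univ ×ˢ Ioi 0) := by
    rw [← Measure.prod_restrict, Measure.restrict_univ]
  have hmeas : MeasurableSet ((univ : Set ℝ) ×ˢ Ioi (0 : ℝ)) :=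
    MeasurableSet.univ.prod measurableSet_Ioi
  refine ((integrable_inv_one_add_abs_sq.const_mul C).mul_prod
    integrableOn_inv_one_add_pow_three).mono' ?_ ?_ <;> rw [hprod]
  · exact ((Continuous.continuousOn (by fun_prop)).mul (h.continuousOn.comp (by fun_prop)
      fun p hp => mem_closedDomain.2 ⟨le_of_lt hp.2, ht⟩)).aestronglyMeasurable hmeas
  · refine ae_restrict_of_forall_mem hmeas fun p hp => ?_
    rw [sub_eq_add_neg, Complex.exp_add, mul_assoc, norm_mul, norm_exp_neg_I_mul_ofReal_mul,
      one_mul, ← neg_mul, ← neg_mul]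
    exact (norm_exp_neg_I_mul_mul_le (le_of_lt hp.2) hl _).trans
      (hC p.1 p.2 t (le_of_lt hp.2) ht)

theorem halfSpaceFT_eq_halfLineFT (hT : 0 ≤ T) (h : HasDecay T u)
    (hu₀ : ∀ x y : ℝ, 0 < y → u (x, y, 0) = u₀ x y) (κ : ℝ) (hl : l.im ≤ 0) :
    halfSpaceFT u₀ κ l = halfLineFT (fun y => xTransform u κ y 0) l := by
  have hcongr : halfSpaceFT u₀ κ l = ∫ x : ℝ, ∫ y in Ioi (0 : ℝ),
      Complex.exp (-Complex.I * x * κ - Complex.I * y * l) * u (x, y, 0) := by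
    rw [halfSpaceFT]
    congr 1 with x
    exact setIntegral_congr_fun measurableSet_Ioi fun y hy => by rw [hu₀ x y hy]
  rw [hcongr, integral_integral_swap (h.integrable_prod κ ⟨le_rfl, hT⟩ hl), halfLineFT]
  congr 1 with y
  rw [xTransform, ← integral_const_mul]
  congr 1 with x
  rw [← mul_assoc, ← Complex.exp_add]
  congr 2
  ring

theorem tTransform_eq_timeFT {g : ℝ → ℝ → ℂ}
    (hg : ∀ x t : ℝ, 0 < t → t < T → v (x, 0, t) = g x t) (κ : ℝ) (η : ℂ)
    (ht : t ∈ Ioo 0 T) : tTransform g κ η t = timeFT (xTransform v κ 0) η t := by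
  refine intervalIntegral.integral_congr_uIoo fun τ hτ => ?_
  rw [uIoo_of_le ht.1.le] at hτ
  simp only [xFT, xTransform, fun x => hg x τ hτ.1 (hτ.2.trans ht.2)]

theorem IsSolution.Dy_eq_neumann (hu : IsSolution T u₀ g₀ g₁ u) {m n : ℕ}
    (h : SmoothDecay m (n + 1) T u) (x : ℝ) (ht : t ∈ Ioo 0 T) : Dy T u (x, 0, t) = g₁ x t := by
  rw [← hu.neumann x t ht.1 ht.2]
  exact ((h.hasDerivWithinAt_y le_rfl (Ioo_subset_Icc_self ht)).derivWithin
    (uniqueDiffOn_Ici 0 0 self_mem_Ici)).symm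

theorem IsSolution.G_eq (hu : IsSolution T u₀ g₀ g₁ u) (hT : 0 < T) (h : SmoothDecay 5 4 T u)
    (ht : t ∈ Ioo 0 T) (hsq : nu ε κ l ^ 2 = -l ^ 2 - 2 * (κ : ℂ) ^ 2)
    (hνi : 0 ≤ (nu ε κ l).im) (hl : 0 ≤ l.im) (hne : l ≠ |κ| * Complex.I) :
    G ε u₀ g₀ g₁ κ l t = boundaryData T u κ l t - Complex.exp (timeExponent κ l * t) *
      (halfLineFT (fun y => xTransform u κ y t) (-l)
        + 2 * l * ftSlope (fun y => xTransform u κ y t) (-l, -nu ε κ l)) := by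
  have hpde : SolvesEquation T u := hu.pde
  have hl' : (-l).im ≤ 0 := by simpa using hl
  have hνi' : (-nu ε κ l).im ≤ 0 := by simpa using hνi
  have hrel := hpde.global_relation hT h κ ht hl'
  have hrel' := hpde.global_relation hT h κ ht hνi'
  simp only [boundaryData, boundaryTerm, timeExponent_neg, timeExponent_of_sq hsq] at hrel hrel'
  have hcube := h.hasDecay.isCubeDecaying_xTransform κ (Ioo_subset_Icc_self ht)
  have helim := eliminate_boundary_values (sub_ne_zero_of_sq hsq hl hne) hsq hrel hrel'
    (mul_ftSlope hcube.integrableOn hcube.integrableOn_momentFun hl' hνi')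
  rw [boundaryData, boundaryTerm, ← helim, G, ← timeExponent,
    halfSpaceFT_eq_halfLineFT hT.le h.hasDecay hu.initial κ hl',
    halfSpaceFT_eq_halfLineFT hT.le h.hasDecay hu.initial κ hνi',
    tTransform_eq_timeFT hu.dirichlet κ _ ht,
    tTransform_eq_timeFT (fun x t h₀ hT => hu.Dy_eq_neumann h x ⟨h₀, hT⟩) κ _ ht]

theorem IsSolution.E_mul_G_eq (hu : IsSolution T u₀ g₀ g₁ u) (hT : 0 < T)
    (h : SmoothDecay 5 4 T u) (x y : ℝ) (ht : t ∈ Ioo 0 T) {S : Set ℂ} {ν : ℂ → ℂ}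
    (hS : IsRootBranch κ S ν) (hlS : l ∈ S) (hν : nu ε κ l = ν l) (hl : 0 ≤ l.im)
    (hne : l ≠ |κ| * Complex.I) :
    E κ l x y t * G ε u₀ g₀ g₁ κ l t = E κ l x y t * boundaryData T u κ l t
      - Complex.exp (Complex.I * κ * x) * Complex.exp (Complex.I * l * y) *
        (halfLineFT (fun y => xTransform u κ y t) (-l)
          + 2 * l * ftSlope (fun y => xTransform u κ y t) (-l, -ν l)) := by
  rw [hu.G_eq hT h ht (by rw [hν, hS.sq_eq l hlS]) (by rw [hν]; exact hS.im_nonneg l hlS) hl hne,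
    mul_sub, ← mul_assoc, E_mul_exp_timeExponent, hν]

end Integrand

/-! ### Decay in `κ` -/

theorem IsCubeDecaying.integral_norm_le_and_integral_norm_momentFun_le {f : ℝ → ℂ}
    (h : IsCubeDecaying f) {C : ℝ} (hC : ∀ y, 0 < y → ‖f y‖ ≤ C * ((1 + y) ^ 3)⁻¹) :
    ∫ y in Ioi (0 : ℝ), ‖f y‖ ≤ C * ∫ y in Ioi (0 : ℝ), ((1 + |y|) ^ 2)⁻¹ ∧
      ∫ y in Ioi (0 : ℝ), ‖momentFun f y‖ ≤ C * ∫ y in Ioi (0 : ℝ), ((1 + |y|) ^ 2)⁻¹ := by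
  have hmajorant : IntegrableOn (fun y : ℝ => C * ((1 + |y|) ^ 2)⁻¹) (Ioi 0) :=
    (integrable_inv_one_add_abs_sq.const_mul _).integrableOn
  have hweight : ∀ y : ℝ, 0 < y → (1 + y) * ‖f y‖ ≤ C * ((1 + |y|) ^ 2)⁻¹ := fun y hy => by
    rw [abs_of_pos hy]
    calc (1 + y) * ‖f y‖ ≤ (1 + y) * (C * ((1 + y) ^ 3)⁻¹) :=
          mul_le_mul_of_nonneg_left (hC y hy) (by positivity)
      _ = C * ((1 + y) ^ 2)⁻¹ := by field_simp
  rw [← integral_const_mul]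
  constructor
  · refine setIntegral_mono_on h.integrableOn.norm hmajorant measurableSet_Ioi fun y hy => ?_
    have hy : 0 < y := hy
    exact (le_mul_of_one_le_left (norm_nonneg _) (by linarith)).trans (hweight y hy)
  · refine setIntegral_mono_on h.integrableOn_momentFun.norm hmajorant measurableSet_Ioi
      fun y hy => ?_
    have hy : 0 < y := hy
    rw [norm_momentFun hy.le]
    exact (mul_le_mul_of_nonneg_right (by linarith) (norm_nonneg _)).trans (hweight y hy)

section Frequency

variable {n : ℕ} {T y t : ℝ} {u v : ℝ × ℝ × ℝ → ℂ}

theorem HasDecay.continuous_xTransform_freq (h : HasDecay T v) (hy : 0 ≤ y) (ht : t ∈ Icc 0 T) :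
    Continuous fun κ => xTransform v κ y t := by
  obtain ⟨C, hC⟩ := h.exists_norm_exp_mul_le
  exact continuous_of_dominated (bound := fun x => C * ((1 + |x|) ^ 2)⁻¹)
    (fun κ => (h.continuous_exp_mul hy ht).aestronglyMeasurable)
    (fun κ => Eventually.of_forall fun x => hC x κ y t hy ht)
    (integrable_inv_one_add_abs_sq.const_mul C) (Eventually.of_forall fun x => by fun_prop)

theorem HasDecay.continuous_halfLineFT_xTransform_freq (h : HasDecay T v) (ht : t ∈ Icc 0 T) :
    Continuous fun p : ℝ × ℝ => halfLineFT (fun y => xTransform v p.1 y t) (p.2 : ℂ) := by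
  obtain ⟨C, hC⟩ := h.exists_norm_xTransform_le
  exact continuous_of_dominated (bound := fun y => C * ((1 + y) ^ 3)⁻¹)
    (fun p => (h.integrableOn_exp_mul_xTransform p.1 ht (by simp)).aestronglyMeasurable)
    (fun p => ae_restrict_of_forall_mem measurableSet_Ioi fun y hy =>
      (norm_exp_neg_I_mul_mul_le (le_of_lt hy) (by simp) _).trans (hC p.1 y t (le_of_lt hy) ht))
    (integrableOn_inv_one_add_pow_three.const_mul C)
    (ae_restrict_of_forall_mem measurableSet_Ioi fun y hy =>
      Continuous.mul (by fun_prop)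
        ((h.continuous_xTransform_freq (le_of_lt hy) ht).comp continuous_fst))

theorem SmoothDecay.exists_norm_xTransform_le_inv_one_add_sq (hT : 0 < T)
    (h : SmoothDecay 5 (n + 2) T u) :
    ∃ C, ∀ κ y t : ℝ, 0 ≤ y → t ∈ Icc 0 T →
      ‖xTransform u κ y t‖ ≤ C * (1 + κ ^ 2)⁻¹ * ((1 + y) ^ 3)⁻¹ := by
  have hxx : SmoothDecay 5 n T ((Dx T)^[2] u) := h.iterate_dirDeriv (k := 2) hT _
  obtain ⟨C, hC⟩ := h.hasDecay.exists_norm_xTransform_le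
  obtain ⟨C', hC'⟩ := hxx.hasDecay.exists_norm_xTransform_le
  refine ⟨C + C', fun κ y t hy ht => ?_⟩
  have hsq : ‖xTransform ((Dx T)^[2] u) κ y t‖ = κ ^ 2 * ‖xTransform u κ y t‖ := by
    rw [(h.mono (Nat.le_add_left 2 n)).xTransform_iterate_Dx hT κ hy ht, norm_mul, norm_pow,
      norm_mul, Complex.norm_I, one_mul, Complex.norm_real, Real.norm_eq_abs, sq_abs]
  have hsum : (1 + κ ^ 2) * ‖xTransform u κ y t‖ ≤ (C + C') * ((1 + y) ^ 3)⁻¹ := by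
    rw [add_mul, add_mul, one_mul, ← hsq]
    exact add_le_add (hC κ y t hy ht) (hC' κ y t hy ht)
  rw [mul_right_comm, ← div_eq_mul_inv, le_div_iff₀ (by positivity), mul_comm]
  exact hsum

theorem SmoothDecay.integrable_xTransform_freq (hT : 0 < T) (h : SmoothDecay 5 (n + 2) T u)
    (hy : 0 ≤ y) (ht : t ∈ Icc 0 T) : Integrable fun κ => xTransform u κ y t := by
  obtain ⟨C, hC⟩ := h.exists_norm_xTransform_le_inv_one_add_sq hT
  exact ((integrable_inv_one_add_sq.const_mul C).mul_const ((1 + y) ^ 3)⁻¹).mono'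
    (h.hasDecay.continuous_xTransform_freq hy ht).aestronglyMeasurable
    (Eventually.of_forall fun κ => hC κ y t hy ht)

theorem SmoothDecay.integrable_exp_mul_xTransform (hT : 0 < T) (h : SmoothDecay 5 (n + 2) T u)
    (x : ℝ) (hy : 0 ≤ y) (ht : t ∈ Icc 0 T) :
    Integrable fun κ : ℝ => Complex.exp (Complex.I * κ * x) * xTransform u κ y t :=
  (h.integrable_xTransform_freq hT hy ht).bdd_mul (c := 1)
    (Continuous.aestronglyMeasurable (by fun_prop))
    (Eventually.of_forall fun κ => (norm_exp_I_mul_ofReal_mul κ x).le)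

theorem SmoothDecay.integral_exp_mul_xTransform (hT : 0 < T) (h : SmoothDecay 5 (n + 2) T u)
    (x : ℝ) (hy : 0 ≤ y) (ht : t ∈ Icc 0 T) :
    ∫ κ : ℝ, Complex.exp (Complex.I * κ * x) * xTransform u κ y t =
      2 * Real.pi * u (x, y, t) :=
  fourier_inversion_angular (g := fun x => u (x, y, t))
    (by simpa using h.hasDecay.integrable_exp_mul (κ := 0) hy ht)
    (h.integrable_xTransform_freq hT hy ht)
    (by simpa using (h.hasDecay.continuous_exp_mul (κ := 0) hy ht).continuousAt)

theorem SmoothDecay.exists_integral_norm_xTransform_le (hT : 0 < T)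
    (h : SmoothDecay 5 (n + 2) T u) (ht : t ∈ Icc 0 T) :
    ∃ M, ∀ κ : ℝ, ∫ y in Ioi (0 : ℝ), ‖xTransform u κ y t‖ ≤ M * (1 + κ ^ 2)⁻¹ ∧
      ∫ y in Ioi (0 : ℝ), ‖momentFun (fun y => xTransform u κ y t) y‖ ≤ M * (1 + κ ^ 2)⁻¹ := by
  obtain ⟨C, hC⟩ := h.exists_norm_xTransform_le_inv_one_add_sq hT
  refine ⟨C * ∫ y in Ioi (0 : ℝ), ((1 + |y|) ^ 2)⁻¹, fun κ => ?_⟩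
  rw [mul_right_comm]
  exact (h.hasDecay.isCubeDecaying_xTransform κ
    ht).integral_norm_le_and_integral_norm_momentFun_le fun y hy => hC κ y t hy.le ht

end Frequency

/-! ### The integrals of the representation formula -/

theorem HasCurveIntegral.congr {γ : ℝ → ℂ} {F₁ F₂ : ℂ → ℂ} {I : ℂ}
    (hI : HasCurveIntegral γ F₁ I) (h : ∀ s, F₁ (γ s) = F₂ (γ s)) : HasCurveIntegral γ F₂ I := by
  simpa only [HasCurveIntegral, h] using hI

theorem HasRealLineIntegral.congr {F₁ F₂ : ℂ → ℂ} {I : ℂ} (hI : HasRealLineIntegral F₁ I)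
    (h : ∀ s : ℝ, F₁ s = F₂ s) : HasRealLineIntegral F₂ I := by
  obtain ⟨I₁, I₂, h₁, h₂, e⟩ := hI
  exact ⟨I₁, I₂, h₁.congr fun s => by simpa [negAxis] using h (-s), h₂.congr h, e⟩

theorem measurable_of_hasRealLineIntegral {F : ℝ → ℂ → ℂ} {A : ℝ → ℂ}
    (hF : Continuous fun p : ℝ × ℝ => F p.1 p.2) (h : ∀ κ, HasRealLineIntegral (F κ) (A κ)) :
    Measurable A := by
  have hneg : Continuous fun p : ℝ × ℝ => F p.1 (-p.2) := by
    simpa [Function.comp_def] using hF.comp (continuous_fst.prodMk continuous_snd.neg)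
  have hcont : ∀ n : ℕ, Continuous fun κ : ℝ =>
      (∫ s in (0 : ℝ)..n, F κ (-s)) + ∫ s in (0 : ℝ)..n, F κ s := fun n =>
    (intervalIntegral.continuous_parametric_intervalIntegral_of_continuous' hneg _ _).add
      (intervalIntegral.continuous_parametric_intervalIntegral_of_continuous' hF _ _)
  refine measurable_of_tendsto_metrizable (fun n => (hcont n).measurable)
    (tendsto_pi_nhds.2 fun κ => ?_)
  obtain ⟨I₁, I₂, h₁, h₂, hA⟩ := h κ
  rw [hA]
  refine (((h₁.2.neg).add h₂.2).comp tendsto_natCast_atTop_atTop).congr fun n => ?_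
  simp only [Function.comp_def, deriv_negAxis, deriv_ofReal, mul_neg, mul_one, negAxis,
    intervalIntegral.integral_neg, neg_neg]

section Representation

variable {n : ℕ} {T y t ε : ℝ} {u₀ g₀ g₁ : ℝ → ℝ → ℂ} {u : ℝ × ℝ × ℝ → ℂ}

theorem SmoothDecay.exists_initial_integral (hT : 0 < T) (h : SmoothDecay 5 (n + 2) T u)
    (x y : ℝ) (ht : 0 < t) : ∃ A : ℝ → ℂ, (∀ κ, HasRealLineIntegral
      (fun l => E κ l x y t * halfLineFT (fun y => xTransform u κ y 0) l) (A κ)) ∧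
      Integrable A := by
  have h₀ : (0 : ℝ) ∈ Icc 0 T := ⟨le_rfl, hT.le⟩
  obtain ⟨M, hM⟩ := h.exists_integral_norm_xTransform_le hT h₀
  have hcube := fun κ => h.hasDecay.isCubeDecaying_xTransform κ h₀
  choose A hA hA' using fun κ => exists_hasRealLineIntegral ht κ x y (hcube κ).integrableOn
    (hcube κ).integrableOn_momentFun (hM κ).1 (hM κ).2
  have hE : Continuous fun p : ℝ × ℝ => E p.1 p.2 x y t := by
    unfold E
    fun_prop
  have hmeas : Measurable A := measurable_of_hasRealLineIntegral
    (hE.mul (h.hasDecay.continuous_halfLineFT_xTransform_freq h₀)) hA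
  exact ⟨A, hA, ((integrable_inv_one_add_sq.const_mul M).mul_const _).mono'
    hmeas.aestronglyMeasurable (Eventually.of_forall hA')⟩

theorem SmoothDecay.isC2Decaying (hT : 0 < T) (h : SmoothDecay 5 (n + 2) T u) (κ : ℝ)
    (ht : t ∈ Icc 0 T) :
    IsC2Decaying (fun y => xTransform u κ y t) (fun y => xTransform (Dy T u) κ y t)
      (fun y => xTransform (Dy T (Dy T u)) κ y t) where
  decaying := h.hasDecay.isCubeDecaying_xTransform κ ht
  decaying_deriv := (h.dirDeriv hT _).hasDecay.isCubeDecaying_xTransform κ ht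
  decaying_deriv₂ := ((h.dirDeriv hT _).dirDeriv hT _).hasDecay.isCubeDecaying_xTransform κ ht
  hasDerivAt _ hy := h.hasDerivAt_xTransform_y hT κ hy ht
  hasDerivAt_deriv _ hy := (h.dirDeriv hT _).hasDerivAt_xTransform_y hT κ hy ht

theorem SolvesEquation.E_mul_boundaryData (hu : SolvesEquation T u) (hT : 0 < T)
    (h : SmoothDecay 5 4 T u) (κ x y : ℝ) (ht : t ∈ Ioo 0 T) {l : ℂ} (hl : l.im ≤ 0) :
    E κ l x y t * boundaryData T u κ l t =
      Complex.exp (Complex.I * κ * x) * Complex.exp (Complex.I * l * y) *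
        halfLineFT (fun y => xTransform u κ y t) l
      - E κ l x y t * halfLineFT (fun y => xTransform u κ y 0) l := by
  rw [← hu.global_relation hT h κ ht hl, mul_sub, ← mul_assoc, E_mul_exp_timeExponent]

theorem SmoothDecay.isDecaying_reflected (hT : 0 < T) (h : SmoothDecay 5 (n + 2) T u) {κ : ℝ}
    (ht : t ∈ Icc 0 T) {S : Set ℂ} {ν : ℂ → ℂ} (hν : IsRootBranch κ S ν)
    (hS : S ⊆ {l | 0 ≤ l.im}) (x y : ℝ) :
    IsDecaying y S fun l => Complex.exp (Complex.I * κ * x) * Complex.exp (Complex.I * l * y) *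
      (halfLineFT (fun y => xTransform u κ y t) (-l)
        + 2 * l * ftSlope (fun y => xTransform u κ y t) (-l, -ν l)) :=
  have hC := h.isC2Decaying hT κ ht
  hν.isDecaying_halfLineFT y hS hC.decaying.continuousOn hC.hasDerivAt hC.decaying.integrableOn
    hC.decaying_deriv.integrableOn hC.decaying.integrableOn_momentFun _

theorem IsSolution.hasBoundaryIntegral (hu : IsSolution T u₀ g₀ g₁ u) (hT : 0 < T)
    (h : SmoothDecay 5 4 T u) (hε : 0 < ε) (hε' : ε < Real.pi / 4) {κ : ℝ} (x : ℝ) (hy : 0 < y)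
    (ht : t ∈ Ioo 0 T) {A : ℂ} (hA : HasRealLineIntegral
      (fun l => E κ l x y t * halfLineFT (fun y => xTransform u κ y 0) l) A) :
    HasBoundaryIntegral κ (fun l => E κ l x y t * G ε u₀ g₀ g₁ κ l t)
        (2 * Real.pi * (Complex.exp (Complex.I * κ * x) * xTransform u κ y t) - A) ∧
      HasAsymptoticBoundaryIntegral κ (fun l => E κ l x y t * G ε u₀ g₀ g₁ κ l t)
        (2 * Real.pi * (Complex.exp (Complex.I * κ * x) * xTransform u κ y t) - A) := by
  have hpde : SolvesEquation T u := hu.pde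
  have hIcc := Ioo_subset_Icc_self ht
  have hreal := fun s : ℝ => (hpde.E_mul_boundaryData hT h κ x y ht (l := s) (by simp)).symm
  obtain ⟨A₁, A₂, hA₁, hA₂, rfl⟩ := hA
  obtain ⟨V₁, V₂, hV₁, hV₂, hV⟩ :=
    (h.isC2Decaying hT κ hIcc).hasRealLineIntegral (Complex.exp (Complex.I * κ * x)) hy
  have hneg : HasCurveIntegral negAxis (fun l => E κ l x y t * boundaryData T u κ l t) (V₁ - A₁) :=
    (hV₁.sub hA₁).congr fun s => by simpa [negAxis] using hreal (-s)
  obtain ⟨I, hI, hboundary⟩ := exists_hasBoundaryIntegral hy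
    (h.isDecaying_boundaryData hT κ x y ht)
    (h.isDecaying_reflected hT hIcc (isRootBranch_leftRoot κ) (fun l hl => hl.2) x y)
    (h.isDecaying_reflected hT hIcc (isRootBranch_rightRoot κ) (fun l hl => hl.2) x y)
    (fun l hl hne => hu.E_mul_G_eq hT h x y ht (isRootBranch_leftRoot κ) hl.1
      (nu_eq_leftRoot hε hε' hl) hl.1.2 hne)
    (fun l hl hne => hu.E_mul_G_eq hT h x y ht (isRootBranch_rightRoot κ) hl
      (nu_eq_rightRoot hε hε' hl) hl.2 hne)
    hneg
  have hpos : I = V₂ - A₂ := hI.unique ((hV₂.sub hA₂).congr hreal)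
  have hsum : -(V₁ - A₁) + I =
      2 * Real.pi * (Complex.exp (Complex.I * κ * x) * xTransform u κ y t) - (-A₁ + A₂) := by
    rw [hpos]
    linear_combination -hV
  rwa [hsum] at hboundary

end Representation

end BiharmonicSchrodinger

end

theorem mainTheorem1 :
    ∃ N : ℕ, ∀ (T : ℝ) (u₀ g₀ g₁ : ℝ → ℝ → ℂ) (u : ℝ × ℝ × ℝ → ℂ) (ε : ℝ),
      0 < T → 0 < ε → ε < Real.pi / 4 →
      BiharmonicSchrodinger.SmoothDecaying N T u →
      BiharmonicSchrodinger.IsSolution T u₀ g₀ g₁ u →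
      ∀ x y t : ℝ, 0 < y → 0 < t → t < T →
        ∃ A B : ℝ → ℂ,
          (∀ κ : ℝ, BiharmonicSchrodinger.HasRealLineIntegral
            (fun l => BiharmonicSchrodinger.E κ l x y t *
              BiharmonicSchrodinger.halfSpaceFT u₀ κ l) (A κ)) ∧
          (∀ κ : ℝ, BiharmonicSchrodinger.HasBoundaryIntegral κ
            (fun l => BiharmonicSchrodinger.E κ l x y t *
              BiharmonicSchrodinger.G ε u₀ g₀ g₁ κ l t) (B κ)) ∧
          (∀ κ : ℝ, BiharmonicSchrodinger.HasAsymptoticBoundaryIntegral κ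
            (fun l => BiharmonicSchrodinger.E κ l x y t *
              BiharmonicSchrodinger.G ε u₀ g₀ g₁ κ l t) (B κ)) ∧
          MeasureTheory.Integrable A MeasureTheory.volume ∧
          MeasureTheory.Integrable B MeasureTheory.volume ∧
          u (x, y, t) =
            1 / (2 * (Real.pi : ℂ)) ^ 2 * (∫ κ : ℝ, A κ) +
            1 / (2 * (Real.pi : ℂ)) ^ 2 * (∫ κ : ℝ, B κ) := by
  refine ⟨5, fun T u₀ g₀ g₁ u ε hT hε hε' hdecay hu x y t hy ht htT => ?_⟩
  have h := hdecay.smoothDecay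
  have htI : t ∈ Ioo 0 T := ⟨ht, htT⟩
  have htIcc := Ioo_subset_Icc_self htI
  obtain ⟨A, hA, hA_int⟩ := h.exists_initial_integral hT x y ht
  have hB := fun κ =>
    hu.hasBoundaryIntegral hT (h.mono (Nat.le_succ 4)) hε hε' x hy htI (hA κ)
  have hû_int := (h.integrable_exp_mul_xTransform hT x hy.le htIcc).const_mul (2 * (Real.pi : ℂ))
  refine ⟨A, _, fun κ => (hA κ).congr fun s => ?_, fun κ => (hB κ).1, fun κ => (hB κ).2, hA_int,
    hû_int.sub hA_int, ?_⟩
  · rw [BiharmonicSchrodinger.halfSpaceFT_eq_halfLineFT hT.le h.hasDecay hu.initial κ (by simp)]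
  · have hpi : (Real.pi : ℂ) ≠ 0 := Complex.ofReal_ne_zero.2 Real.pi_ne_zero
    rw [integral_sub hû_int hA_int, integral_const_mul,
      h.integral_exp_mul_xTransform hT x hy.le htIcc]
    field_simp
    ring
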